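/- Let $\mathcal X_d=\{-1,1\}^d$ and $\mathcal Y=\{-1,1\}$. For a distribution $\mathcal D$ on $\mathcal X_d\times\mathcal Y$ and a classifier $c:\mathcal X_d\to\mathcal Y$, let $\mathrm{err}_{\mathcal D}(c)=\Pr_{(x,y)\sim\mathcal D}[c(x)\neq y]$. Algorithms are deterministic multitape Turing machines over a fixed finite alphabet, with the input on the first tape and the output on the second. A learning algorithm gets a dataset in some dimension $d\ge 1$ and outputs the code of a Boolean circuit with $d$ inputs, which represents a classifier $\mathcal X_d\to\mathcal Y$; an output that is not the code of such a circuit represents the constant classifier $1$. For $s,k\in\mathbb N$ let $\mathcal B_{s,k}$ be the set of two-tape Turing machines with at most $s$ states that halt after at most $(2dm)^k$ steps on every dataset $Z\in(\mathcal X_d\times\mathcal Y)^m$, for all $d,m\ge1$; write $B(Z)$ for the classifier that $B$ outputs on $Z$. A learning algorithm $A$, which gets two datasets $Z;Z'$ (with a mark between them), is *$(s,k)$-Turing-optimal* if 1. it runs in polynomial time: there is a polynomial $q$ such that it halts after at most $q(d(m+M))$ steps on all $Z\in(\mathcal X_d\times\mathcal Y)^m$ and $Z'\in(\mathcal X_d\times\mathcal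 Y)^M$ with $d,m\ge1$ and $M\ge0$; and 2. there is a polynomial $p$ such that for all $\epsilon,\delta\in\{2^{-i}: i\in\mathbb N\}$, all $d,m\ge1$, all $M\ge p(d,m,1/\epsilon,1/\delta)$ and every distribution $\mathcal D$ on $\mathcal X_d\times\mathcal Y$, $$\Pr_{Z\sim\mathcal D^m,\,Z'\sim\mathcal D^M}\Bigl[\mathrm{err}_{\mathcal D}(A(Z;Z'))\le \mathrm{err}_{\mathcal D}(B(Z))+\epsilon\ \text{ for all } B\in\mathcal B_{s,k}\Bigr]\ge 1-\delta .$$ It is *Turing-optimal* if it is $(s,k)$-Turing-optimal for all $s,k\in\mathbb N$ (the polynomial $p$ may depend on $s,k$; the algorithm may not). **Claim.** Let $A$ be an algorithm that takes additional inputs $s,k$ (in unary), and write $A_{s,k}$ for $A$ with these inputs fixed. Suppose that $A_{s,k}$ is $(s,k)$-Turing-optimal for every pair of constants $s,k\ge 1$. Consider the following algorithm. On input $Z\in(\mathcal X_d\times\mathcal Y)^m$, $Z'\in(\mathcal X_d\times\mathcal Y)^M$ with $d,m\ge1$, $M\ge0$, put $r=\lfloor M^{1/10}\rfloor$. For $s=1,\dots,r$,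 for $k=1,\dots,r$ and for $t=1,\dots,r$, let $c_{s,k,t}$ be the output of $A_{s,k}$ on $Z;Z'[:t]$, where $Z'[:t]$ consists of the first $t$ examples of $Z'$, and where $A_{s,k}$ is run with a time limit of $M$ steps (if it does not halt in time, $c_{s,k,t}$ is the empty word, which represents the constant classifier $1$); let $\hat e_{s,k,t}$ be the fraction of the last $r$ examples of $Z'$ that $c_{s,k,t}$ misclassifies. Output the first $c_{s,k,t}$, in the order of the loops, that minimizes $\hat e_{s,k,t}$ (the empty word if $r=0$). Then this algorithm is Turing-optimal: some multitape Turing machine implements it (it halts with exactly this output on all such inputs) and is Turing-optimal; in particular, it runs in polynomial time. -/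

import Mathlib

open MeasureTheory

namespace AlgLearn

/-! ### Classifiers, data and errors

The labels `-1` and `1` are represented by `false` and `true`, so that `{-1,1}^d` is
`Fin d → Bool`. -/

/-- The hypercube `{-1,1}^d`. -/
abbrev Cube (d : ℕ) : Type := Fin d → Bool

/-- A labeled example in dimension `d`. -/
abbrev Example (d : ℕ) : Type := Cube d × Bool

/-- A finite dataset of labeled examples in dimension `d`, in order. -/
abbrev Dataset (d : ℕ) : Type := List (Example d)

/-- The error of a classifier: the probability that it mislabels an example drawn from `D`. -/
noncomputable def err {d : ℕ} (D : Measure (Example d)) (c : Cube d → Bool) : ℝ :=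
  D.real {z | c z.1 ≠ z.2}

/-- The empirical error of a classifier: the fraction of the dataset that it mislabels. -/
def empErr {d : ℕ} (c : Cube d → Bool) (S : Dataset d) : ℚ :=
  (S.countP fun z => c z.1 != z.2 : ℚ) / (S.length : ℚ)

/-! ### Turing machines -/

/-- The tape alphabet: the blank, the two signs, and two separators. -/
inductive Sym : Type
  | blank
  | neg
  | pos
  | sep
  | bar
  deriving DecidableEq

instance : Inhabited Sym := ⟨Sym.blank⟩

/-- A deterministic multitape Turing machine with `e + 2` two-way infinite tapes. Tape `0` holds
the input, the output is read from tape `1`, and the remaining `e` tapes are additional work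
tapes. In each step the machine reads the scanned symbols and changes its state, rewrites the
scanned symbols and moves each head to the left, to the right, or not at all (`none`).
The machine halts when the transition function is undefined (`none`). -/
structure Machine (e : ℕ) : Type 1 where
  State : Type
  [fintypeState : Fintype State]
  start : State
  trans : State → (Fin (e + 2) → Sym) → Option (State × (Fin (e + 2) → Sym × Option Turing.Dir))

attribute [instance] Machine.fintypeState

/-- The number of states of a machine. -/
def Machine.size {e : ℕ} (A : Machine e) : ℕ := Fintype.card A.State

/-- An instantaneous configuration: the state and the tapes (with the positions of the heads). -/
structure Machine.Cfg {e : ℕ} (A : Machine e) : Type where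
  state : A.State
  tape : Fin (e + 2) → Turing.Tape Sym

/-- Write a symbol, then move the head. -/
def act (T : Turing.Tape Sym) (a : Sym × Option Turing.Dir) : Turing.Tape Sym :=
  match a.2 with
  | none => T.write a.1
  | some dir => (T.write a.1).move dir

/-- One step; `none` if the machine has halted. -/
def Machine.step {e : ℕ} (A : Machine e) (c : A.Cfg) : Option A.Cfg :=
  (A.trans c.state fun i => (c.tape i).head).map fun p =>
    { state := p.1, tape := fun i => act (c.tape i) (p.2 i) }

/-- The initial configuration: the input is on tape `0`, the head on its first symbol, and all
other tapes are blank. -/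
def Machine.init {e : ℕ} (A : Machine e) (input : List Sym) : A.Cfg where
  state := A.start
  tape := fun i => if i = 0 then Turing.Tape.mk₁ input else Turing.Tape.mk₁ []

theorem takeWhile_append_blank (l : List Sym) (n : ℕ) :
    (l ++ List.replicate n Sym.blank).takeWhile (fun a => a != Sym.blank) =
      l.takeWhile (fun a => a != Sym.blank) := by
  induction l with
  | nil => cases n <;> simp [List.replicate_succ]
  | cons a l ih =>
    by_cases h : a = Sym.blank
    · simp [h]
    · simp [h, ih]

/-- The word on a tape: the symbols from the head to the right, up to the first blank. -/
def wordAt (T : Turing.Tape Sym) : List Sym :=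
  T.right₀.liftOn (fun l => l.takeWhile fun a => a != Sym.blank) (by
    rintro a b ⟨n, rfl⟩
    exact (takeWhile_append_blank a n).symm)

/-- The output of the computation from `c` if the machine halts after at most `t` steps; `none` if
it is still running after `t` steps. -/
def Machine.runFrom {e : ℕ} (A : Machine e) : ℕ → A.Cfg → Option (List Sym)
  | 0, c => match A.step c with
    | none => some (wordAt (c.tape 1))
    | some _ => none
  | t + 1, c => match A.step c with
    | none => some (wordAt (c.tape 1))
    | some c' => A.runFrom t c'

/-- Run the machine on an input with the time limit `t`. -/
def Machine.run {e : ℕ} (A : Machine e) (t : ℕ) (input : List Sym) : Option (List Sym) :=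
  A.runFrom t (A.init input)

open Classical in
/-- The output of the machine without a time limit (the empty word if it does not halt). -/
noncomputable def Machine.output {e : ℕ} (A : Machine e) (input : List Sym) : List Sym :=
  if h : ∃ w t, A.run t input = some w then h.choose else []

theorem Machine.runFrom_unique {e : ℕ} (A : Machine e) (t t' : ℕ) (c : A.Cfg) (w w' : List Sym)
    (h : A.runFrom t c = some w) (h' : A.runFrom t' c = some w') : w = w' := by
  induction t generalizing t' c with
  | zero =>
    cases t' <;> simp only [Machine.runFrom] at h h' <;> cases hc : A.step c <;> simp_all
  | succ t ih =>
    cases t' <;> simp only [Machine.runFrom] at h h' <;> cases hc : A.step c <;> simp_all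
    exact ih _ _ h h'

theorem Machine.output_eq {e : ℕ} (A : Machine e) (t : ℕ) (input w : List Sym)
    (h : A.run t input = some w) : A.output input = w := by
  have hex : ∃ w t, A.run t input = some w := ⟨w, t, h⟩
  rw [Machine.output, dif_pos hex]
  obtain ⟨t', ht'⟩ := hex.choose_spec
  exact A.runFrom_unique _ _ _ _ _ ht' h

/-! ### Boolean circuits -/

/-- A gate of a Boolean circuit. Its arguments are indices of wires: wires `0, …, d - 1` carry the
inputs, and the wire `d + i` carries the value of the gate number `i`. -/
inductive Gate : Type
  | and (i j : ℕ)
  | or (i j : ℕ)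
  | not (i : ℕ)

/-- The value of a gate, given the values of the earlier wires; `none` if the gate refers to a
wire that is not there. -/
def Gate.eval (wires : List Bool) : Gate → Option Bool
  | .and i j => (wires[i]?).bind fun a => (wires[j]?).map fun b => a && b
  | .or i j => (wires[i]?).bind fun a => (wires[j]?).map fun b => a || b
  | .not i => (wires[i]?).map fun a => !a

/-- The value of the last gate of a circuit, given the values of the wires that precede its first
gate. It is `none` if there is no gate, or some gate refers to a wire that does not precede it;
this depends on the number of the wires only, and not on their values. -/
def evalCircuit : List Gate → List Bool → Option Bool
  | [], _ => none
  | [g], wires => g.eval wires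
  | g :: g' :: gs, wires => (g.eval wires).bind fun b => evalCircuit (g' :: gs) (wires ++ [b])

/-- A number in unary, followed by a separator. -/
def unary (n : ℕ) : List Sym := List.replicate n Sym.pos ++ [Sym.sep]

/-- The code of a gate. -/
def Gate.code : Gate → List Sym
  | .and i j => Sym.pos :: (unary i ++ unary j)
  | .or i j => Sym.neg :: (unary i ++ unary j)
  | .not i => Sym.bar :: unary i

/-- The code of a circuit: the codes of its gates in order. -/
def codeCircuit (gs : List Gate) : List Sym := gs.flatMap Gate.code

theorem unary_append_inj (m n : ℕ) (u v : List Sym) (h : unary m ++ u = unary n ++ v) :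
    m = n ∧ u = v := by
  induction m generalizing n with
  | zero => cases n <;> simp_all [unary, List.replicate_succ]
  | succ m ih =>
    cases n with
    | zero => simp [unary, List.replicate_succ] at h
    | succ n =>
      have h' : unary m ++ u = unary n ++ v := by
        simpa [unary, List.replicate_succ] using h
      exact ⟨congrArg _ (ih n h').1, (ih n h').2⟩

theorem Gate.code_append_inj (g g' : Gate) (u v : List Sym) (h : g.code ++ u = g'.code ++ v) :
    g = g' ∧ u = v := by
  cases g <;> cases g' <;> simp only [Gate.code, List.cons_append, List.append_assoc,
    List.cons.injEq, reduceCtorEq, false_and, true_and] at h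
  case and.and i j i' j' =>
    obtain ⟨hi, h₁⟩ := unary_append_inj _ _ _ _ h
    obtain ⟨hj, h₂⟩ := unary_append_inj _ _ _ _ h₁
    exact ⟨by rw [hi, hj], h₂⟩
  case or.or i j i' j' =>
    obtain ⟨hi, h₁⟩ := unary_append_inj _ _ _ _ h
    obtain ⟨hj, h₂⟩ := unary_append_inj _ _ _ _ h₁
    exact ⟨by rw [hi, hj], h₂⟩
  case not.not i i' =>
    obtain ⟨hi, h₁⟩ := unary_append_inj _ _ _ _ h
    exact ⟨by rw [hi], h₁⟩

theorem codeCircuit_injective : Function.Injective codeCircuit := by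
  intro gs
  induction gs with
  | nil =>
    rintro (_ | ⟨g', gs'⟩) h
    · rfl
    · cases g' <;> simp [codeCircuit, Gate.code] at h
  | cons g gs ih =>
    rintro (_ | ⟨g', gs'⟩) h
    · cases g <;> simp [codeCircuit, Gate.code] at h
    · simp only [codeCircuit, List.flatMap_cons] at h
      obtain ⟨hg, h₁⟩ := Gate.code_append_inj _ _ _ _ h
      rw [hg, ih h₁]

open Classical in
/-- The classifier on `{-1,1}^d` that is represented by a word. If the word is the code of a valid
circuit with `d` inputs, then it is the function that the circuit computes. Any other word
represents the classifier that is constantly `1`. -/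
noncomputable def classifierOf (d : ℕ) (w : List Sym) (x : Cube d) : Bool :=
  if h : ∃ gs, codeCircuit gs = w then (evalCircuit h.choose (List.ofFn x)).getD true else true

theorem classifierOf_codeCircuit (d : ℕ) (gs : List Gate) (x : Cube d) :
    classifierOf d (codeCircuit gs) x = (evalCircuit gs (List.ofFn x)).getD true := by
  have h : ∃ gs', codeCircuit gs' = codeCircuit gs := ⟨gs, rfl⟩
  rw [classifierOf, dif_pos h, codeCircuit_injective h.choose_spec]

/-! ### Learning algorithms -/

/-- The symbol for a sign. -/
def signSym (b : Bool) : Sym := if b then Sym.pos else Sym.neg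

/-- The code of an example: its coordinates, its label, and a separator. -/
def codeExample {d : ℕ} (z : Example d) : List Sym :=
  (List.ofFn z.1).map signSym ++ [signSym z.2, Sym.sep]

/-- The code of a dataset. -/
def codeData {d : ℕ} (Z : Dataset d) : List Sym := Z.flatMap codeExample

/-- The code of the concatenation `Z;Z'`, with a mark between the two parts, so that the dimension
and both sizes can be determined. -/
def codeInput {d : ℕ} (Z Z' : Dataset d) : List Sym := codeData Z ++ Sym.bar :: codeData Z'

/-- The code of the additional inputs `s` and `k` of a learning algorithm. -/
def codeParams (s k : ℕ) : List Sym := unary s ++ unary k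

/-- The family `𝓑_{s,k}`: two-tape machines with at most `s` states that halt after at most
`(2dm)^k` steps on every dataset of `m` examples in dimension `d`. -/
def boundedMachines (s k : ℕ) : Set (Machine 0) :=
  {B | B.size ≤ s ∧ ∀ d : ℕ, 1 ≤ d → ∀ Z : Dataset d, 1 ≤ Z.length →
    (B.run ((2 * d * Z.length) ^ k) (codeData Z)).isSome}

/-- The algorithm `A`, with the additional inputs coded by the word `a`, runs in polynomial time:
on `m` examples `Z` and `M` additional examples `Z'` in dimension `d` it halts after at most
`q(d(m+M))` steps, for a polynomial `q`. -/
def PolyTime {e : ℕ} (A : Machine e) (a : List Sym) : Prop :=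
  ∃ q : Polynomial ℕ, ∀ d : ℕ, 1 ≤ d → ∀ Z Z' : Dataset d, 1 ≤ Z.length →
    (A.run (q.eval (d * (Z.length + Z'.length))) (a ++ codeInput Z Z')).isSome

/-- The algorithm `A`, with the additional inputs coded by the word `a`, is a poly-time learning
algorithm and a probably algorithmically optimal learner for the family `F`. The accuracy and the
failure probability are `ε = 2^(-i)` and `δ = 2^(-j)`. Comparing with every `B` in `F` is
comparing with the minimum of the errors over `F`. -/
def IsPAOLearner {e : ℕ} (A : Machine e) (a : List Sym) (F : Set (Machine 0)) : Prop :=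
  PolyTime A a ∧
  ∃ p : MvPolynomial (Fin 4) ℕ, ∀ i j d m M : ℕ, 1 ≤ d → 1 ≤ m →
    MvPolynomial.eval ![d, m, 2 ^ i, 2 ^ j] p ≤ M →
    ∀ (D : Measure (Example d)) [IsProbabilityMeasure D],
      1 - (1 / 2 : ℝ) ^ j ≤
        ((Measure.pi fun _ : Fin m => D).prod (Measure.pi fun _ : Fin M => D)).real
          {S | ∀ B ∈ F,
            err D (classifierOf d (A.output (a ++ codeInput (List.ofFn S.1) (List.ofFn S.2)))) ≤
              err D (classifierOf d (B.output (codeData (List.ofFn S.1)))) + (1 / 2 : ℝ) ^ i}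

/-- `(s,k)`-Turing-optimality of the algorithm `A` with the additional inputs coded by `a`. -/
def IsTuringOptimalFor (s k : ℕ) {e : ℕ} (A : Machine e) (a : List Sym) : Prop :=
  IsPAOLearner A a (boundedMachines s k)

/-- Turing-optimality of an algorithm (without additional inputs). -/
def IsTuringOptimal {e : ℕ} (A : Machine e) : Prop :=
  ∀ s k : ℕ, IsTuringOptimalFor s k A []

/-! ### The reduction -/

/-- The range `r = ⌊M^(1/10)⌋` of the loops. -/
noncomputable def loopBound (M : ℕ) : ℕ := ⌊(M : ℝ) ^ (1 / 10 : ℝ)⌋₊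

/-- The triples `(s,k,t)` with entries in `{1, …, r}`, in the order of the nested loops. -/
def triples (r : ℕ) : List (ℕ × ℕ × ℕ) :=
  (List.range' 1 r).flatMap fun s => (List.range' 1 r).flatMap fun k =>
    (List.range' 1 r).map fun t => (s, k, t)

/-- The candidate `c_{s,k,t}`: the output of `A` with inputs `s, k` on `Z;Z'[:t]`, with the time
limit `M`. If the time limit is exceeded, then it is the empty word, which is not a circuit and so
stands for the constant classifier `1`. -/
def candidate {e : ℕ} (A : Machine e) {d : ℕ} (Z Z' : Dataset d) (v : ℕ × ℕ × ℕ) : List Sym :=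
  (A.run Z'.length (codeParams v.1 v.2.1 ++ codeInput Z (Z'.take v.2.2))).getD []

/-- The reduction: among the candidates `c_{s,k,t}` with `1 ≤ s, k, t ≤ r`, output the first one
that minimizes the empirical error on the last `r` examples of `Z'` (the empty word if there is
no candidate). -/
noncomputable def reduction {e : ℕ} (A : Machine e) {d : ℕ} (Z Z' : Dataset d) : List Sym :=
  let r := loopBound Z'.length
  match (triples r).argmin
    (fun v => empErr (classifierOf d (candidate A Z Z' v)) (Z'.rtake r)) with
  | none => []
  | some v => candidate A Z Z' v

/-- The machine `U` implements the reduction applied to `A`. -/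
def ImplementsReduction {e e' : ℕ} (U : Machine e') (A : Machine e) : Prop :=
  ∀ d : ℕ, 1 ≤ d → ∀ Z Z' : Dataset d, 1 ≤ Z.length →
    ∃ t : ℕ, U.run t (codeInput Z Z') = some (reduction A Z Z')

end AlgLearn

open AlgLearn

namespace AlgLearn

/-! ### A structured language for stack programs -/

/-! The claim has a statistical half and a computational half.

Statistics: let `t = p(d, m, 2/ε, 2/δ) + 1`. By the optimality of `A_{s,k}`, with probability at
least `1 - δ/2` its output on `Z` and the first `t` examples of `Z'` is within `ε/2` of every
competitor. If `M` is large, then `s, k, t ≤ r` and the time limit `M` is not exceeded, so this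
output is one of the candidates. Every candidate depends only on `Z` and on at most `r ≤ M - r`
initial examples of `Z'`; given these, the last `r` examples are a fresh sample. Hoeffding's
inequality (`measureReal_err_deviation_le`) and a union bound over the `r³` candidates
(`measureReal_tests_le`) show that all empirical errors are within `ε/4` of the true ones, except
with probability `2 r³ exp(-rε²/8)`, which is at most `δ/2` once `r` is polynomially large in `1/ε`
and `1/δ` (`test_failure_le`). Then the empirical minimizer loses at most `2 · ε/4` against
`c_{s,k,t}` (`err_reduction_le`), in total at most `ε` (`le_measureReal_reduction`). Since `r` is
about `M^(1/10)`, a polynomial lower bound on `r` is a polynomial lower bound on `M`.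

Computation: a single machine has to run the loops, simulate `A` with a clock, evaluate circuits and
compare error counts. It is written as a structured program over stacks, together with raw tapes
that carry the tapes of `A`. A stack is a tape whose content starts at the head, and each
instruction costs a constant number of machine steps, so the time bounds of programs are time bounds
of machines (`Exec.exits`, `exists_machine`). Three points need an argument: a circuit can be
evaluated while its code is read letter by letter, and malformed words are detected on the way
(`classifierOf_eq_scan`); the simulated tapes can be blanked after each run, because a machine with
limited time visits few cells (`Supp.erase`); and the range `r` is found by counting the `i ≤ M`
with `i^10 ≤ M` (`foldl_loopBound`). The loops then perform a running minimum, which is the `argmin`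
in the definition of the reduction (`foldl_argmin`). -/

/-- The nonblank symbols. -/
inductive Letter : Type
  | neg
  | pos
  | sep
  | bar
  deriving DecidableEq

/-- The tape symbol of a letter. -/
def Letter.sym : Letter → Sym
  | .neg => .neg
  | .pos => .pos
  | .sep => .sep
  | .bar => .bar

/-- The letter of a tape symbol; `none` for the blank. -/
def Sym.letter : Sym → Option Letter
  | .blank => none
  | .neg => some .neg
  | .pos => some .pos
  | .sep => some .sep
  | .bar => some .bar

@[simp] theorem Letter.letter_sym (a : Letter) : a.sym.letter = some a := by cases a <;> rfl

@[simp] theorem Sym.letter_blank : Sym.blank.letter = none := rfl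

@[simp] theorem Letter.sym_ne_blank (a : Letter) : a.sym ≠ Sym.blank := by cases a <;> simp [sym]

theorem Letter.sym_injective : Function.Injective Letter.sym := by
  intro a b h
  simpa using congrArg Sym.letter h

@[simp] theorem default_sym : (default : Sym) = Sym.blank := rfl

/-- What a program sees: its register, the tops of the stacks, and the scanned symbols of the raw
tapes. -/
structure View (R V τ : Type) where
  reg : R
  top : V → Option Letter
  scan : τ → Sym

/-- The effect of a basic instruction: the new register, the letters to be pushed, and the actions
on the raw tapes. -/
structure Effect (R V τ : Type) where
  reg : R
  out : V → Letter
  act : τ → Sym × Option Turing.Dir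

/-- A structured program with a finite register `R`, stacks `V` and raw tapes `τ`. The instruction
`op P Q F` pushes on the stacks in `P`, pops the other stacks in `Q`, and acts on the raw tapes. -/
inductive Prog (R V τ : Type) : Type
  | op (P Q : V → Bool) (F : View R V τ → Effect R V τ)
  | seq (p q : Prog R V τ)
  | ite (c : View R V τ → Bool) (p q : Prog R V τ)
  | loop (c : View R V τ → Bool) (p : Prog R V τ)

/-- The state of a structured program. -/
@[ext] structure St (R V τ : Type) where
  reg : R
  var : V → List Letter
  tape : τ → Turing.Tape Sym

variable {R V τ : Type}

/-- What a program sees in a state. -/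
def St.view (s : St R V τ) : View R V τ where
  reg := s.reg
  top z := (s.var z).head?
  scan i := (s.tape i).head

/-- What an instruction sees that pushes on the stacks in `P`. -/
def St.mask (s : St R V τ) (P : V → Bool) : View R V τ where
  reg := s.reg
  top z := if P z then none else (s.var z).head?
  scan i := (s.tape i).head

/-- The effect of a basic instruction on the state. -/
def St.app (s : St R V τ) (P Q : V → Bool) (F : View R V τ → Effect R V τ) : St R V τ where
  reg := (F (s.mask P)).reg
  var z := if P z then (F (s.mask P)).out z :: s.var z else if Q z then (s.var z).tail else s.var z
  tape i := AlgLearn.act (s.tape i) ((F (s.mask P)).act i)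

/-- Big-step semantics with the exact number of machine steps. -/
inductive Exec : Prog R V τ → St R V τ → ℕ → St R V τ → Prop
  | op (P Q F) (s : St R V τ) : Exec (.op P Q F) s 2 (s.app P Q F)
  | seq {p q s t s' t' s''} : Exec p s t s' → Exec q s' t' s'' → Exec (.seq p q) s (t + t') s''
  | ite_true {c : View R V τ → Bool} {p q s t s'} : c s.view = true → Exec p s t s' →
      Exec (.ite c p q) s (t + 1) s'
  | ite_false {c : View R V τ → Bool} {p q s t s'} : c s.view = false → Exec q s t s' →
      Exec (.ite c p q) s (t + 1) s'
  | loop_false {c : View R V τ → Bool} {p s} : c s.view = false → Exec (.loop c p) s 1 s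
  | loop_true {c : View R V τ → Bool} {p s t s' t' s''} : c s.view = true → Exec p s t s' →
      Exec (.loop c p) s' t' s'' → Exec (.loop c p) s (t + t' + 1) s''

/-! ### Compilation to a machine -/

/-- The control points of a program. -/
def Prog.Pt : Prog R V τ → Type
  | .op _ _ _ => Bool
  | .seq p q => p.Pt ⊕ q.Pt
  | .ite _ p q => Option (p.Pt ⊕ q.Pt)
  | .loop _ p => Option p.Pt

theorem Prog.finite_pt (p : Prog R V τ) : Finite p.Pt := by
  induction p with
  | op P Q F => exact inferInstanceAs (Finite Bool)
  | seq p q hp hq => exact inferInstanceAs (Finite (p.Pt ⊕ q.Pt))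
  | ite c p q hp hq => exact inferInstanceAs (Finite (Option (p.Pt ⊕ q.Pt)))
  | loop c p hp => exact inferInstanceAs (Finite (Option p.Pt))

/-- The control point where a program starts. -/
def Prog.entry : (p : Prog R V τ) → p.Pt
  | .op _ _ _ => false
  | .seq p _ => Sum.inl p.entry
  | .ite _ _ _ => none
  | .loop _ _ => none

/-- Leave the scanned symbols as they are. -/
def idle {ι : Type} (h : ι → Sym) : ι → Sym × Option Turing.Dir := fun i => (h i, none)

/-- What a program sees, given its register and the scanned symbols. -/
def viewOf (r : R) (h : V ⊕ τ → Sym) : View R V τ where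
  reg := r
  top z := (h (Sum.inl z)).letter
  scan i := h (Sum.inr i)

/-- The transitions of a program; it exits when there is no next control point. -/
def Prog.next : (p : Prog R V τ) → p.Pt → R → (V ⊕ τ → Sym) →
    Option p.Pt × R × (V ⊕ τ → Sym × Option Turing.Dir)
  | .op P Q F, b, r, h => match b with
    | false => (some true, r, fun i => match i with
      | Sum.inl z => (h i, if P z then some .left else none)
      | Sum.inr _ => (h i, none))
    | true => (none, (F (viewOf r h)).reg, fun i => match i with
      | Sum.inl z => if P z then (((F (viewOf r h)).out z).sym, none) else
          if Q z then (Sym.blank, some .right) else (h i, none)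
      | Sum.inr i => (F (viewOf r h)).act i)
  | .seq p q, l, r, h => match l with
    | Sum.inl l => (some (((p.next l r h).1.map Sum.inl).getD (Sum.inr q.entry)), (p.next l r h).2)
    | Sum.inr l => ((q.next l r h).1.map Sum.inr, (q.next l r h).2)
  | .ite c p q, l, r, h => match l with
    | none => (some (some (if c (viewOf r h) then Sum.inl p.entry else Sum.inr q.entry)),
        r, idle h)
    | some (Sum.inl l) => ((p.next l r h).1.map (some ∘ Sum.inl), (p.next l r h).2)
    | some (Sum.inr l) => ((q.next l r h).1.map (some ∘ Sum.inr), (q.next l r h).2)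
  | .loop c p, l, r, h => match l with
    | none => (if c (viewOf r h) then some (some p.entry) else none, r, idle h)
    | some l => (some (p.next l r h).1, (p.next l r h).2)

/-- A register together with tapes. -/
abbrev Conf (R V τ : Type) : Type := R × (V ⊕ τ → Turing.Tape Sym)

/-- One step of a program. -/
def Prog.go (p : Prog R V τ) (l : p.Pt) (c : Conf R V τ) : Option p.Pt × Conf R V τ :=
  let o := p.next l c.1 fun i => (c.2 i).head
  (o.1, o.2.1, fun i => act (c.2 i) (o.2.2 i))

/-- A program exits after exactly `t` steps. -/
inductive Prog.Exits (p : Prog R V τ) : p.Pt → Conf R V τ → ℕ → Conf R V τ → Prop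
  | last {l c c'} : p.go l c = (none, c') → p.Exits l c 1 c'
  | more {l c l' c' t c''} : p.go l c = (some l', c') → p.Exits l' c' t c'' →
      p.Exits l c (t + 1) c''

@[simp] theorem act_head (T : Turing.Tape Sym) : act T (T.head, none) = T := by
  simp [act, Turing.Tape.write_self]

/-- The machine configuration of a state. -/
def St.conf (s : St R V τ) : Conf R V τ :=
  (s.reg, Sum.elim (fun z => Turing.Tape.mk₁ ((s.var z).map Letter.sym)) s.tape)

theorem letter_head_mk₁ (w : List Letter) :
    (Turing.Tape.mk₁ (w.map Letter.sym)).head.letter = w.head? := by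
  cases w <;> simp [Turing.Tape.mk₁, Turing.Tape.mk₂]

theorem viewOf_conf (s : St R V τ) : viewOf s.conf.1 (fun i => (s.conf.2 i).head) = s.view := by
  simp [viewOf, St.conf, St.view, letter_head_mk₁]

/-- Erasing before the move keeps the left half of the tape blank, so the tape still has the form
`mk₁`. Popping an empty stack is harmless. -/
theorem act_pop (w : List Letter) :
    act (Turing.Tape.mk₁ (w.map Letter.sym)) (Sym.blank, some .right) =
      Turing.Tape.mk₁ (w.tail.map Letter.sym) := by
  have h : (Turing.ListBlank.mk [Sym.blank] : Turing.ListBlank Sym) = Turing.ListBlank.mk [] :=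
    Quotient.sound' (Or.inr ⟨1, rfl⟩)
  cases w <;> simp [act, Turing.Tape.mk₁, Turing.Tape.mk₂, Turing.Tape.write_mk',
    Turing.Tape.move_right_mk', Turing.ListBlank.cons_mk, h]

theorem head_move_left (w : List Sym) : ((Turing.Tape.mk₁ w).move .left).head = Sym.blank := by
  simp [Turing.Tape.mk₁, Turing.Tape.mk₂, Turing.Tape.move_left_mk']

theorem write_move_left (w : List Sym) (a : Sym) :
    ((Turing.Tape.mk₁ w).move .left).write a = Turing.Tape.mk₁ (a :: w) := by
  simp [Turing.Tape.mk₁, Turing.Tape.mk₂, Turing.Tape.move_left_mk', Turing.Tape.write_mk']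

theorem act_left (T : Turing.Tape Sym) : act T (T.head, some .left) = T.move .left := by
  simp [act, Turing.Tape.write_self]

theorem act_none (T : Turing.Tape Sym) (a : Sym) : act T (a, none) = T.write a := rfl

/-- The map `g` places the control points of the part `p` in the whole `q`, and `x` says what
follows when `p` exits: `none` if `q` exits as well, `some m` if `q` continues at `m`. Every
composite construct is an instance. -/
theorem Prog.Exits.embed {p q : Prog R V τ} (g : p.Pt → q.Pt) (x : Option q.Pt)
    (hg : ∀ l c, q.go (g l) c = (((p.go l c).1.map (some ∘ g)).getD x, (p.go l c).2))
    {l c t c'} (h : p.Exits l c t c') :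
    (x = none → q.Exits (g l) c t c') ∧
      ∀ m, x = some m → ∀ t' c'', q.Exits m c' t' c'' → q.Exits (g l) c (t + t') c'' := by
  induction h with
  | @last l c c' h1 =>
    have h2 := hg l c
    rw [h1] at h2
    refine ⟨fun hx => .last (h2.trans (by simp [hx])), fun m hm t' c'' h => ?_⟩
    rw [add_comm]
    exact .more (h2.trans (by simp [hm])) h
  | @more l c l' c' t c'' h1 _ ih =>
    have h2 := hg l c
    rw [h1] at h2
    refine ⟨fun hx => .more (h2.trans (by simp)) (ih.1 hx), fun m hm t' c'' h => ?_⟩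
    rw [add_right_comm]
    exact .more (h2.trans (by simp)) (ih.2 m hm _ _ h)

/-- Induction on the execution. For composite programs, the parts are placed in the whole by
`Prog.Exits.embed`, and each test of a condition is one idle step. -/
theorem Exec.exits {p : Prog R V τ} {s s' : St R V τ} {t : ℕ} (h : Exec p s t s') :
    p.Exits p.entry s.conf t s'.conf := by
  induction h with
  | op P Q F s =>
    -- After the first of the two steps, the heads of the stacks in `P` stand on the blank to the
    -- left of the content. So the second step sees no top there, which is the reason for `St.mask`.
    refine Prog.Exits.more (p := .op P Q F) (l' := true) (c' := (s.reg, fun i => match i with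
      | Sum.inl z => if P z then (s.conf.2 (Sum.inl z)).move .left else s.conf.2 (Sum.inl z)
      | Sum.inr i => s.tape i)) ?_ (.last ?_)
    · simp only [Prog.go, Prog.entry, Prog.next, Prod.mk.injEq]
      refine ⟨trivial, rfl, ?_⟩
      funext i
      rcases i with z | i
      · by_cases h : P z <;> simp [h, act_left]
      · simp [St.conf]
    · have hv : viewOf s.reg (fun i => (((match i with
          | Sum.inl z => if P z then (s.conf.2 (Sum.inl z)).move .left else s.conf.2 (Sum.inl z)
          | Sum.inr i => s.tape i : Turing.Tape Sym)).head)) = s.mask P := by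
        simp only [viewOf, St.mask, View.mk.injEq, true_and, and_true]
        funext z
        by_cases h : P z <;> simp [h, St.conf, head_move_left, letter_head_mk₁]
      simp only [Prog.go, Prog.next, Prod.mk.injEq, hv]
      refine ⟨trivial, Prod.ext rfl ?_⟩
      funext i
      rcases i with z | i
      · by_cases h : P z
        · simp [h, St.conf, St.app, act_none, write_move_left]
        · by_cases h' : Q z <;> simp [h, h', St.conf, St.app, act_pop]
      · simp [St.conf, St.app]
  | @seq p q s t s' t' s'' h1 h2 ih1 ih2 =>
    refine (ih1.embed (q := .seq p q) Sum.inl (some (Sum.inr q.entry)) fun l c => ?_).2 _ rfl _ _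
      ((ih2.embed (q := .seq p q) Sum.inr none fun l c => ?_).1 rfl)
    · simp only [Prog.go, Prog.next]
      cases (p.next l c.1 fun i => (c.2 i).head).1 <;> rfl
    · simp only [Prog.go, Prog.next]
      cases (q.next l c.1 fun i => (c.2 i).head).1 <;> rfl
  | @ite_true b p q s t s' hc h ih =>
    refine Prog.Exits.more (p := .ite b p q) (l' := some (Sum.inl p.entry)) (c' := s.conf) ?_
      ((ih.embed (q := .ite b p q) (fun l => some (Sum.inl l)) none fun l c => ?_).1 rfl)
    · simp [Prog.go, Prog.entry, Prog.next, viewOf_conf, hc, idle]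
    · simp only [Prog.go, Prog.next]
      cases (p.next l c.1 fun i => (c.2 i).head).1 <;> rfl
  | @ite_false b p q s t s' hc h ih =>
    refine Prog.Exits.more (p := .ite b p q) (l' := some (Sum.inr q.entry)) (c' := s.conf) ?_
      ((ih.embed (q := .ite b p q) (fun l => some (Sum.inr l)) none fun l c => ?_).1 rfl)
    · simp [Prog.go, Prog.entry, Prog.next, viewOf_conf, hc, idle]
    · simp only [Prog.go, Prog.next]
      cases (q.next l c.1 fun i => (c.2 i).head).1 <;> rfl
  | loop_false hc =>
    refine .last ?_
    simp [Prog.go, Prog.entry, Prog.next, viewOf_conf, hc, idle]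
  | @loop_true b p s t s' t' s'' hc h1 h2 ih1 ih2 =>
    refine Prog.Exits.more (p := .loop b p) (l' := some p.entry) (c' := s.conf) ?_
      ((ih1.embed (q := .loop b p) some (some none) fun l c => ?_).2 _ rfl _ _ ih2)
    · simp [Prog.go, Prog.entry, Prog.next, viewOf_conf, hc, idle]
    · simp only [Prog.go, Prog.next]
      cases (p.next l c.1 fun i => (c.2 i).head).1 <;> rfl

/-- The machine of a program, given an enumeration of its tapes and its initial register. -/
noncomputable def Prog.machine [Finite R] (p : Prog R V τ) {n : ℕ} (f : Fin (n + 2) ≃ V ⊕ τ)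
    (r : R) : Machine n :=
  haveI := p.finite_pt
  -- The control point `none` is the halting state; it is entered when the program exits.
  { State := Option p.Pt × R
    fintypeState := Fintype.ofFinite _
    start := (some p.entry, r)
    trans := fun q h => q.1.map fun l =>
      (((p.next l q.2 fun i => h (f.symm i)).1, (p.next l q.2 fun i => h (f.symm i)).2.1),
        fun i => (p.next l q.2 fun i => h (f.symm i)).2.2 (f i)) }

theorem Prog.Exits.runFrom [Finite R] {p : Prog R V τ} {n : ℕ} {f : Fin (n + 2) ≃ V ⊕ τ}
    {r : R} {l : p.Pt} {c : Conf R V τ} {t : ℕ} {c' : Conf R V τ} (h : p.Exits l c t c') :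
    (p.machine f r).runFrom t ⟨(some l, c.1), fun i => c.2 (f i)⟩ =
      some (wordAt (c'.2 (f 1))) := by
  induction h with
  | last h1 =>
    simp only [Prog.go, Prod.mk.injEq] at h1
    simp only [Machine.runFrom, Machine.step, Prog.machine, Option.map_some,
      Equiv.apply_symm_apply, h1.1]
    simp [← h1.2]
  | more h1 h2 ih =>
    simp only [Prog.go, Prod.mk.injEq] at h1
    rw [Machine.runFrom, ← ih]
    simp only [Machine.step, Prog.machine, Option.map_some, Equiv.apply_symm_apply, h1.1]
    simp [← h1.2]

theorem takeWhile_map_sym (w : List Letter) :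
    (w.map Letter.sym).takeWhile (fun a => a != Sym.blank) = w.map Letter.sym := by
  rw [List.takeWhile_eq_self_iff]
  simp

theorem wordAt_mk₁ (w : List Sym) :
    wordAt (Turing.Tape.mk₁ w) = w.takeWhile (fun a => a != Sym.blank) := by
  unfold wordAt Turing.Tape.mk₁ Turing.Tape.mk₂
  rw [Turing.Tape.mk'_right₀]
  rfl

/-- Two transpositions correct an arbitrary enumeration; the second one does not move `a`, as
neither of the points it exchanges is `a`. This puts the input stack on tape `0` and the output
stack on tape `1`. -/
theorem exists_equiv_fin {X : Type} [Fintype X] [DecidableEq X] (n : ℕ)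
    (h : Fintype.card X = n + 2) (a b : X) (hab : a ≠ b) :
    ∃ f : Fin (n + 2) ≃ X, f 0 = a ∧ f 1 = b := by
  let f₀ : Fin (n + 2) ≃ X := (Fintype.equivFinOfCardEq h).symm
  let f₁ := f₀.trans (Equiv.swap (f₀ 0) a)
  have h0 : f₁ 0 = a := by simp [f₁]
  refine ⟨f₁.trans (Equiv.swap (f₁ 1) b), ?_, by simp⟩
  have h1 : f₁ 1 ≠ a := by rw [← h0]; exact fun h => by simpa using f₁.injective h
  simp only [Equiv.trans_apply, h0]
  exact Equiv.swap_apply_of_ne_of_ne h1.symm hab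

/-- A program that computes a word from a word, as a machine. -/
theorem exists_machine [Finite R] [Fintype V] [DecidableEq V] [Fintype τ] [DecidableEq τ]
    (p : Prog R V τ) (r : R) (inp out : V) (hio : inp ≠ out) :
    ∃ (n : ℕ) (U : Machine n), ∀ (w : List Letter) (t : ℕ) (s' : St R V τ),
      Exec p ⟨r, Function.update (fun _ => []) inp w, fun _ => Turing.Tape.mk₁ []⟩ t s' →
      U.run t (w.map Letter.sym) = some ((s'.var out).map Letter.sym) := by
  have h2 : 2 ≤ Fintype.card (V ⊕ τ) :=
    Fintype.one_lt_card_iff.2 ⟨Sum.inl inp, Sum.inl out, by simpa using hio⟩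
  obtain ⟨n, hn⟩ := Nat.exists_eq_add_of_le' h2
  obtain ⟨f, hf0, hf1⟩ := exists_equiv_fin n hn (Sum.inl inp) (Sum.inl out)
    (by simpa using hio)
  refine ⟨n, p.machine f r, fun w t s' h => ?_⟩
  have := h.exits.runFrom (f := f) (r := r)
  rw [hf1] at this
  simp only [St.conf, Sum.elim_inl, wordAt_mk₁, takeWhile_map_sym] at this
  rw [← this, Machine.run]
  congr 1
  simp only [Machine.init]
  congr 1
  funext i
  by_cases hi : i = 0
  · simp [hi, hf0]
  · have : f i ≠ Sum.inl inp := by rw [← hf0]; exact fun h => hi (f.injective h)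
    rcases hfi : f i with z | j
    · have hz : z ≠ inp := by rintro rfl; exact this hfi
      simp [hi, hz]
    · simp [hi]

variable {R V τ : Type}

/-! ### Bounded execution -/

/-- The program leads from `s` to `s'` in at most `T` steps. -/
def Run (p : Prog R V τ) (s : St R V τ) (T : ℕ) (s' : St R V τ) : Prop := ∃ t ≤ T, Exec p s t s'

theorem Run.cast {p : Prog R V τ} {s s₁ s₂ : St R V τ} {T₁ T₂ : ℕ} (h : Run p s T₁ s₁)
    (hT : T₁ ≤ T₂) (hs : s₁ = s₂) : Run p s T₂ s₂ := by
  obtain ⟨t, ht, h⟩ := h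
  exact ⟨t, ht.trans hT, hs ▸ h⟩

theorem Run.congr {p : Prog R V τ} {s s₁ s' : St R V τ} {T : ℕ} (h : Run p s T s') (hs : s = s₁) :
    Run p s₁ T s' := hs ▸ h

theorem Run.seq {p q : Prog R V τ} {s s' s'' : St R V τ} {T T' : ℕ} (h : Run p s T s')
    (h' : Run q s' T' s'') : Run (.seq p q) s (T + T') s'' := by
  obtain ⟨t, ht, h⟩ := h
  obtain ⟨t', ht', h'⟩ := h'
  exact ⟨t + t', by omega, .seq h h'⟩

theorem Run.ite_true {c : View R V τ → Bool} {p q : Prog R V τ} {s s' : St R V τ} {T : ℕ}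
    (hc : c s.view = true) (h : Run p s T s') : Run (.ite c p q) s (T + 1) s' := by
  obtain ⟨t, ht, h⟩ := h
  exact ⟨t + 1, by omega, .ite_true hc h⟩

theorem Run.ite_false {c : View R V τ → Bool} {p q : Prog R V τ} {s s' : St R V τ} {T : ℕ}
    (hc : c s.view = false) (h : Run q s T s') : Run (.ite c p q) s (T + 1) s' := by
  obtain ⟨t, ht, h⟩ := h
  exact ⟨t + 1, by omega, .ite_false hc h⟩

theorem Run.ite {c : View R V τ → Bool} {p q : Prog R V τ} {s s' : St R V τ} {T : ℕ}
    (h₁ : c s.view = true → Run p s T s') (h₂ : c s.view = false → Run q s T s') :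
    Run (.ite c p q) s (T + 1) s' := by
  cases hc : c s.view
  · exact .ite_false hc (h₂ hc)
  · exact .ite_true hc (h₁ hc)

theorem Run.loop_false {c : View R V τ → Bool} {p : Prog R V τ} {s : St R V τ}
    (hc : c s.view = false) : Run (.loop c p) s 1 s := ⟨1, le_rfl, .loop_false hc⟩

theorem Run.loop_true {c : View R V τ → Bool} {p : Prog R V τ} {s s' s'' : St R V τ} {T T' : ℕ}
    (hc : c s.view = true) (h : Run p s T s') (h' : Run (.loop c p) s' T' s'') :
    Run (.loop c p) s (T + T' + 1) s'' := by
  obtain ⟨t, ht, h⟩ := h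
  obtain ⟨t', ht', h'⟩ := h'
  exact ⟨t + t' + 1, by omega, .loop_true hc h h'⟩

/-- A loop that consumes a list and folds it, with an invariant. -/
theorem Run.foldl {α β : Type*} {c : View R V τ → Bool} {p : Prog R V τ}
    (S : β → List α → St R V τ) (φ : β → α → β) (I : β → List α → Prop) (T : ℕ)
    (hI : ∀ b a l, I b (a :: l) → I (φ b a) l)
    (hc : ∀ b a l, I b (a :: l) → c (S b (a :: l)).view = true)
    (hstep : ∀ b a l, I b (a :: l) → Run p (S b (a :: l)) T (S (φ b a) l))
    (hend : ∀ b, I b [] → c (S b []).view = false) (b : β) (l : List α) (h : I b l) :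
    Run (.loop c p) (S b l) (l.length * (T + 1) + 1) (S (l.foldl φ b) []) := by
  induction l generalizing b with
  | nil => exact (Run.loop_false (hend b h)).cast (by simp) rfl
  | cons a l ih =>
    refine ((hstep b a l h).loop_true (hc b a l h) (ih _ (hI b a l h))).cast ?_ rfl
    simp only [List.length_cons]
    ring_nf
    omega

/-- A counting loop. -/
theorem Run.range' {β : Type*} {c : View R V τ → Bool} {p : Prog R V τ}
    (S : β → ℕ → ℕ → St R V τ) (φ : β → ℕ → β) (I : β → Prop) (T r : ℕ)
    (hI : ∀ b j, j < r → I b → I (φ b (j + 1)))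
    (hc : ∀ b j n, c (S b j (n + 1)).view = true)
    (hstep : ∀ b j n, j + n + 1 = r → I b → Run p (S b j (n + 1)) T (S (φ b (j + 1)) (j + 1) n))
    (hend : ∀ b j, c (S b j 0).view = false) (b : β) (h : I b) :
    Run (.loop c p) (S b 0 r) (r * (T + 1) + 1) (S ((List.range' 1 r).foldl φ b) r 0) := by
  -- The induction is on the number `n` of remaining rounds, with an arbitrary number `j` of
  -- completed ones.
  suffices H : ∀ n j b, I b → j + n = r → Run (.loop c p) (S b j n) (n * (T + 1) + 1)
      (S ((List.range' (j + 1) n).foldl φ b) r 0) from H r 0 b h (by simp)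
  intro n
  induction n with
  | zero =>
    rintro j b - hj
    rw [← (show j = r by omega)]
    exact (Run.loop_false (hend b j)).cast (by simp) rfl
  | succ n ih =>
    intro j b hb hj
    refine ((hstep b j n hj hb).loop_true (hc b j n)
      (ih (j + 1) _ (hI b j (by omega) hb) (by omega))).cast ?_ rfl
    ring_nf
    omega

/-! ### Basic instructions -/

theorem St.ext' {s s' : St R V τ} (hr : s.reg = s'.reg) (ht : s.tape = s'.tape)
    (hv : ∀ z, s.var z = s'.var z) : s = s' := St.ext hr (funext hv) ht

/-- Set the content of a stack. -/
def St.set [DecidableEq V] (s : St R V τ) (z : V) (w : List Letter) : St R V τ :=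
  { s with var := Function.update s.var z w }

/-- Set the register. -/
def St.setReg (s : St R V τ) (r : R) : St R V τ := { s with reg := r }

/-- Set the raw tapes. -/
def St.setTape (s : St R V τ) (T : τ → Turing.Tape Sym) : St R V τ := { s with tape := T }

section

@[simp] theorem St.setReg_reg (s : St R V τ) (r) : (s.setReg r).reg = r := rfl
@[simp] theorem St.setReg_var (s : St R V τ) (r) : (s.setReg r).var = s.var := rfl
@[simp] theorem St.setReg_tape (s : St R V τ) (r) : (s.setReg r).tape = s.tape := rfl
@[simp] theorem St.setTape_reg (s : St R V τ) (T) : (s.setTape T).reg = s.reg := rfl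
@[simp] theorem St.setTape_var (s : St R V τ) (T) : (s.setTape T).var = s.var := rfl
@[simp] theorem St.setTape_tape (s : St R V τ) (T) : (s.setTape T).tape = T := rfl
@[simp] theorem St.view_top (s : St R V τ) (z) : s.view.top z = (s.var z).head? := rfl
@[simp] theorem St.view_reg (s : St R V τ) : s.view.reg = s.reg := rfl
@[simp] theorem St.view_scan (s : St R V τ) (i) : s.view.scan i = (s.tape i).head := rfl

variable [DecidableEq V]

@[simp] theorem St.set_reg (s : St R V τ) (z : V) (w) : (s.set z w).reg = s.reg := rfl
@[simp] theorem St.set_tape (s : St R V τ) (z : V) (w) : (s.set z w).tape = s.tape := rfl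
theorem St.set_var (s : St R V τ) (z : V) (w) (z' : V) :
    (s.set z w).var z' = if z' = z then w else s.var z' := Function.update_apply ..
@[simp] theorem St.set_var_self (s : St R V τ) (z : V) (w) : (s.set z w).var z = w := by
  simp [St.set_var]
theorem St.set_self (s : St R V τ) (z : V) : s.set z (s.var z) = s := by simp [St.set]
@[simp] theorem St.set_set (s : St R V τ) (z : V) (w w') : (s.set z w).set z w' = s.set z w' := by
  simp [St.set]
end

/-- Do nothing but push a letter. -/
def View.emit (v : View R V τ) (a : Letter) : Effect R V τ where
  reg := v.reg
  out _ := a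
  act := idle v.scan

namespace Prog

/-- Do nothing. -/
def skip : Prog R V τ := op (fun _ => false) (fun _ => false) fun v => v.emit .pos

/-- Change the register. -/
def assign (f : View R V τ → R) : Prog R V τ :=
  op (fun _ => false) (fun _ => false) fun v => { v.emit .pos with reg := f v }

variable [DecidableEq V]

/-- Push a letter. -/
def push (z : V) (a : Letter) : Prog R V τ :=
  op (fun z' => decide (z' = z)) (fun _ => false) fun v => v.emit a

/-- Pop a letter. -/
def pop (z : V) : Prog R V τ :=
  op (fun _ => false) (fun z' => decide (z' = z)) fun v => v.emit .pos

/-- Move a letter from a stack to other stacks. -/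
def xfer (x : V) (Y : V → Bool) : Prog R V τ :=
  op Y (fun z' => decide (z' = x)) fun v => v.emit ((v.top x).getD .pos)

/-- Repeat while the stack is not empty. -/
def forEach (x : V) (p : Prog R V τ) : Prog R V τ := loop (fun v => (v.top x).isSome) p

/-- Move the content of a stack to another stack, reversing it. -/
def moveAll (x y : V) : Prog R V τ := forEach x (xfer x fun z => decide (z = y))

/-- Copy the content of the stack `x` to `y`, using the empty stack `t`. -/
def copy (x y t : V) : Prog R V τ :=
  seq (moveAll x t) (forEach t (xfer t fun z => decide (z = x ∨ z = y)))

/-- Empty a stack. -/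
def clear (x : V) : Prog R V τ := forEach x (pop x)

/-- Repeat a program a fixed number of times. -/
def rep (p : Prog R V τ) : ℕ → Prog R V τ
  | 0 => skip
  | n + 1 => seq p (rep p n)

end Prog

theorem Run.op {P Q : V → Bool} {F : View R V τ → Effect R V τ} {s s' : St R V τ}
    (h : s.app P Q F = s') : Run (.op P Q F) s 2 s' := ⟨2, le_rfl, h ▸ .op P Q F s⟩

theorem Run.skip (s : St R V τ) : Run Prog.skip s 2 s := by
  refine Run.op ?_
  ext1 <;> simp [St.app, View.emit, St.mask, idle]

theorem Run.assign (f : View R V τ → R) (s : St R V τ) :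
    Run (Prog.assign f) s 2 (s.setReg (f s.view)) := by
  refine Run.op ?_
  ext1 <;> simp [St.app, View.emit, St.mask, idle, St.view]

theorem Run.rep {p : Prog R V τ} (S : ℕ → St R V τ) (n T : ℕ)
    (h : ∀ j < n, Run p (S j) T (S (j + 1))) : Run (Prog.rep p n) (S 0) (n * T + 2) (S n) := by
  induction n generalizing S with
  | zero => exact (Run.skip _).cast (by simp) rfl
  | succ n ih =>
    refine ((h 0 (by omega)).seq (ih (fun j => S (j + 1)) fun j hj => h (j + 1) (by omega))).cast
      ?_ rfl
    ring_nf
    omega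

variable [DecidableEq V]

theorem Run.push (z : V) (a : Letter) (s : St R V τ) :
    Run (Prog.push z a) s 2 (s.set z (a :: s.var z)) := by
  refine Run.op ?_
  ext1
  · simp [St.app, View.emit, St.mask]
  · funext z'
    by_cases h : z' = z <;> simp [St.app, View.emit, St.set_var, h]
  · simp [St.app, View.emit, St.mask, idle]

theorem Run.pop (z : V) (s : St R V τ) : Run (Prog.pop z) s 2 (s.set z (s.var z).tail) := by
  refine Run.op ?_
  ext1
  · simp [St.app, View.emit, St.mask]
  · funext z'
    by_cases h : z' = z <;> simp [St.app, St.set_var, h]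
  · simp [St.app, View.emit, St.mask, idle]

/-- The condition `hx` is essential: `St.app` gives pushing priority over popping, and `St.mask`
hides the tops of the stacks that are pushed on. -/
theorem Run.xfer (x : V) (Y : V → Bool) (hx : Y x = false) (s : St R V τ) (a : Letter)
    (w : List Letter) (hs : s.var x = a :: w) :
    Run (Prog.xfer x Y) s 2 ⟨s.reg, fun z => if Y z then a :: s.var z else
      if z = x then w else s.var z, s.tape⟩ := by
  refine Run.op ?_
  ext1
  · simp [St.app, View.emit, St.mask]
  · funext z'
    by_cases h : Y z'
    · simp [St.app, View.emit, St.mask, h, hx, hs]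
    · by_cases h' : z' = x <;> simp [St.app, h, h', hx, hs]
  · simp [St.app, View.emit, St.mask, idle]

theorem Run.xfer_one (x y : V) (hxy : x ≠ y) (s : St R V τ) (a : Letter)
    (w : List Letter) (hs : s.var x = a :: w) :
    Run (Prog.xfer x fun z => decide (z = y)) s 2 ((s.set y (a :: s.var y)).set x w) := by
  refine (Run.xfer x (fun z => decide (z = y)) (by simpa using hxy) s a w hs).cast le_rfl ?_
  refine St.ext' rfl rfl fun z => ?_
  by_cases h : z = y
  · subst h
    simp [St.set_var, hxy.symm]
  · simp [St.set_var, h]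

/-- A loop over the letters of a stack. -/
theorem Run.forEach {β : Type*} {p : Prog R V τ} (x : V) (S : β → St R V τ) (φ : β → Letter → β)
    (I : β → List Letter → Prop) (T : ℕ) (hI : ∀ b a l, I b (a :: l) → I (φ b a) l)
    (hstep : ∀ b a l, I b (a :: l) → Run p ((S b).set x (a :: l)) T ((S (φ b a)).set x l))
    (b : β) (l : List Letter) (h : I b l) :
    Run (Prog.forEach x p) ((S b).set x l) (l.length * (T + 1) + 1)
      ((S (l.foldl φ b)).set x []) :=
  Run.foldl (fun b l => (S b).set x l) φ I T hI (by simp) hstep (by simp) b l h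

theorem Run.moveAll (x y : V) (hxy : x ≠ y) (s : St R V τ) :
    Run (Prog.moveAll x y) s (3 * (s.var x).length + 1)
      ((s.set y ((s.var x).reverse ++ s.var y)).set x []) := by
  have := Run.forEach (p := Prog.xfer x fun z => decide (z = y)) x
    (fun b : List Letter => s.set y b) (fun b a => a :: b)
    (fun _ _ => True) 2 (by simp) (fun b a l _ => by
      refine (Run.xfer_one x y hxy _ a l (by simp)).cast le_rfl ?_
      refine St.ext' rfl rfl fun z => ?_
      by_cases h : z = x
      · simp [h]
      · by_cases h' : z = y
        · subst h'
          simp [St.set_var, h]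
        · simp [St.set_var, h, h']) (s.var y) (s.var x) trivial
  rw [St.set_self, St.set_self] at this
  refine this.cast (by omega) ?_
  congr 2
  generalize s.var y = u
  induction s.var x generalizing u with
  | nil => rfl
  | cons a l ih => simp [ih]

theorem Run.clear (x : V) (s : St R V τ) :
    Run (Prog.clear x) s (3 * (s.var x).length + 1) (s.set x []) := by
  have := Run.forEach (p := Prog.pop x) x (fun _ : Unit => s) (fun b _ => b)
    (fun _ _ => True) 2 (by simp) (fun b a l _ => by
      refine (Run.pop x _).cast le_rfl ?_
      simp) () (s.var x) trivial
  rw [St.set_self] at this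
  exact this.cast (by omega) rfl

/-- The content is reversed on its way to `t` and reversed again on its way back to both `x` and
`y`, so the order is restored. -/
theorem Run.copy (x y t : V) (hxy : x ≠ y) (hxt : x ≠ t) (hyt : y ≠ t) (s : St R V τ)
    (ht : s.var t = []) :
    Run (Prog.copy x y t) s (6 * (s.var x).length + 2) (s.set y (s.var x ++ s.var y)) := by
  have := Run.forEach (p := Prog.xfer t fun z => decide (z = x ∨ z = y)) t
    (fun b : List Letter × List Letter => (s.set x b.1).set y b.2)
    (fun b a => (a :: b.1, a :: b.2))
    (fun _ _ => True) 2 (by simp) (fun b a l _ => by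
      refine (Run.xfer t _ (by simp [hxt.symm, hyt.symm]) _ a l (by simp)).cast le_rfl ?_
      refine St.ext' rfl rfl fun z => ?_
      by_cases h : z = t
      · subst h
        simp [hxt.symm, hyt.symm]
      · by_cases h' : z = y
        · subst h'
          simp [St.set_var, h]
        · by_cases h'' : z = x
          · subst h''
            simp [St.set_var, h', h]
          · simp [St.set_var, h, h', h'']) ([], s.var y) (s.var x).reverse trivial
  have hf : ∀ (l u v : List Letter), l.foldl (fun (b : List Letter × List Letter) a =>
      (a :: b.1, a :: b.2)) (u, v) = (l.reverse ++ u, l.reverse ++ v) := by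
    intro l
    induction l with
    | nil => simp
    | cons a l ih => simp [ih]
  rw [hf] at this
  have e : (s.set t ((s.var x).reverse ++ s.var t)).set x [] =
      ((s.set x ([] : List Letter)).set y (s.var y)).set t (s.var x).reverse := by
    refine St.ext' rfl rfl fun z => ?_
    by_cases h : z = t
    · subst h
      simp [St.set_var, hxt.symm, ht]
    · by_cases h' : z = y
      · subst h'
        simp [St.set_var, h, hxy.symm]
      · by_cases h'' : z = x
        · subst h''
          simp [St.set_var, h', h]
        · simp [St.set_var, h, h', h'']
  have h₁ := Run.moveAll x t hxt s
  rw [e] at h₁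
  refine (h₁.seq this).cast ?_ ?_
  · simp only [List.length_reverse]
    omega
  · refine St.ext' rfl rfl fun z => ?_
    by_cases h : z = t
    · subst h
      simp [St.set_var, ht, hyt.symm]
    · by_cases h' : z = y
      · subst h'
        simp [St.set_var, h]
      · by_cases h'' : z = x
        · subst h''
          simp [St.set_var, h', h]
        · simp [St.set_var, h, h', h'']

/-- This form and the next two name the content explicitly, so that in long compositions the time
bounds and states do not mention contents of nested updates. -/
theorem Run.copyOf (x y t : V) (u : List Letter) (s : St R V τ) (hx : s.var x = u)
    (hy : s.var y = []) (ht : s.var t = []) (hxy : x ≠ y) (hxt : x ≠ t) (hyt : y ≠ t) :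
    Run (Prog.copy x y t) s (6 * u.length + 2) (s.set y u) :=
  (Run.copy x y t hxy hxt hyt s ht).cast (by simp [hx]) (by simp [hx, hy])

theorem Run.moveOf (x y : V) (u : List Letter) (s : St R V τ) (hx : s.var x = u)
    (hy : s.var y = []) (hxy : x ≠ y) :
    Run (Prog.moveAll x y) s (3 * u.length + 1) ((s.set y u.reverse).set x []) :=
  (Run.moveAll x y hxy s).cast (by simp [hx]) (by simp [hx, hy])

theorem Run.clearOf (x : V) (u : List Letter) (s : St R V τ) (hx : s.var x = u) :
    Run (Prog.clear x) s (3 * u.length + 1) (s.set x []) :=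
  (Run.clear x s).cast (by simp [hx]) rfl

/-! ### Codes as words of letters -/

/-- The letter of a sign. -/
def signL (b : Bool) : Letter := if b then .pos else .neg

/-- The code of an example. -/
def exampleL {d : ℕ} (z : Example d) : List Letter :=
  (List.ofFn z.1).map signL ++ [signL z.2, .sep]

/-- The code of a dataset. -/
def dataL {d : ℕ} (Z : Dataset d) : List Letter := Z.flatMap exampleL

/-- The code of a number. -/
def unaryL (n : ℕ) : List Letter := List.replicate n .pos ++ [.sep]

/-- The code of a gate. -/
def Gate.codeL : Gate → List Letter
  | .and i j => .pos :: (unaryL i ++ unaryL j)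
  | .or i j => .neg :: (unaryL i ++ unaryL j)
  | .not i => .bar :: unaryL i

/-- The code of a circuit. -/
def circuitL (gs : List Gate) : List Letter := gs.flatMap Gate.codeL

theorem sym_signL (b : Bool) : (signL b).sym = signSym b := by cases b <;> rfl

theorem unary_eq (n : ℕ) : unary n = (unaryL n).map Letter.sym := by
  simp [unary, unaryL, Letter.sym]

theorem codeExample_eq {d : ℕ} (z : Example d) : codeExample z = (exampleL z).map Letter.sym := by
  have h : Letter.sep.sym = Sym.sep := rfl
  simp [codeExample, exampleL, sym_signL, h, Function.comp_def]

theorem codeData_eq {d : ℕ} (Z : Dataset d) : codeData Z = (dataL Z).map Letter.sym := by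
  rw [codeData, dataL, List.map_flatMap, funext codeExample_eq]

theorem Gate.code_eq (g : Gate) : g.code = g.codeL.map Letter.sym := by
  cases g <;> simp [Gate.code, Gate.codeL, unary_eq, Letter.sym]

theorem codeCircuit_eq (gs : List Gate) : codeCircuit gs = (circuitL gs).map Letter.sym := by
  rw [codeCircuit, circuitL, List.map_flatMap, funext Gate.code_eq]

/-- The code of the input of a learning algorithm. -/
def inputL {d : ℕ} (Z Z' : Dataset d) : List Letter := dataL Z ++ .bar :: dataL Z'

theorem codeInput_eq {d : ℕ} (Z Z' : Dataset d) :
    codeInput Z Z' = (inputL Z Z').map Letter.sym := by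
  simp [codeInput, inputL, codeData_eq, Letter.sym]

theorem codeParams_eq (s k : ℕ) : codeParams s k = (unaryL s ++ unaryL k).map Letter.sym := by
  simp [codeParams, unary_eq]

theorem exists_map_sym (w : List Sym) (h : Sym.blank ∉ w) :
    ∃ u : List Letter, u.map Letter.sym = w := by
  induction w with
  | nil => exact ⟨[], rfl⟩
  | cons a w ih =>
    obtain ⟨u, rfl⟩ := ih (fun h' => h (List.mem_cons_of_mem _ h'))
    have : ∃ b : Letter, b.sym = a := by
      cases a
      · simp at h
      · exact ⟨.neg, rfl⟩
      · exact ⟨.pos, rfl⟩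
      · exact ⟨.sep, rfl⟩
      · exact ⟨.bar, rfl⟩
    obtain ⟨b, rfl⟩ := this
    exact ⟨b :: u, rfl⟩

/-- Hence the first bar of an input is the mark between the two datasets. -/
theorem bar_notMem_dataL {d : ℕ} (Z : Dataset d) : Letter.bar ∉ dataL Z := by
  have h : ∀ b, signL b ≠ .bar := by intro b; cases b <;> simp [signL]
  simp [dataL, exampleL, h, (h _).symm]

theorem length_exampleL {d : ℕ} (z : Example d) : (exampleL z).length = d + 2 := by
  simp [exampleL]

theorem length_dataL {d : ℕ} (Z : Dataset d) : (dataL Z).length = Z.length * (d + 2) := by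
  induction Z with
  | nil => simp [dataL]
  | cons z Z ih =>
    simp only [dataL, List.flatMap_cons, List.length_append] at ih ⊢
    rw [ih, length_exampleL, List.length_cons]
    ring

/-! ### Evaluation of circuits by a scan of the code -/

/-- The state of the scan: before a gate (and whether there was a gate before), in the first
argument of a gate (`none` for a negation), in the second argument of a conjunction or disjunction
(with the value of the first one), or after an error. -/
inductive Mode : Type
  | start (any : Bool)
  | fst (k : Option Bool)
  | snd (k a : Bool)
  | bad

/-- What to do with the wires: nothing, go to the next wire, go back to the first wire, or append
a wire. -/
inductive Todo : Type
  | stay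
  | adv
  | rew
  | fin (v : Bool)

/-- The control of the scan: from the state, the current wire and the scanned letter. -/
def Mode.ctl : Mode → Option Bool → Letter → Mode × Todo
  | .start _, _, .pos => (.fst (some true), .rew)
  | .start _, _, .neg => (.fst (some false), .rew)
  | .start _, _, .bar => (.fst none, .rew)
  | .fst k, some _, .pos => (.fst k, .adv)
  | .fst none, some a, .sep => (.start true, .fin !a)
  | .fst (some k), some a, .sep => (.snd k a, .rew)
  | .snd k a, some _, .pos => (.snd k a, .adv)
  | .snd k a, some b, .sep => (.start true, .fin (if k then a && b else a || b))
  | _, _, _ => (.bad, .stay)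

/-- The effect on the wires, which are given by the reversed list of those that precede the
current one and the list of the others. -/
def Todo.move : Todo → List Bool × List Bool → List Bool × List Bool
  | .stay, u => u
  | .adv, (p, []) => (p, [])
  | .adv, (p, a :: q) => (a :: p, q)
  | .rew, (p, q) => ([], p.reverse ++ q)
  | .fin v, (p, q) => (v :: (q.reverse ++ p), [])

/-- The value of the last gate, from the state of the scan, the wires, and the rest of the code. -/
def scan : Mode → List Bool × List Bool → List Letter → Option Bool
  | .start true, u, [] => u.1.head?
  | _, _, [] => none
  | m, u, c :: w => scan (m.ctl u.2.head? c).1 ((m.ctl u.2.head? c).2.move u) w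

theorem scan_cons (m : Mode) (u c w) :
    scan m u (c :: w) = scan (m.ctl u.2.head? c).1 ((m.ctl u.2.head? c).2.move u) w := by
  cases m <;> simp [scan]

@[simp] theorem scan_bad (u w) : scan .bad u w = none := by
  induction w generalizing u with
  | nil => rfl
  | cons c w ih => rw [scan_cons]; exact ih _

/-- Each unit of the index advances the current wire by one, so at the separator the current wire is
`q[n]`. If the wires run out before, the scan fails, as does the lookup. -/
theorem scan_fst (k : Option Bool) (p q : List Bool) (n : ℕ) (w : List Letter) :
    scan (.fst k) (p, q) (unaryL n ++ w) = q[n]?.bind fun a => match k with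
      | none => scan (.start true) ((!a) :: (q.reverse ++ p), []) w
      | some k => scan (.snd k a) ([], p.reverse ++ q) w := by
  induction n generalizing p q with
  | zero =>
    rcases q with - | ⟨a, q⟩ <;> rcases k with - | k <;>
      simp [unaryL, scan_cons, Mode.ctl, Todo.move]
  | succ n ih =>
    have h : unaryL (n + 1) ++ w = .pos :: (unaryL n ++ w) := by simp [unaryL, List.replicate_succ]
    rw [h, scan_cons]
    rcases q with - | ⟨a, q⟩
    · simp [Mode.ctl]
    · simpa [Mode.ctl, Todo.move] using ih (a :: p) q

theorem scan_snd (k b : Bool) (p q : List Bool) (n : ℕ) (w : List Letter) :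
    scan (.snd k b) (p, q) (unaryL n ++ w) = q[n]?.bind fun a =>
      scan (.start true) ((if k then b && a else b || a) :: (q.reverse ++ p), []) w := by
  induction n generalizing p q with
  | zero =>
    rcases q with - | ⟨a, q⟩ <;> simp [unaryL, scan_cons, Mode.ctl, Todo.move]
  | succ n ih =>
    have h : unaryL (n + 1) ++ w = .pos :: (unaryL n ++ w) := by simp [unaryL, List.replicate_succ]
    rw [h, scan_cons]
    rcases q with - | ⟨a, q⟩
    · simp [Mode.ctl]
    · simpa [Mode.ctl, Todo.move] using ih _ _

/-- Between two gates all wires lie reversed in the first list, so a new wire is added at its front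
and the head is the value of the last gate. The rewinding at the start of each argument makes its
index count from the first wire. -/
theorem scan_gate (any : Bool) (ws : List Bool) (g : Gate) (w : List Letter) :
    scan (.start any) (ws.reverse, []) (g.codeL ++ w) = (g.eval ws).bind fun v =>
      scan (.start true) ((ws ++ [v]).reverse, []) w := by
  cases g with
  | and i j =>
    rw [Gate.codeL, List.cons_append, List.append_assoc, scan_cons]
    simp only [Mode.ctl, Todo.move, scan_fst, scan_snd, Gate.eval]
    cases hi : ws[i]? <;> cases hj : ws[j]? <;> simp [hi, hj]
  | or i j =>
    rw [Gate.codeL, List.cons_append, List.append_assoc, scan_cons]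
    simp only [Mode.ctl, Todo.move, scan_fst, scan_snd, Gate.eval]
    cases hi : ws[i]? <;> cases hj : ws[j]? <;> simp [hi, hj]
  | not i =>
    rw [Gate.codeL, List.cons_append, scan_cons]
    simp only [Mode.ctl, Todo.move, scan_fst, Gate.eval]
    cases hi : ws[i]? <;> simp [hi]

/-- The flag of `Mode.start` separates the empty circuit, which has no value, from the end of a
nonempty one, where the value is the last wire; hence the hypothesis `h`. -/
theorem scan_circuit (any : Bool) (ws : List Bool) (gs : List Gate) (h : any = false ∨ gs ≠ []) :
    scan (.start any) (ws.reverse, []) (circuitL gs) = evalCircuit gs ws := by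
  induction gs generalizing any ws with
  | nil =>
    obtain rfl : any = false := by simpa using h
    rfl
  | cons g gs ih =>
    rw [circuitL, List.flatMap_cons, scan_gate]
    rcases gs with - | ⟨g', gs⟩
    · rw [evalCircuit]
      cases hg : g.eval ws <;> simp [scan]
    · rw [evalCircuit]
      congr 1
      funext v
      exact ih _ _ (Or.inr (by simp))

/-- Towards the converse, that the scan succeeds on codes only: any letter other than `pos` and
`sep` leads to the absorbing state `bad`, and a word that ends inside an argument has no value. -/
theorem exists_unaryL_of_scan_fst (k : Option Bool) (u) (w : List Letter)
    (h : scan (.fst k) u w ≠ none) : ∃ n w', w = unaryL n ++ w' := by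
  induction w generalizing u with
  | nil => simp [scan] at h
  | cons c w ih =>
    rw [scan_cons] at h
    obtain ⟨p, q⟩ := u
    rcases q with - | ⟨a, q⟩
    · exact absurd (by simp [Mode.ctl]) h
    · cases c
      · exact absurd (by simp [Mode.ctl]) h
      · obtain ⟨n, w', rfl⟩ := ih _ h
        exact ⟨n + 1, w', by simp [unaryL, List.replicate_succ]⟩
      · exact ⟨0, w, by simp [unaryL]⟩
      · exact absurd (by simp [Mode.ctl]) h

theorem exists_unaryL_of_scan_snd (k b : Bool) (u) (w : List Letter)
    (h : scan (.snd k b) u w ≠ none) : ∃ n w', w = unaryL n ++ w' := by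
  induction w generalizing u with
  | nil => simp [scan] at h
  | cons c w ih =>
    rw [scan_cons] at h
    obtain ⟨p, q⟩ := u
    rcases q with - | ⟨a, q⟩
    · exact absurd (by simp [Mode.ctl]) h
    · cases c
      · exact absurd (by simp [Mode.ctl]) h
      · obtain ⟨n, w', rfl⟩ := ih _ h
        exact ⟨n + 1, w', by simp [unaryL, List.replicate_succ]⟩
      · exact ⟨0, w, by simp [unaryL]⟩
      · exact absurd (by simp [Mode.ctl]) h

theorem exists_of_bind_ne_none {α β : Type*} {o : Option α} {f : α → Option β}
    (h : o.bind f ≠ none) : ∃ a, f a ≠ none := by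
  cases o with
  | none => simp at h
  | some a => exact ⟨a, h⟩

/-- The code of the first gate is split off and the scan continues with the rest. A gate has several
letters, so the induction is on the length of the word. -/
theorem exists_circuitL_of_scan (any : Bool) (u) (w : List Letter)
    (h : scan (.start any) u w ≠ none) : ∃ gs, w = circuitL gs := by
  induction hn : w.length using Nat.strong_induction_on generalizing any u w with
  | _ n ih =>
  rcases w with - | ⟨c, w⟩
  · exact ⟨[], rfl⟩
  · rw [scan_cons] at h
    have two (k : Bool) (v) (h : scan (.fst (some k)) v w ≠ none) :
        ∃ i j gs, w = unaryL i ++ (unaryL j ++ circuitL gs) := by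
      obtain ⟨i, w₁, rfl⟩ := exists_unaryL_of_scan_fst _ _ _ h
      obtain ⟨p, q⟩ := v
      rw [scan_fst] at h
      obtain ⟨a, h⟩ := exists_of_bind_ne_none h
      obtain ⟨j, w₂, rfl⟩ := exists_unaryL_of_scan_snd _ _ _ _ h
      simp only [scan_snd] at h
      obtain ⟨b, h⟩ := exists_of_bind_ne_none h
      obtain ⟨gs, rfl⟩ := ih _ (by simp at hn; omega) _ _ _ h rfl
      exact ⟨i, j, gs, rfl⟩
    cases c with
    | neg =>
      obtain ⟨i, j, gs, rfl⟩ := two _ _ h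
      exact ⟨.or i j :: gs, by simp [circuitL, Gate.codeL]⟩
    | pos =>
      obtain ⟨i, j, gs, rfl⟩ := two _ _ h
      exact ⟨.and i j :: gs, by simp [circuitL, Gate.codeL]⟩
    | sep => exact absurd (by simp [Mode.ctl]) h
    | bar =>
      simp only [Mode.ctl] at h
      obtain ⟨i, w₁, rfl⟩ := exists_unaryL_of_scan_fst _ _ _ h
      obtain ⟨p, q⟩ := u
      rw [Todo.move, scan_fst] at h
      obtain ⟨a, h⟩ := exists_of_bind_ne_none h
      obtain ⟨gs, rfl⟩ := ih _ (by simp at hn; omega) _ _ _ h rfl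
      exact ⟨.not i :: gs, by simp [circuitL, Gate.codeL]⟩

/-- The scan yields `none` both on words that are no codes and on codes of invalid circuits. In both
cases the represented classifier is constantly `true`, so a single default value covers them. -/
theorem classifierOf_eq_scan (d : ℕ) (w : List Letter) (x : Cube d) :
    classifierOf d (w.map Letter.sym) x =
      (scan (.start false) ((List.ofFn x).reverse, []) w).getD true := by
  by_cases h : ∃ gs, w = circuitL gs
  · obtain ⟨gs, rfl⟩ := h
    rw [← codeCircuit_eq, classifierOf_codeCircuit, scan_circuit _ _ _ (Or.inl rfl)]
  · have h₁ : scan (.start false) ((List.ofFn x).reverse, []) w = none := by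
      by_contra h'
      exact h (exists_circuitL_of_scan _ _ _ h')
    rw [h₁, classifierOf, dif_neg]
    · rfl
    · rintro ⟨gs, hg⟩
      rw [codeCircuit_eq] at hg
      exact h ⟨gs, (Letter.sym_injective.list_map hg).symm⟩

/-! ### The range of the loops and the minimization -/

/-- Replaces the real root by a comparison of natural numbers, which a machine can carry out. -/
theorem le_loopBound_iff (i M : ℕ) : i ≤ loopBound M ↔ i ^ 10 ≤ M := by
  rw [loopBound, Nat.le_floor_iff (by positivity), one_div,
    Real.le_rpow_inv_iff_of_pos (by positivity) (by positivity) (by norm_num)]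
  norm_cast

theorem loopBound_le (M : ℕ) : loopBound M ≤ M :=
  (Nat.le_self_pow (by norm_num) _).trans ((le_loopBound_iff _ M).1 le_rfl)

/-- The counter is raised exactly at the `i ≤ loopBound M`, and all of these are at most `M`. -/
theorem foldl_loopBound (M : ℕ) :
    (List.range' 1 M).foldl (fun c i => if i ^ 10 ≤ M then c + 1 else c) 0 = loopBound M := by
  suffices H : ∀ n, (List.range' 1 n).foldl (fun c i => if i ^ 10 ≤ M then c + 1 else c) 0 =
      min n (loopBound M) by
    rw [H, min_eq_right (loopBound_le M)]
  intro n
  induction n with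
  | zero => simp
  | succ n ih =>
    rw [List.range'_concat, List.foldl_append, ih]
    simp only [List.foldl_cons, List.foldl_nil, ← le_loopBound_iff]
    split_ifs <;> omega

theorem foldl_triples {β : Type*} (r : ℕ) (φ : β → ℕ × ℕ × ℕ → β) (b : β) :
    (triples r).foldl φ b = (List.range' 1 r).foldl (fun b s => (List.range' 1 r).foldl (fun b k =>
      (List.range' 1 r).foldl (fun b t => φ b (s, k, t)) b) b) b := by
  simp [triples, List.foldl_flatMap, List.foldl_map]

/-- The initial value `r + 1` exceeds every count, so the first element is always accepted.
Afterwards the strict comparison keeps the first minimizer, in agreement with `List.argmin`. Counts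
can replace fractions because the denominator `r` is the same for all; for `r = 0` the list is
empty. -/
theorem foldl_argmin {α β : Type*} (L : List α) (cnt : α → ℕ) (f : α → ℚ) (g : α → β) (r : ℕ)
    (hr : r = 0 → L = []) (hcnt : ∀ v, cnt v ≤ r) (hf : ∀ v, f v = cnt v / r) (w : β) :
    L.foldl (fun b v => if cnt v < b.1 then (cnt v, g v) else b) (r + 1, w) =
      match L.argmin f with
      | none => (r + 1, w)
      | some v => (cnt v, g v) := by
  rcases Nat.eq_zero_or_pos r with h0 | h0
  · simp [hr h0]
  · clear hr
    have hlt : ∀ u v, f u < f v ↔ cnt u < cnt v := by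
      intro u v
      rw [hf, hf, div_lt_div_iff_of_pos_right (by exact_mod_cast h0)]
      norm_cast
    induction L using List.reverseRecOn with
    | nil => simp
    | append_singleton L a ih =>
      rw [List.foldl_append, ih, List.argmin_concat]
      cases h : L.argmin f with
      | none => simp [Nat.lt_succ_of_le (hcnt a)]
      | some v => by_cases h' : cnt a < cnt v <;> simp [hlt, h']

/-! ### The program: counting the errors of a candidate -/

/-- The stacks of the program. -/
inductive Var : Type
  | inp | out | zr | zp | mc | cl | rr | test | sv | sr | kv | kr | tv | tr | best | cand | err
  | cw | tw | wr | w2 | t1 | t2 | t3 | clock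
  deriving DecidableEq

instance : Fintype Var where
  elems := {.inp, .out, .zr, .zp, .mc, .cl, .rr, .test, .sv, .sr, .kv, .kr, .tv, .tr, .best, .cand,
    .err, .cw, .tw, .wr, .w2, .t1, .t2, .t3, .clock}
  complete x := by cases x <;> decide

/-- The register of the program: a state of the simulated machine, the state of the scan of a
circuit with the next action on the wires, and the label of an example. -/
@[ext] structure Reg (Q : Type) where
  st : Q
  mode : Mode
  todo : Todo
  lab : Bool

/-- The initial register. -/
def Reg.zero {Q : Type} (q : Q) : Reg Q := ⟨q, .start false, .stay, false⟩

instance : Finite Mode := by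
  refine Finite.of_surjective (α := (Bool ⊕ Option Bool) ⊕ (Bool × Bool) ⊕ Unit) (fun
    | .inl (.inl a) => .start a
    | .inl (.inr a) => .fst a
    | .inr (.inl (a, b)) => .snd a b
    | .inr (.inr _) => .bad) ?_
  rintro (a | a | ⟨a, b⟩ | _)
  · exact ⟨.inl (.inl a), rfl⟩
  · exact ⟨.inl (.inr a), rfl⟩
  · exact ⟨.inr (.inl (a, b)), rfl⟩
  · exact ⟨.inr (.inr ()), rfl⟩

instance : Finite Todo := by
  refine Finite.of_surjective (α := Option Bool ⊕ Bool) (fun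
    | .inl none => .stay
    | .inl (some true) => .adv
    | .inl (some false) => .rew
    | .inr v => .fin v) ?_
  rintro (_ | _ | _ | v)
  · exact ⟨.inl none, rfl⟩
  · exact ⟨.inl (some true), rfl⟩
  · exact ⟨.inl (some false), rfl⟩
  · exact ⟨.inr v, rfl⟩

instance {Q : Type} [Finite Q] : Finite (Reg Q) :=
  Finite.of_injective (fun r : Reg Q => (r.st, r.mode, r.todo, r.lab)) fun r r' h => by
    simp only [Prod.mk.injEq] at h
    ext1 <;> simp_all

variable {Q τ : Type}

/-- The sign of a letter. -/
def Letter.bit (a : Letter) : Bool := a == .pos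

@[simp] theorem bit_signL (b : Bool) : (signL b).bit = b := by cases b <;> rfl

theorem signL_ne_sep (b : Bool) : signL b ≠ .sep := by cases b <;> simp [signL]

/-- The next state of the scan of a circuit. -/
def scanReg (v : View (Reg Q) Var τ) : Reg Q :=
  let o := v.reg.mode.ctl ((v.top .w2).map Letter.bit) ((v.top .cw).getD .pos)
  { v.reg with mode := o.1, todo := o.2 }

/-- The value of the new wire. -/
def Todo.val : Todo → Bool
  | .fin v => v
  | _ => false

/-- Process a letter of the code of a circuit. -/
def scanStep : Prog (Reg Q) Var τ :=
  .seq (.op (fun _ => false) (fun z => decide (z = .cw)) fun v =>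
    { v.emit .pos with reg := scanReg v }) <|
  .ite (fun v => match v.reg.todo with | .adv => (v.top .w2).isSome | _ => false)
    (.xfer .w2 fun z => decide (z = .wr)) <|
  .ite (fun v => match v.reg.todo with | .rew => true | _ => false) (.moveAll .wr .w2) <|
  .ite (fun v => match v.reg.todo with | .fin _ => true | _ => false)
    (.seq (.moveAll .w2 .wr) (.op (fun z => decide (z = .wr)) (fun _ => false) fun v =>
      v.emit (signL v.reg.todo.val))) .skip

/-- The state during the scan of a circuit. -/
def St.scan (s : St (Reg Q) Var τ) (b : (Mode × Todo) × List Bool × List Bool) :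
    St (Reg Q) Var τ :=
  ((s.setReg { s.reg with mode := b.1.1, todo := b.1.2 }).set .wr (b.2.1.map signL)).set .w2
    (b.2.2.map signL)

/-- A step of the scan of a circuit. -/
def scanFold (b : (Mode × Todo) × List Bool × List Bool) (c : Letter) :
    (Mode × Todo) × List Bool × List Bool :=
  (b.1.1.ctl b.2.2.head? c, (b.1.1.ctl b.2.2.head? c).2.move b.2)

/-- The stack `wr` holds the wires before the current one and `w2` the others. Rewinding and
appending move a whole stack, at three steps per wire; this gives the term `3 * N`. -/
theorem Run.scanStep (s : St (Reg Q) Var τ) (b : (Mode × Todo) × List Bool × List Bool)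
    (c : Letter) (w : List Letter) (N : ℕ) (hN : b.2.1.length + b.2.2.length ≤ N) :
    Run scanStep ((s.scan b).set .cw (c :: w)) (3 * N + 8)
      ((s.scan (scanFold b c)).set .cw w) := by
  obtain ⟨⟨m, td⟩, p, q⟩ := b
  simp only at hN
  have h₁ : ((((s.scan ((m, td), p, q)).set .cw (c :: w)).app (fun _ => false)
      (fun z => decide (z = .cw)) fun v => { v.emit .pos with reg := scanReg v })) =
      (s.scan (m.ctl q.head? c, p, q)).set .cw w := by
    ext1
    · simp [St.app, St.scan, scanReg, St.mask, St.set_var, Function.comp_def]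
    · funext z
      by_cases hz : z = .cw <;> simp [St.app, St.scan, St.set_var, hz]
    · simp [St.app, View.emit, St.mask, idle, St.scan]
  refine ((Run.op h₁).seq (T' := 3 * N + 6) ?_).cast (by omega) rfl
  unfold scanFold
  obtain ⟨m', td'⟩ := m.ctl q.head? c
  cases td' with
  | stay =>
    refine (Run.ite_false ?_ (.ite_false ?_ (.ite_false ?_ (.skip _)))).cast (by omega) ?_ <;>
      simp [St.scan, Todo.move]
  | adv =>
    rcases q with - | ⟨a, q⟩
    · refine (Run.ite_false ?_ (.ite_false ?_ (.ite_false ?_ (.skip _)))).cast (by omega) ?_ <;>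
        simp [St.scan, Todo.move, St.set_var]
    · refine (Run.ite_true ?_ (.xfer_one Var.w2 Var.wr (by decide) _ (signL a) (q.map signL) ?_)).cast
        (by omega) ?_
      · simp [St.scan, St.set_var]
      · simp [St.scan, St.set_var]
      · refine St.ext' rfl rfl fun z => ?_
        cases z <;> simp [St.scan, Todo.move, St.set_var]
  | rew =>
    refine (Run.ite_false ?_ (.ite_true ?_ (.moveAll Var.wr Var.w2 (by decide) _))).cast ?_ ?_
    · simp [St.scan]
    · simp [St.scan]
    · simp [St.scan, St.set_var]
      omega
    · refine St.ext' rfl rfl fun z => ?_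
      cases z <;> simp [St.scan, Todo.move, St.set_var]
  | fin v =>
    refine (Run.ite_false ?_ (.ite_false ?_ (.ite_true ?_
      ((Run.moveAll Var.w2 Var.wr (by decide) _).seq (Run.op rfl))))).cast ?_ ?_
    · simp [St.scan]
    · simp [St.scan]
    · simp [St.scan]
    · simp [St.scan, St.set_var]
      omega
    · ext1
      · rfl
      · funext z
        cases z <;> simp [St.app, St.mask, View.emit, St.scan, Todo.move, St.set_var, Todo.val]
      · simp [St.app, St.mask, View.emit, St.scan, idle]

/-- The value of the last gate at the end of the scan. -/
def Mode.result {α : Type} : Mode → Option α → Option α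
  | .start true, o => o
  | _, _ => none

theorem scan_eq_foldl (b : (Mode × Todo) × List Bool × List Bool) (w : List Letter) :
    scan b.1.1 b.2 w =
      (w.foldl scanFold b).1.1.result (w.foldl scanFold b).2.1.head? := by
  induction w generalizing b with
  | nil =>
    obtain ⟨⟨m, td⟩, u⟩ := b
    rcases m with (_ | _) | _ | _ | _ <;> rfl
  | cons c w ih =>
    rw [scan_cons, List.foldl_cons, ← ih]
    rfl

/-- Only `fin` creates a wire, so the number of wires never exceeds the dimension plus the number of
letters read. -/
theorem length_move_le (td : Todo) (u : List Bool × List Bool) :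
    (td.move u).1.length + (td.move u).2.length ≤ u.1.length + u.2.length + 1 := by
  obtain ⟨p, q⟩ := u
  cases td with
  | adv => cases q <;> simp [Todo.move]; omega
  | _ => simp [Todo.move]; try omega

/-- The invariant is that the wires and the unread letters together number at most `N`. -/
theorem Run.scanLoop (s : St (Reg Q) Var τ) (b : (Mode × Todo) × List Bool × List Bool)
    (w : List Letter) (N : ℕ) (hN : b.2.1.length + b.2.2.length + w.length ≤ N) :
    Run (.forEach .cw AlgLearn.scanStep) ((s.scan b).set .cw w) (w.length * (3 * N + 9) + 1)
      ((s.scan (w.foldl scanFold b)).set .cw []) := by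
  refine Run.forEach .cw (fun b => s.scan b) scanFold
    (fun b l => b.2.1.length + b.2.2.length + l.length ≤ N) (3 * N + 8) ?_ ?_ b w hN
  · intro b a l h
    have := length_move_le (b.1.1.ctl b.2.2.head? a).2 b.2
    simp only [scanFold, List.length_cons] at h ⊢
    omega
  · intro b a l h
    exact Run.scanStep s b a l N (by simp only [List.length_cons] at h; omega)

theorem length_foldl_scanFold (b : (Mode × Todo) × List Bool × List Bool) (w : List Letter) :
    (w.foldl scanFold b).2.1.length + (w.foldl scanFold b).2.2.length ≤
      b.2.1.length + b.2.2.length + w.length := by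
  induction w generalizing b with
  | nil => simp
  | cons c w ih =>
    have := length_move_le (b.1.1.ctl b.2.2.head? c).2 b.2
    refine (ih _).trans ?_
    simp only [scanFold, List.length_cons] at this ⊢
    omega

/-- Move the letters before the next separator to another stack. -/
def load (x y : Var) : Prog (Reg Q) Var τ :=
  .loop (fun v => v.top x != some .sep) (.xfer x fun z => decide (z = y))

theorem Run.load (x y : Var) (hxy : x ≠ y) (s : St (Reg Q) Var τ) (u : List Bool)
    (w : List Letter) (hx : s.var x = u.map signL ++ .sep :: w) :
    Run (load x y) s (u.length * 3 + 1)
      ((s.set y ((u.map signL).reverse ++ s.var y)).set x (.sep :: w)) := by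
  have := Run.foldl (c := fun v => v.top x != some .sep)
    (p := .xfer x fun z => decide (z = y))
    (fun (b : List Letter) l => (s.set y b).set x (l.map signL ++ .sep :: w))
    (fun b a => signL a :: b) (fun _ _ => True) 2 (by simp)
    (by intro b a l _; simpa using signL_ne_sep a) (by
      intro b a l _
      refine (Run.xfer_one x y hxy _ (signL a) (l.map signL ++ .sep :: w) (by simp)).cast
        le_rfl ?_
      refine St.ext' rfl rfl fun z => ?_
      by_cases h : z = x
      · simp [h]
      · by_cases h' : z = y
        · subst h'
          simp [St.set_var, h]
        · simp [St.set_var, h, h']) (by simp) (s.var y) u trivial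
  have hf : ∀ (u : List Bool) (b : List Letter),
      u.foldl (fun b a => signL a :: b) b = (u.map signL).reverse ++ b := by
    intro u
    induction u with
    | nil => simp
    | cons a u ih => simp [ih]
  rw [hf, ← hx, St.set_self, St.set_self] at this
  exact this.cast (by omega) rfl

/-- The output of the scan disagrees with the label. -/
def mismatch (v : View (Reg Q) Var τ) : Bool :=
  (v.reg.mode.result ((v.top .wr).map Letter.bit)).getD true != v.reg.lab

/-- Evaluate the candidate on the next example, and count an error. -/
def testStep (q₀ : Q) : Prog (Reg Q) Var τ :=
  .seq (load .tw .wr) <|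
  .seq (.pop .tw) <|
  .seq (.assign fun v => { Reg.zero q₀ with lab := ((v.top .wr).map Letter.bit).getD false }) <|
  .seq (.pop .wr) <|
  .seq (.copy .cand .cw .t1) <|
  .seq (.forEach .cw scanStep) <|
  .seq (.ite mismatch (.push .err .pos) .skip) <|
  .seq (.clear .wr) <| .seq (.clear .w2) (.assign fun _ => Reg.zero q₀)

/-- Loading an example reverses it: the label comes to lie on top, from where it goes to the
register, and below it are the coordinates in the reversed order that the scan expects. -/
theorem Run.testStep (q₀ : Q) (s : St (Reg Q) Var τ) {d : ℕ} (z : Example d) (w rest : List Letter)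
    (hr : s.reg = Reg.zero q₀) (htw : s.var .tw = exampleL z ++ rest) (hwr : s.var .wr = [])
    (hw2 : s.var .w2 = []) (hcw : s.var .cw = []) (ht1 : s.var .t1 = []) (hc : s.var .cand = w)
    (N : ℕ) (hN : d + w.length ≤ N) :
    Run (testStep q₀) s (3 * N ^ 2 + 40 * N + 40)
      ((s.set .tw rest).set .err (if classifierOf d (w.map Letter.sym) z.1 != z.2 then
        .pos :: s.var .err else s.var .err)) := by
  have hN2 : w.length * (3 * N + 9) ≤ 3 * N ^ 2 + 9 * N := by
    calc w.length * (3 * N + 9) ≤ N * (3 * N + 9) := Nat.mul_le_mul_right _ (by omega)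
      _ = _ := by ring
  set p := w.foldl scanFold ((.start false, .stay), (List.ofFn z.1).reverse, []) with hp
  have hlen : p.2.1.length + p.2.2.length ≤ N :=
    (length_foldl_scanFold _ _).trans (by simpa using hN)
  have hcl : classifierOf d (w.map Letter.sym) z.1 = (p.1.1.result p.2.1.head?).getD true := by
    rw [classifierOf_eq_scan, ← scan_eq_foldl]
  apply Run.cast
  · apply Run.seq
    · exact Run.load .tw .wr (by decide) s (List.ofFn z.1 ++ [z.2]) rest (by simp [htw, exampleL])
    apply Run.seq (Run.pop _ _)
    apply Run.seq (Run.assign _ _)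
    apply Run.seq (Run.pop _ _)
    apply Run.seq (Run.copy Var.cand Var.cw Var.t1 (by decide) (by decide) (by decide) _
      (by simp [St.set_var, ht1]))
    apply Run.seq
    · have := Run.scanLoop ((s.setReg { Reg.zero q₀ with lab := z.2 }).set .tw rest)
        ((.start false, .stay), (List.ofFn z.1).reverse, []) w N (by simpa using hN)
      apply this.congr
      ext1
      · simp [Reg.zero, St.scan, St.set_var]
      · funext y
        cases y <;> simp [St.set_var, St.scan, hcw, hc, hw2, hwr]
      · rfl
    apply Run.seq (Run.ite (T := 2)
      (s' := ((((s.setReg { Reg.zero q₀ with lab := z.2 }).set .tw rest).scan p).set .cw []).set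
        .err (if classifierOf d (w.map Letter.sym) z.1 != z.2 then
        .pos :: s.var .err else s.var .err)) ?_ ?_)
    · apply Run.seq (Run.clear _ _)
      apply Run.seq (Run.clear _ _)
      exact Run.assign _ _
    · intro hm
      have hm' : (classifierOf d (w.map Letter.sym) z.1 != z.2) = true := by
        rw [← hm, hcl]
        simp [mismatch, St.scan, St.set_var, Function.comp_def, ← hp]
      rw [hm']
      refine (Run.push _ _ _).cast le_rfl ?_
      simp [St.scan, St.set_var, hp]
    · intro hm
      have hm' : (classifierOf d (w.map Letter.sym) z.1 != z.2) = false := by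
        rw [← hm, hcl]
        simp [mismatch, St.scan, St.set_var, Function.comp_def, ← hp]
      rw [hm']
      refine (Run.skip _).cast le_rfl ?_
      refine St.ext' rfl rfl fun y => ?_
      cases y <;> simp [St.scan, St.set_var, hp]
  · simp [St.scan, St.set_var, hc]
    omega
  · ext1
    · simp [hr]
    · funext y
      cases y <;> simp [St.set_var, St.scan, hcw, hc, hw2, hwr, ht1]
    · rfl

/-- Count the errors of the candidate on the test examples. -/
def countErr (q₀ : Q) : Prog (Reg Q) Var τ :=
  .seq (.copy .test .tw .t1) (.forEach .tw (testStep q₀))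

theorem Run.countErr (q₀ : Q) (s : St (Reg Q) Var τ) {d : ℕ} (Z : Dataset d) (w : List Letter)
    (hr : s.reg = Reg.zero q₀) (htest : s.var .test = dataL Z) (htw : s.var .tw = [])
    (hwr : s.var .wr = []) (hw2 : s.var .w2 = []) (hcw : s.var .cw = []) (ht1 : s.var .t1 = [])
    (herr : s.var .err = []) (hc : s.var .cand = w)
    (N : ℕ) (hN : d + w.length ≤ N) (hZ : (dataL Z).length ≤ N) :
    Run (countErr q₀) s (3 * N ^ 3 + 40 * N ^ 2 + 50 * N + 40)
      (s.set .err (List.replicate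
        (Z.countP fun z => classifierOf d (w.map Letter.sym) z.1 != z.2) .pos)) := by
  have hl := Run.foldl (c := fun v => (v.top .tw).isSome) (p := AlgLearn.testStep q₀)
    (fun (b : ℕ) (l : Dataset d) => (s.set .err (List.replicate b .pos)).set .tw (dataL l))
    (fun b z => if classifierOf d (w.map Letter.sym) z.1 != z.2 then b + 1 else b)
    (fun _ _ => True) (3 * N ^ 2 + 40 * N + 40) (by simp)
    (by intro b a l _; simp [dataL, exampleL]) (by
      intro b z l _
      refine (Run.testStep q₀ _ z w (dataL l) ?_ ?_ ?_ ?_ ?_ ?_ ?_ N hN).cast le_rfl ?_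
      · simpa using hr
      · simp [dataL]
      · simpa [St.set_var] using hwr
      · simpa [St.set_var] using hw2
      · simpa [St.set_var] using hcw
      · simpa [St.set_var] using ht1
      · simpa [St.set_var] using hc
      · refine St.ext' rfl rfl fun y => ?_
        cases y <;> simp [St.set_var]
        split_ifs <;> simp [List.replicate_succ]) (by simp [dataL]) 0 Z trivial
  have hf : ∀ (Z : Dataset d) (b : ℕ),
      Z.foldl (fun b z => if classifierOf d (w.map Letter.sym) z.1 != z.2 then b + 1 else b) b =
        b + Z.countP fun z => classifierOf d (w.map Letter.sym) z.1 != z.2 := by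
    intro Z
    induction Z with
    | nil => simp
    | cons z Z ih =>
      intro b
      rw [List.foldl_cons, ih, List.countP_cons]
      split_ifs <;> omega
  rw [hf] at hl
  have hZ' : Z.length ≤ N := by
    refine le_trans ?_ hZ
    rw [length_dataL]
    exact Nat.le_mul_of_pos_right _ (by omega)
  apply Run.cast
  · apply Run.seq (Run.copy Var.test Var.tw Var.t1 (by decide) (by decide) (by decide) s ht1)
    apply hl.congr
    refine St.ext' rfl rfl fun y => ?_
    cases y <;> simp [St.set_var, herr, htw, htest]
  · rw [htest]
    have := Nat.mul_le_mul_right (3 * N ^ 2 + 40 * N + 40 + 1) hZ'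
    ring_nf at this ⊢
    omega
  · refine St.ext' rfl rfl fun y => ?_
    cases y <;> simp [St.set_var, htw, dataL]

/-! ### The program: computing a candidate -/

section
variable {Q τ : Type}

/-- Move the first examples of a word to another stack, reversing them. The number of examples is
given in unary. -/
def takeExamples (n x y : Var) : Prog (Reg Q) Var τ :=
  .forEach n (.seq (.pop n) (.seq (load x y) (.xfer x fun z => decide (z = y))))

theorem Run.takeExamples (n x y : Var) (hnx : n ≠ x) (hny : n ≠ y) (hxy : x ≠ y)
    (s : St (Reg Q) Var τ) {d : ℕ} (L : Dataset d) (j : ℕ) (hj : j ≤ L.length)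
    (hn : s.var n = List.replicate j .pos) (hx : s.var x = dataL L) :
    Run (takeExamples n x y) s (j * (3 * d + 9) + 1)
      (((s.set n []).set x (dataL (L.drop j))).set y ((dataL (L.take j)).reverse ++ s.var y)) := by
  induction j generalizing s L with
  | zero =>
    refine (Run.loop_false (by simp [hn])).cast (by omega) ?_
    refine St.ext' rfl rfl fun z => ?_
    simp only [St.set_var]
    split_ifs with h1 h2 h3 <;> simp_all [dataL]
  | succ j ih =>
    rcases L with - | ⟨z, L⟩
    · simp at hj
    have hs := ih (s := ((s.set n (List.replicate j .pos)).set x (dataL L)).set y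
        ((exampleL z).reverse ++ s.var y)) L (by simpa using hj)
        (by simp [St.set_var, hnx, hny]) (by simp [St.set_var, hxy])
    refine (Run.loop_true (T := 3 * d + 8) (by simp [hn, List.replicate_succ]) ?_ hs).cast
      (by ring_nf; omega) ?_
    · apply Run.cast
      · apply Run.seq (Run.pop _ _)
        apply Run.seq
        · exact Run.load x y hxy _ (List.ofFn z.1 ++ [z.2]) (dataL L)
            (by simp [St.set_var, hnx.symm, hx, dataL, exampleL])
        · exact Run.xfer_one x y hxy _ .sep (dataL L) (by simp)
      · simp
        omega
      · refine St.ext' rfl rfl fun v => ?_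
        simp only [St.set_var]
        split_ifs <;> simp_all [exampleL, List.replicate_succ]
    · refine St.ext' rfl rfl fun v => ?_
      simp only [St.set_var]
      split_ifs <;> simp_all [dataL]

end

variable {e : ℕ} {Q : Type}

/-- The tapes of the simulated machine with an input on the first tape. -/
def inTape (w : List Letter) (i : Fin (e + 2)) : Turing.Tape Sym :=
  if i = 0 then Turing.Tape.mk₁ (w.map Letter.sym) else Turing.Tape.mk₁ []

/-- Move to the left on the first raw tape. -/
def rawLeft : Prog (Reg Q) Var (Fin (e + 2)) :=
  .op (fun _ => false) (fun _ => false) fun v =>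
    { v.emit .pos with act := fun i => (v.scan i, if i = 0 then some .left else none) }

/-- Write on the first raw tape. -/
def rawWrite (P : Var → Bool) (f : View (Reg Q) Var (Fin (e + 2)) → Letter) :
    Prog (Reg Q) Var (Fin (e + 2)) :=
  .op (fun _ => false) P fun v =>
    { v.emit .pos with act := fun i => (if i = 0 then (f v).sym else v.scan i, none) }

/-- Put a letter in front of the word on the first raw tape. -/
def feedOne (a : Letter) : Prog (Reg Q) Var (Fin (e + 2)) :=
  .seq rawLeft (rawWrite (fun _ => false) fun _ => a)

/-- Put the letters of a stack in front of the word on the first raw tape. -/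
def feed (x : Var) : Prog (Reg Q) Var (Fin (e + 2)) :=
  .forEach x (.seq rawLeft (rawWrite (fun z => decide (z = x)) fun v => (v.top x).getD .pos))

/-- A push on a raw tape takes two instructions, a move to the left and a write. The letter is
chosen after the move, so by `hf` it must not depend on the raw tapes. -/
theorem Run.rawPush (P : Var → Bool) (f : View (Reg Q) Var (Fin (e + 2)) → Letter)
    (s s' : St (Reg Q) Var (Fin (e + 2))) (u : List Letter) (a : Letter) (hs : s.tape = inTape u)
    (hr : s'.reg = s.reg) (hv : s'.var = fun z => if P z then (s.var z).tail else s.var z)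
    (ht : s'.tape = inTape (a :: u))
    (hf : ∀ T, f (s.setTape T).view = a) :
    Run (.seq rawLeft (rawWrite P f)) s 4 s' := by
  refine (Run.op rfl).seq (Run.op ?_)
  have h1 : (s.app (fun _ => false) (fun _ => false) fun v => { v.emit .pos with
      act := fun i => (v.scan i, if i = 0 then some .left else none) }) =
      s.setTape fun i => if i = 0 then (s.tape i).move .left else s.tape i := by
    ext1
    · rfl
    · funext z
      simp [St.app]
    · funext i
      by_cases h : i = 0 <;> simp [St.app, St.mask, h, act_left]
  rw [h1]
  have h2 : ∀ T, (s.setTape T).mask (fun _ => false) = (s.setTape T).view := by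
    intro T
    simp [St.mask, St.view]
  ext1
  · simp [St.app, h2, View.emit, hr]
  · simp [St.app, hv]
  · funext i
    rw [ht]
    by_cases h : i = 0
    · simp only [St.app, h2, hf, h, if_true, St.setTape_tape, act_none, hs]
      simp [inTape, write_move_left]
    · simp [St.app, h2, h, hs, inTape]

theorem Run.feedOne (a : Letter) (s : St (Reg Q) Var (Fin (e + 2))) (u : List Letter)
    (hs : s.tape = inTape u) : Run (feedOne a) s 4 (s.setTape (inTape (a :: u))) :=
  Run.rawPush _ _ s _ u a hs rfl (by simp) rfl fun _ => rfl

theorem Run.feed (x : Var) (s : St (Reg Q) Var (Fin (e + 2))) (u : List Letter)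
    (hs : s.tape = inTape u) :
    Run (feed x) s (5 * (s.var x).length + 1)
      ((s.setTape (inTape ((s.var x).reverse ++ u))).set x []) := by
  have := Run.forEach (p := .seq rawLeft (rawWrite (fun z => decide (z = x))
      fun v => (v.top x).getD .pos)) x
    (fun b : List Letter => s.setTape (inTape b)) (fun b a => a :: b)
    (fun _ _ => True) 4 (by simp) (fun b a l _ => by
      refine Run.rawPush _ _ _ _ b a rfl rfl ?_ rfl ?_
      · funext z
        by_cases h : z = x <;> simp [St.set_var, h]
      · simp) u (s.var x) trivial
  have hf : ∀ (l b : List Letter), l.foldl (fun b a => a :: b) b = l.reverse ++ b := by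
    intro l
    induction l with
    | nil => simp
    | cons a l ih => simp [ih]
  rw [hf] at this
  refine (this.congr ?_).cast (by omega) rfl
  ext1
  · rfl
  · funext z
    by_cases h : z = x <;> simp [St.set_var, h]
  · exact hs.symm

theorem Run.feedOf (x : Var) (v u : List Letter) (s : St (Reg Q) Var (Fin (e + 2)))
    (hx : s.var x = v) (hs : s.tape = inTape u) :
    Run (AlgLearn.feed x) s (5 * v.length + 1)
      ((s.setTape (inTape (v.reverse ++ u))).set x []) :=
  (Run.feed x s u hs).cast (by simp [hx]) (by simp [hx])

/-- Put the input of the simulated machine on its first tape. -/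
def build : Prog (Reg Q) Var (Fin (e + 2)) :=
  .seq (.copy .zp .t2 .t1) <| .seq (.copy .tv .t3 .t1) <| .seq (takeExamples .t3 .t2 .cw) <|
  .seq (.clear .t2) <| .seq (feed .cw) <| .seq (feedOne .bar) <|
  .seq (.copy .zr .t2 .t1) <| .seq (feed .t2) <| .seq (feedOne .sep) <|
  .seq (.copy .kv .t2 .t1) <| .seq (feed .t2) <| .seq (feedOne .sep) <|
  .seq (.copy .sv .t2 .t1) (feed .t2)

theorem length_dataL_take_le {d : ℕ} (L : Dataset d) (j : ℕ) :
    (dataL (L.take j)).length ≤ (dataL L).length := by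
  rw [length_dataL, length_dataL]
  exact Nat.mul_le_mul_right _ (by simp)

theorem length_dataL_drop_le {d : ℕ} (L : Dataset d) (j : ℕ) :
    (dataL (L.drop j)).length ≤ (dataL L).length := by
  rw [length_dataL, length_dataL]
  exact Nat.mul_le_mul_right _ (by simp)

/-- The input is assembled from its end to its beginning, since letters can only be put in front of
the word on the tape. `feed` reverses what it reads; this is why `zr` stores the first dataset in
reverse, while the order is immaterial for unary numbers. -/
theorem Run.build (s : St (Reg Q) Var (Fin (e + 2))) {d : ℕ} (Z Z' : Dataset d) (σ κ t N : ℕ)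
    (ht : t ≤ Z'.length) (htape : s.tape = inTape []) (hzr : s.var .zr = (dataL Z).reverse)
    (hzp : s.var .zp = dataL Z') (hsv : s.var .sv = List.replicate σ .pos)
    (hkv : s.var .kv = List.replicate κ .pos) (htv : s.var .tv = List.replicate t .pos)
    (h1 : s.var .t1 = []) (h2 : s.var .t2 = []) (h3 : s.var .t3 = []) (hcw : s.var .cw = [])
    (hN : (dataL Z).length ≤ N) (hN' : (dataL Z').length ≤ N) (hσ : σ ≤ N) (hκ : κ ≤ N) :
    Run build s (100 * N + 100)
      (s.setTape (inTape (unaryL σ ++ (unaryL κ ++ inputL Z (Z'.take t))))) := by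
  have hl : t * (3 * d + 9) ≤ 6 * N := by
    have : t * (d + 2) ≤ Z'.length * (d + 2) := Nat.mul_le_mul_right _ ht
    rw [← length_dataL] at this
    calc t * (3 * d + 9) ≤ 6 * (t * (d + 2)) := by ring_nf; omega
      _ ≤ 6 * N := by omega
  have hl' := length_dataL_take_le Z' t
  have hl'' := length_dataL_drop_le Z' t
  have hl3 : t ≤ N := ht.trans (le_trans (by
    rw [length_dataL]; exact Nat.le_mul_of_pos_right _ (by omega)) hN')
  apply Run.cast
  · apply Run.seq (Run.copyOf Var.zp Var.t2 Var.t1 _ _ hzp h2 h1 (by decide) (by decide)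
      (by decide))
    apply Run.seq (Run.copyOf Var.tv Var.t3 Var.t1 (List.replicate t .pos) _
      (by simp [St.set_var, htv]) (by simp [St.set_var, h3]) (by simp [St.set_var, h1])
      (by decide) (by decide) (by decide))
    apply Run.seq ((Run.takeExamples .t3 .t2 .cw (by decide) (by decide) (by decide) _ Z' t ht
      (by simp) (by simp [St.set_var])).cast le_rfl rfl)
    -- The nested updates so far are replaced by the two that matter: the unused examples on `t2`,
    -- and the reversed prefix on `cw`.
    apply Run.congr (s := (s.set .t2 (dataL (Z'.drop t))).set .cw (dataL (Z'.take t)).reverse)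
    apply Run.seq (Run.clearOf Var.t2 (dataL (Z'.drop t)) _ (by simp [St.set_var]))
    apply Run.seq (Run.feedOf .cw (dataL (Z'.take t)).reverse [] _ (by simp [St.set_var])
      (by simpa using htape))
    apply Run.seq (Run.feedOne .bar _ _ rfl)
    apply Run.seq (Run.copyOf Var.zr Var.t2 Var.t1 (dataL Z).reverse _
      (by simp [St.set_var, hzr]) (by simp [St.set_var]) (by simp [St.set_var, h1])
      (by decide) (by decide) (by decide))
    apply Run.seq (Run.feedOf .t2 (dataL Z).reverse _ _ (by simp) rfl)
    apply Run.seq (Run.feedOne .sep _ _ rfl)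
    apply Run.seq (Run.copyOf Var.kv Var.t2 Var.t1 (List.replicate κ .pos) _
      (by simp [St.set_var, hkv]) (by simp) (by simp [St.set_var, h1])
      (by decide) (by decide) (by decide))
    apply Run.seq (Run.feedOf .t2 (List.replicate κ .pos) _ _ (by simp) rfl)
    apply Run.seq (Run.feedOne .sep _ _ rfl)
    apply Run.seq (Run.copyOf Var.sv Var.t2 Var.t1 (List.replicate σ .pos) _
      (by simp [St.set_var, hsv]) (by simp) (by simp [St.set_var, h1])
      (by decide) (by decide) (by decide))
    exact Run.feedOf .t2 (List.replicate σ .pos) _ _ (by simp) rfl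
    refine St.ext' rfl rfl fun y => ?_
    cases y <;> simp [St.set_var, h3, hcw]
  · simp only [List.length_reverse, List.length_replicate]
    generalize (dataL (Z'.take t)).length = a at *
    generalize (dataL (Z'.drop t)).length = b at *
    generalize (dataL Z').length = c at *
    generalize (dataL Z).length = c' at *
    omega
  · refine St.ext' (by simp) ?_ fun y => ?_
    · simp [unaryL, inputL]
    · cases y <;> simp [St.set_var, h2, hcw]

/-! ### Tapes of bounded extent -/

theorem head_mk₂ (l r : List Sym) : (Turing.Tape.mk₂ l r).head = r.headD Sym.blank := by
  cases r <;> simp [Turing.Tape.mk₂]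

theorem write_mk₂ (l r : List Sym) (a : Sym) :
    (Turing.Tape.mk₂ l r).write a = Turing.Tape.mk₂ l (a :: r.tail) := by
  simp [Turing.Tape.mk₂, Turing.Tape.write_mk']

theorem move_left_mk₂ (l r : List Sym) :
    (Turing.Tape.mk₂ l r).move .left = Turing.Tape.mk₂ l.tail (l.headD Sym.blank :: r) := by
  cases l <;> simp [Turing.Tape.mk₂, Turing.Tape.move_left_mk']

theorem move_right_mk₂ (l r : List Sym) :
    (Turing.Tape.mk₂ l r).move .right = Turing.Tape.mk₂ (r.headD Sym.blank :: l) r.tail := by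
  cases r <;> simp [Turing.Tape.mk₂, Turing.Tape.move_right_mk']

theorem wordAt_mk₂ (l r : List Sym) :
    wordAt (Turing.Tape.mk₂ l r) = r.takeWhile fun a => a != Sym.blank := by
  unfold wordAt Turing.Tape.mk₂
  rw [Turing.Tape.mk'_right₀]
  rfl

theorem mk₂_blank (r : List Sym) :
    Turing.Tape.mk₂ [Sym.blank] r = Turing.Tape.mk₂ [] r := by
  have h : (Turing.ListBlank.mk [Sym.blank] : Turing.ListBlank Sym) = Turing.ListBlank.mk [] :=
    Quotient.sound' (Or.inr ⟨1, rfl⟩)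
  simp [Turing.Tape.mk₂, h]

/-- Only `K` cells around the head can be nonblank. -/
def Supp (K : ℕ) (T : Turing.Tape Sym) : Prop :=
  ∃ l r : List Sym, T = Turing.Tape.mk₂ l r ∧ l.length + r.length ≤ K

theorem Supp.mono {K K' : ℕ} {T : Turing.Tape Sym} (h : Supp K T) (hK : K ≤ K') : Supp K' T := by
  obtain ⟨l, r, hT, h⟩ := h
  exact ⟨l, r, hT, h.trans hK⟩

/-- Writing can add one cell to an empty right part, and moving can add another one at the border of
the described region. -/
theorem Supp.act {K : ℕ} {T : Turing.Tape Sym} (h : Supp K T) (a : Sym × Option Turing.Dir) :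
    Supp (K + 2) (AlgLearn.act T a) := by
  obtain ⟨l, r, rfl, h⟩ := h
  obtain ⟨a, _ | _ | _⟩ := a
  · exact ⟨_, _, by rw [AlgLearn.act, write_mk₂], by simp; omega⟩
  · exact ⟨_, _, by simp only [AlgLearn.act, write_mk₂, move_left_mk₂]; rfl, by simp; omega⟩
  · exact ⟨_, _, by simp only [AlgLearn.act, write_mk₂, move_right_mk₂]; rfl, by simp; omega⟩

/-- Erase the scanned symbol and move. -/
def erase (dir : Turing.Dir) (T : Turing.Tape Sym) : Turing.Tape Sym := act T (.blank, some dir)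

theorem iterate_erase_left (l r : List Sym) (n : ℕ) :
    ∃ r' : List Sym, (erase .left)^[n] (Turing.Tape.mk₂ l r) = Turing.Tape.mk₂ (l.drop n) r' ∧
      r'.length ≤ r.length + 1 + n := by
  induction n with
  | zero => exact ⟨r, by simp, by omega⟩
  | succ n ih =>
    obtain ⟨r', h, hr⟩ := ih
    refine ⟨(l.drop n).headD Sym.blank :: Sym.blank :: r'.tail, ?_, by simp; omega⟩
    rw [Function.iterate_succ_apply', h]
    simp only [erase, act, write_mk₂, move_left_mk₂]
    simp

theorem iterate_erase_right (r : List Sym) (n : ℕ) :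
    (erase .right)^[n] (Turing.Tape.mk₂ [] r) = Turing.Tape.mk₂ [] (r.drop n) := by
  induction n with
  | zero => simp
  | succ n ih =>
    rw [Function.iterate_succ_apply', ih]
    simp only [erase, act, write_mk₂, move_right_mk₂]
    simp [mk₂_blank]

/-- After `n > K` erasing moves to the left, nothing nonblank remains on the left, and the right
part has at most `K + 1 + n ≤ 2n` cells. Two erasing sweeps of `n` moves to the right clear it. The
final position is irrelevant, as tapes are described relative to the head. -/
theorem Supp.erase {K n : ℕ} {T : Turing.Tape Sym} (h : Supp K T) (hn : K + 1 ≤ n) :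
    (erase .right)^[n] ((erase .right)^[n] ((AlgLearn.erase .left)^[n] T)) =
      Turing.Tape.mk₁ [] := by
  obtain ⟨l, r, rfl, h⟩ := h
  obtain ⟨r', hr', hl⟩ := iterate_erase_left l r n
  rw [hr', List.drop_eq_nil_of_le (by omega), iterate_erase_right, iterate_erase_right,
    List.drop_drop, List.drop_eq_nil_of_le (by omega)]
  rfl

/-! ### The program: simulating a machine with a time limit -/

variable {e : ℕ}

/-- The configuration after at most `n` steps. -/
def Machine.after (A : Machine e) : ℕ → A.Cfg → A.Cfg
  | 0, c => c
  | n + 1, c => match A.step c with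
    | none => c
    | some c' => A.after n c'

/-- A run with a time limit is split into a simulation of at most `n` steps and a single test for
halting at its end, which is how the program proceeds. -/
theorem Machine.runFrom_eq_after (A : Machine e) (n : ℕ) (c : A.Cfg) :
    A.runFrom n c = if (A.step (A.after n c)).isNone then some (wordAt ((A.after n c).tape 1))
      else none := by
  induction n generalizing c with
  | zero => cases h : A.step c <;> simp [Machine.runFrom, Machine.after, h]
  | succ n ih =>
    cases h : A.step c with
    | none => simp [Machine.runFrom, Machine.after, h]
    | some c' => simp [Machine.runFrom, Machine.after, h, ih]

theorem Machine.supp_after (A : Machine e) (n K : ℕ) (c : A.Cfg) (h : ∀ i, Supp K (c.tape i)) :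
    ∀ i, Supp (K + 2 * n) ((A.after n c).tape i) := by
  induction n generalizing c K with
  | zero => exact h
  | succ n ih =>
    intro i
    cases hc : A.step c with
    | none =>
      simp only [Machine.after, hc]
      exact (h i).mono (by omega)
    | some c' =>
      simp only [Machine.after, hc]
      refine (ih (K + 2) c' (fun i => ?_) i).mono (by omega)
      simp only [Machine.step, Option.map_eq_some_iff] at hc
      obtain ⟨p, -, rfl⟩ := hc
      exact (h i).act _

/-- Simulate a machine as long as the clock permits. -/
def sim (A : Machine e) : Prog (Reg A.State) Var (Fin (e + 2)) :=
  .loop (fun v => (A.trans v.reg.st v.scan).isSome && (v.top .clock).isSome)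
    (.op (fun _ => false) (fun z => decide (z = .clock)) fun v =>
      match A.trans v.reg.st v.scan with
      | none => v.emit .pos
      | some p => { v.emit .pos with reg := { v.reg with st := p.1 }, act := p.2 })

/-- One letter of the clock is spent per simulated step. What is left of it after an early halt is
of no interest, so only its length is recorded. -/
theorem Run.sim (A : Machine e) (s : St (Reg A.State) Var (Fin (e + 2))) (c : A.Cfg) (n : ℕ)
    (hr : s.reg.st = c.state) (ht : s.tape = c.tape) (hc : s.var .clock = List.replicate n .pos) :
    ∃ u : List Letter, u.length ≤ n ∧ Run (sim A) s (3 * n + 1)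
      (((s.setReg { s.reg with st := (A.after n c).state }).setTape (A.after n c).tape).set
        .clock u) := by
  -- When the loop ends at once, the final state of the statement is the present one.
  have halted (hA : A.after n c = c) : ((s.setReg { s.reg with st := (A.after n c).state }).setTape
      (A.after n c).tape).set .clock (List.replicate n .pos) = s := by
    rw [hA, ← hr, ← ht, ← hc]
    refine St.ext' rfl rfl fun z => ?_
    by_cases h : z = .clock <;> simp [St.set_var, h]
  induction n generalizing s c with
  | zero =>
    refine ⟨[], le_rfl, (Run.loop_false ?_).cast (by omega) (halted rfl).symm⟩
    simp [hc]
  | succ n ih =>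
    cases hA : A.trans c.state fun i => (c.tape i).head with
    | none =>
      have hstep : A.step c = none := by simp [Machine.step, hA]
      refine ⟨List.replicate (n + 1) .pos, by simp, (Run.loop_false ?_).cast (by omega)
        (halted (by simp [Machine.after, hstep])).symm⟩
      have : s.view.scan = fun i => (c.tape i).head := by funext i; simp [ht]
      rw [this]
      simp [hr, hA]
    | some p =>
      have hv : s.view.scan = fun i => (c.tape i).head := by funext i; simp [ht]
      have hstep : A.step c = some ⟨p.1, fun i => act (c.tape i) (p.2 i)⟩ := by
        simp [Machine.step, hA]
      have hafter : A.after (n + 1) c = A.after n ⟨p.1, fun i => act (c.tape i) (p.2 i)⟩ := by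
        simp [Machine.after, hstep]
      obtain ⟨u, hu, h⟩ := ih (((s.setReg { s.reg with st := p.1 }).setTape fun i =>
        act (c.tape i) (p.2 i)).set .clock (List.replicate n .pos))
        ⟨p.1, fun i => act (c.tape i) (p.2 i)⟩ rfl rfl (by simp) (by
          intro hA
          rw [hA]
          refine St.ext' rfl rfl fun z => ?_
          by_cases h : z = .clock <;> simp [St.set_var, h])
      refine ⟨u, by omega, (Run.loop_true ?_ (Run.op ?_) h).cast (by omega) ?_⟩
      · rw [hv]
        simp [hr, hA, hc, List.replicate_succ]
      · have hm : (s.mask fun _ => false).scan = fun i => (c.tape i).head := by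
          funext i; simp [St.mask, ht]
        have hm' : (s.mask fun _ => false).reg = s.reg := rfl
        ext1
        · simp [St.app, hm, hm', hr, hA]
        · funext z
          by_cases h : z = .clock <;> simp [St.app, St.set_var, h, hc]
        · funext i
          simp [St.app, hm, hm', hr, hA, ht]
      · rw [hafter]
        refine St.ext' rfl rfl fun z => ?_
        by_cases h : z = .clock <;> simp [St.set_var, h]

variable {Q : Type}

/-- Copy the output of the simulated machine. -/
def copyOut : Prog (Reg Q) Var (Fin (e + 2)) :=
  .loop (fun v => (v.scan 1).letter.isSome)
    (.op (fun z => decide (z = .t1)) (fun _ => false) fun v =>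
      { v.emit ((v.scan 1).letter.getD .pos) with
        act := fun i => (v.scan i, if i = 1 then some .right else none) })

theorem Sym.letter_eq_some {a : Sym} (h : a ≠ Sym.blank) : ∃ b : Letter, b.sym = a := by
  cases a
  · exact absurd rfl h
  · exact ⟨.neg, rfl⟩
  · exact ⟨.pos, rfl⟩
  · exact ⟨.sep, rfl⟩
  · exact ⟨.bar, rfl⟩

/-- Reading moves the head along the output, so the tape changes to some `X`. Only the extent of `X`
matters, because the tape is erased afterwards. -/
theorem Run.copyOut (s : St (Reg Q) Var (Fin (e + 2))) (l r : List Sym)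
    (hs : s.tape 1 = Turing.Tape.mk₂ l r) :
    ∃ (w : List Letter) (X : Turing.Tape Sym),
      w.map Letter.sym = (r.takeWhile fun a => a != Sym.blank) ∧ Supp (l.length + r.length) X ∧
      Run copyOut s (3 * r.length + 1)
        ((s.setTape (Function.update s.tape 1 X)).set .t1 (w.reverse ++ s.var .t1)) := by
  have halted (s : St (Reg Q) Var (Fin (e + 2))) (l r : List Sym)
      (hs : s.tape 1 = Turing.Tape.mk₂ l r) (h : r.headD Sym.blank = Sym.blank) :
      ∃ (w : List Letter) (X : Turing.Tape Sym),
      w.map Letter.sym = (r.takeWhile fun a => a != Sym.blank) ∧ Supp (l.length + r.length) X ∧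
      Run AlgLearn.copyOut s (3 * r.length + 1)
        ((s.setTape (Function.update s.tape 1 X)).set .t1 (w.reverse ++ s.var .t1)) := by
    refine ⟨[], s.tape 1, by cases r <;> simp_all, ⟨l, r, hs, le_rfl⟩,
      (Run.loop_false ?_).cast (by omega) ?_⟩
    · rw [St.view_scan, hs, head_mk₂, h]
      rfl
    · refine St.ext' rfl (by simp) fun z => ?_
      by_cases h : z = .t1 <;> simp [St.set_var, h]
  induction r generalizing s l with
  | nil => exact halted s l [] hs rfl
  | cons a r ih =>
    by_cases ha : a = Sym.blank
    · exact halted s l _ hs (by simpa using ha)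
    · obtain ⟨b, rfl⟩ := Sym.letter_eq_some ha
      have hX : act (s.tape 1) (b.sym, some .right) = Turing.Tape.mk₂ (b.sym :: l) r := by
        simp [act, hs, write_mk₂, move_right_mk₂]
      obtain ⟨w, X, hw, hsupp, hrun⟩ := ih ((s.setTape (Function.update s.tape 1
        (Turing.Tape.mk₂ (b.sym :: l) r))).set .t1 (b :: s.var .t1)) (b.sym :: l) (by simp)
      refine ⟨b :: w, X, by simp [hw], hsupp.mono (by simp; omega),
        (Run.loop_true ?_ (Run.op ?_) hrun).cast (by simp; omega) ?_⟩
      · simp [hs, head_mk₂]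
      · have hm : (s.mask fun z => decide (z = .t1)).scan 1 = b.sym := by
          simp [St.mask, hs, head_mk₂]
        ext1
        · rfl
        · funext z
          by_cases h : z = .t1 <;> simp [St.app, St.set_var, View.emit, h, hm]
        · funext i
          by_cases h : i = 1
          · subst h
            simp [St.app, hm, hX]
          · simp [St.app, St.mask, h]
      · refine St.ext' rfl (by simp) fun z => ?_
        by_cases h : z = .t1 <;> simp [St.set_var, h]

/-- Erase the raw tapes in one direction. -/
def sweep (x : Var) (dir : Turing.Dir) : Prog (Reg Q) Var (Fin (e + 2)) :=
  .forEach x (.op (fun _ => false) (fun z => decide (z = x)) fun v =>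
    { v.emit .pos with act := fun _ => (.blank, some dir) })

theorem Run.sweep (x : Var) (dir : Turing.Dir) (s : St (Reg Q) Var (Fin (e + 2)))
    (u : List Letter) (hx : s.var x = u) :
    Run (sweep x dir) s (3 * u.length + 1)
      ((s.setTape fun i => (erase dir)^[u.length] (s.tape i)).set x []) := by
  have := Run.forEach (p := .op (fun _ => false) (fun z => decide (z = x)) fun v =>
      { v.emit .pos with act := fun _ => (.blank, some dir) }) x
    (fun n : ℕ => s.setTape fun i => (erase dir)^[n] (s.tape i)) (fun n _ => n + 1)
    (fun _ _ => True) 2 (by simp) (fun n a l _ => by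
      refine Run.op ?_
      ext1
      · rfl
      · funext z
        by_cases h : z = x <;> simp [St.app, St.set_var, h]
      · funext i
        simp only [St.app, St.set_tape, St.setTape_tape, Function.iterate_succ_apply']
        rfl) 0 u trivial
  have hf : ∀ (l : List Letter) (n : ℕ), l.foldl (fun n _ => n + 1) n = n + l.length := by
    intro l
    induction l with
    | nil => simp
    | cons a l ih => intro n; simp [ih]; omega
  rw [hf, zero_add] at this
  refine (this.congr ?_).cast (by omega) rfl
  refine St.ext' rfl rfl fun z => ?_
  by_cases h : z = x <;> simp [St.set_var, h, hx]

/-- Compute a candidate. -/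
def candProg (A : Machine e) : Prog (Reg A.State) Var (Fin (e + 2)) :=
  .seq build <| .seq (.copy .mc .clock .t1) <| .seq (sim A) <|
  .seq (.ite (fun v => (A.trans v.reg.st v.scan).isNone) copyOut .skip) <|
  .seq (.moveAll .t1 .cand) <| .seq (.clear .clock) <| .seq (.assign fun _ => Reg.zero A.start) <|
  .seq (.copy .cl .t2 .t1) <| .seq (sweep .t2 .left) <|
  .seq (.copy .cl .t2 .t1) <| .seq (sweep .t2 .right) <|
  .seq (.copy .cl .t2 .t1) (sweep .t2 .right)

/-- Apart from `cand`, everything is restored, including blank raw tapes, so that the loops can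
repeat the program. The stack `cl` provides the length of the erasing sweeps. -/
theorem Run.candProg (A : Machine e) (s : St (Reg A.State) Var (Fin (e + 2))) {d : ℕ}
    (Z Z' : Dataset d) (σ κ t N : ℕ) (hreg : s.reg = Reg.zero A.start)
    (ht : t ≤ Z'.length) (htape : s.tape = inTape []) (hzr : s.var .zr = (dataL Z).reverse)
    (hzp : s.var .zp = dataL Z') (hsv : s.var .sv = List.replicate σ .pos)
    (hkv : s.var .kv = List.replicate κ .pos) (htv : s.var .tv = List.replicate t .pos)
    (hmc : s.var .mc = List.replicate Z'.length .pos)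
    (h1 : s.var .t1 = []) (h2 : s.var .t2 = []) (h3 : s.var .t3 = []) (hcw : s.var .cw = [])
    (hclock : s.var .clock = []) (hcand : s.var .cand = [])
    (hσ : σ ≤ Z'.length) (hκ : κ ≤ Z'.length)
    (hcl : (dataL Z).length + (dataL Z').length + 4 * Z'.length + 4 ≤ (s.var .cl).length)
    (hN : (s.var .cl).length ≤ N) :
    ∃ w : List Letter, w.map Letter.sym = candidate A Z Z' (σ, κ, t) ∧ w.length ≤ N ∧
      Run (candProg A) s (200 * N + 200) (s.set .cand w) := by
  set input := unaryL σ ++ (unaryL κ ++ inputL Z (Z'.take t)) with hinput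
  set c := A.init (input.map Letter.sym) with hc
  have hct : c.tape = inTape input := by
    funext i
    rw [hc, Machine.init, inTape]
  have hlen : input.length ≤ (dataL Z).length + (dataL Z').length + 2 * Z'.length + 3 := by
    have := length_dataL_take_le Z' t
    simp only [hinput, unaryL, inputL, List.length_append, List.length_replicate, List.length_cons,
      List.length_nil]
    omega
  obtain ⟨u, hu, hsim⟩ := Run.sim A ((s.setTape (inTape input)).set .clock
    (List.replicate Z'.length .pos)) c Z'.length (by simp [hreg, Reg.zero, hc, Machine.init])
    (by simp [hct]) (by simp)
  have hsupp : ∀ i, Supp (input.length + 2 * Z'.length) ((A.after Z'.length c).tape i) := by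
    refine A.supp_after _ _ c fun i => ?_
    rw [hct]
    by_cases h : i = 0
    · exact ⟨[], input.map Letter.sym, by simp [inTape, h, Turing.Tape.mk₁], by simp⟩
    · exact ⟨[], [], by simp [inTape, h, Turing.Tape.mk₁], by simp⟩
  set c' := A.after Z'.length c with hc'
  set s₁ := ((s.setReg { s.reg with st := c'.state }).setTape c'.tape).set .clock u with hs₁
  have hcandidate : candidate A Z Z' (σ, κ, t) = (A.runFrom Z'.length c).getD [] := by
    simp only [candidate, Machine.run, hc, hinput, codeParams_eq, codeInput_eq, List.map_append,
      List.append_assoc]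
  obtain ⟨l, r, htl, hlr⟩ := hsupp 1
  have hcopy : ∃ (w : List Letter) (X : Turing.Tape Sym), w.map Letter.sym =
      candidate A Z Z' (σ, κ, t) ∧ w.length ≤ input.length + 2 * Z'.length ∧
      Supp (input.length + 2 * Z'.length) X ∧
      Run (.ite (fun v => (A.trans v.reg.st v.scan).isNone) AlgLearn.copyOut .skip) s₁
        (3 * (input.length + 2 * Z'.length) + 3)
        ((s₁.setTape (Function.update s₁.tape 1 X)).set .t1 w.reverse) := by
    have hv : (A.trans s₁.view.reg.st s₁.view.scan).isNone = (A.step c').isNone := by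
      simp only [Machine.step, Option.isNone_map]
      rfl
    rw [hcandidate, A.runFrom_eq_after, ← hc']
    cases hstep : (A.step c').isNone
    -- The time limit is exceeded: nothing is copied, and the candidate is the empty word.
    · refine ⟨[], s₁.tape 1, by simp, by simp, hsupp 1, (Run.ite_false (hv.trans hstep)
        (Run.skip _)).cast (by omega) ?_⟩
      refine St.ext' (by simp) (by simp) fun z => ?_
      by_cases h : z = .t1 <;> simp [hs₁, St.set_var, h, h1]
    · obtain ⟨w, X, hw, hX, hrun⟩ := Run.copyOut s₁ l r (by simpa [hs₁] using htl)
      refine ⟨w, X, by simp [hw, htl, wordAt_mk₂], ?_, hX.mono hlr,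
        (Run.ite_true (hv.trans hstep) hrun).cast (by omega) ?_⟩
      · have := congrArg List.length hw
        rw [List.length_map] at this
        rw [this]
        exact (List.takeWhile_prefix _).length_le.trans (by omega)
      · simp [hs₁, St.set_var, h1]
  obtain ⟨w, X, hw, hwl, hX, hrun⟩ := hcopy
  refine ⟨w, hw, by omega, ?_⟩
  have hZ' : Z'.length ≤ (dataL Z').length := by
    rw [length_dataL]
    exact Nat.le_mul_of_pos_right _ (by omega)
  generalize hclv : s.var .cl = cl at *
  apply Run.cast
  · apply Run.seq (Run.build s Z Z' σ κ t N ht htape hzr hzp hsv hkv htv h1 h2 h3 hcw (by omega)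
      (by omega) (by omega) (by omega))
    rw [← hinput]
    apply Run.seq (Run.copyOf Var.mc Var.clock Var.t1 (List.replicate Z'.length .pos) _
      (by simpa using hmc) (by simpa using hclock) (by simpa using h1) (by decide) (by decide)
      (by decide))
    apply Run.seq (s' := s₁) (hsim.cast le_rfl ?_)
    apply Run.seq hrun
    apply Run.seq (Run.moveOf Var.t1 Var.cand w.reverse _ (by simp)
      (by simp [hs₁, St.set_var, hcand]) (by decide))
    apply Run.seq (Run.clearOf Var.clock u _ (by simp [hs₁, St.set_var]))
    apply Run.seq (Run.assign _ _)
    apply Run.congr (s := (s.setTape (Function.update c'.tape 1 X)).set .cand w)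
    · apply Run.seq (Run.copyOf Var.cl Var.t2 Var.t1 cl _ (by simp [St.set_var, hclv])
        (by simp [St.set_var, h2]) (by simp [St.set_var, h1]) (by decide) (by decide) (by decide))
      apply Run.seq (Run.sweep .t2 .left _ cl (by simp))
      apply Run.seq (Run.copyOf Var.cl Var.t2 Var.t1 cl _ (by simp [St.set_var, hclv])
        (by simp) (by simp [St.set_var, h1]) (by decide) (by decide) (by decide))
      apply Run.seq (Run.sweep .t2 .right _ cl (by simp))
      apply Run.seq (Run.copyOf Var.cl Var.t2 Var.t1 cl _ (by simp [St.set_var, hclv])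
        (by simp) (by simp [St.set_var, h1]) (by decide) (by decide) (by decide))
      exact Run.sweep .t2 .right _ cl (by simp)
    · refine St.ext' (by simp [hreg]) (by simp [hs₁]) fun z => ?_
      cases z <;> simp [hs₁, St.set_var, hclock, h1]
    · refine St.ext' (by simp [hs₁]) (by simp [hs₁]) fun z => ?_
      by_cases h : z = .clock <;> simp [hs₁, St.set_var, h]
  · simp only [List.length_reverse, List.length_replicate]
    generalize (dataL Z).length = a at *
    generalize (dataL Z').length = b at *
    omega
  · refine St.ext' (by simp) ?_ fun z => ?_
    · funext i
      have : Supp (input.length + 2 * Z'.length) (Function.update c'.tape 1 X i) := by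
        by_cases h : i = 1
        · subst h
          simpa using hX
        · simpa [h] using hsupp i
      simp only [St.set_tape, St.setTape_tape]
      -- The input has at most `|Z| + |Z'| + 2M + 3` letters (in code lengths, with `M` examples in
      -- `Z'`), and `M` steps add at most `2M` cells. One more is needed for a sweep, which explains
      -- `4M + 4` in `hcl`.
      rw [this.erase (by omega), htape]
      simp [inTape]
    · cases z <;> simp [St.set_var, h2]

/-! ### The program: the main loops -/

variable {e : ℕ}

/-- Keep the candidate if it has fewer errors than the best one so far. -/
def update {Q τ : Type} : Prog (Reg Q) Var τ :=
  .seq (.copy .err .t2 .t1) <| .seq (.copy .best .t3 .t1) <|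
  .seq (.forEach .t2 (.seq (.pop .t2) (.pop .t3))) <|
  .seq (.ite (fun v => (v.top .t3).isSome)
    (.seq (.clear .out) <| .seq (.moveAll .cand .t1) <| .seq (.moveAll .t1 .out) <|
      .seq (.clear .best) (.moveAll .err .best))
    (.seq (.clear .cand) (.clear .err))) (.clear .t3)

/-- Set the best number of errors and the best candidate. -/
def St.keep {Q τ : Type} (s : St (Reg Q) Var τ) (b : ℕ × List Letter) : St (Reg Q) Var τ :=
  (s.set .best (List.replicate b.1 .pos)).set .out b.2

/-- Subtraction is truncated because popping an empty stack does nothing. It decides comparisons: `a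
< b` holds exactly if something is left on `y`. -/
theorem Run.sub {Q τ : Type} (x y : Var) (hxy : x ≠ y) (s : St (Reg Q) Var τ) (a b : ℕ)
    (hx : s.var x = List.replicate a .pos) (hy : s.var y = List.replicate b .pos) :
    Run (.forEach x (.seq (.pop x) (.pop y))) s (5 * a + 1)
      ((s.set x []).set y (List.replicate (b - a) .pos)) := by
  induction a generalizing s b with
  | zero =>
    refine (Run.loop_false (by simp [hx])).cast (by omega) ?_
    refine St.ext' rfl rfl fun z => ?_
    simp only [St.set_var]
    split_ifs with h1 h2
    · simp [h1, hy]
    · simp [h2, hx]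
    · rfl
  | succ a ih =>
    have h := ih ((s.set x (List.replicate a .pos)).set y (List.replicate (b - 1) .pos)) (b - 1)
      (by simp [St.set_var, hxy]) (by simp)
    refine (Run.loop_true (T := 4) (by simp [hx, List.replicate_succ])
      ((Run.pop _ _).seq (Run.pop _ _)) (h.congr ?_)).cast (by omega) ?_
    · refine St.ext' rfl rfl fun z => ?_
      simp only [St.set_var]
      split_ifs <;> simp_all
    · refine St.ext' rfl rfl fun z => ?_
      simp only [St.set_var]
      split_ifs <;> simp_all [Nat.sub_sub, add_comm]

theorem Run.update {Q τ : Type} (s : St (Reg Q) Var τ) (b : ℕ × List Letter) (n : ℕ)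
    (w : List Letter) (h1 : s.var .t1 = []) (h2 : s.var .t2 = []) (h3 : s.var .t3 = [])
    (hcand : s.var .cand = []) (herr : s.var .err = []) (N : ℕ) (hn : n ≤ N) (hb : b.1 ≤ N)
    (hw : w.length ≤ N) (hb' : b.2.length ≤ N) :
    Run update (((s.keep b).set .cand w).set .err (List.replicate n .pos)) (50 * N + 50)
      (s.keep (if n < b.1 then (n, w) else b)) := by
  apply Run.cast
  · apply Run.seq (Run.copyOf Var.err Var.t2 Var.t1 (List.replicate n .pos) _ (by simp)
      (by simp [St.set_var, St.keep, h2]) (by simp [St.set_var, St.keep, h1]) (by decide)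
      (by decide) (by decide))
    apply Run.seq (Run.copyOf Var.best Var.t3 Var.t1 (List.replicate b.1 .pos) _
      (by simp [St.set_var, St.keep])
      (by simp [St.set_var, St.keep, h3]) (by simp [St.set_var, St.keep, h1]) (by decide)
      (by decide) (by decide))
    apply Run.seq (Run.sub .t2 .t3 (by decide) _ n b.1 (by simp [St.set_var]) (by simp))
    apply Run.seq (Run.ite (T := 20 * N + 20)
      (s' := (s.keep (if n < b.1 then (n, w) else b)).set .t3 (List.replicate (b.1 - n) .pos))
        ?_ ?_)
    · exact Run.clearOf Var.t3 (List.replicate (b.1 - n) .pos) _ (by simp)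
    · intro hc
      have hc' : n < b.1 := by
        have : b.1 - n ≠ 0 := by
          intro h
          simp [h] at hc
        omega
      rw [if_pos hc']
      apply Run.cast
      · apply Run.seq (Run.clearOf Var.out b.2 _ (by simp [St.set_var, St.keep]))
        apply Run.seq (Run.moveOf Var.cand Var.t1 w _ (by simp [St.set_var])
          (by simp [St.set_var, St.keep, h1]) (by decide))
        apply Run.seq (Run.moveOf Var.t1 Var.out w.reverse _ (by simp [St.set_var])
          (by simp [St.set_var]) (by decide))
        apply Run.seq (Run.clearOf Var.best (List.replicate b.1 .pos) _
          (by simp [St.set_var, St.keep]))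
        exact Run.moveOf Var.err Var.best (List.replicate n .pos) _ (by simp [St.set_var])
          (by simp) (by decide)
      · simp only [List.length_reverse, List.length_replicate]
        omega
      · refine St.ext' (by simp [St.keep]) (by simp [St.keep]) fun z => ?_
        cases z <;> simp [St.set_var, St.keep, h1, h2, hcand, herr]
    · intro hc
      have hc' : ¬ n < b.1 := by
        intro h
        obtain ⟨j, hj⟩ := Nat.exists_eq_succ_of_ne_zero (show b.1 - n ≠ 0 by omega)
        simp [hj, List.replicate_succ] at hc
      rw [if_neg hc']
      apply Run.cast
      · apply Run.seq (Run.clearOf Var.cand w _ (by simp [St.set_var]))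
        exact Run.clearOf Var.err (List.replicate n .pos) _ (by simp [St.set_var])
      · simp only [List.length_replicate]
        omega
      · refine St.ext' (by simp [St.keep]) (by simp [St.keep]) fun z => ?_
        cases z <;> simp [St.set_var, St.keep, h2, hcand, herr]
  · simp only [List.length_replicate]
    omega
  · refine St.ext' (by simp [St.keep]) (by simp [St.keep]) fun z => ?_
    cases z <;> simp [St.set_var, St.keep, h3]

/-- The body of the loops. -/
def body (A : Machine e) : Prog (Reg A.State) Var (Fin (e + 2)) :=
  .seq (candProg A) (.seq (countErr A.start) update)

/-- The number of test errors of a candidate. -/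
noncomputable def errors (A : Machine e) {d : ℕ} (Z Z' : Dataset d) (v : ℕ × ℕ × ℕ) : ℕ :=
  (Z'.rtake (loopBound Z'.length)).countP fun z =>
    classifierOf d (candidate A Z Z' v) z.1 != z.2

/-- Needed to store the output of the simulated machine on a stack, which holds letters only. -/
theorem blank_notMem_wordAt (T : Turing.Tape Sym) : Sym.blank ∉ wordAt T := by
  obtain ⟨L, R, rfl⟩ := T.exists_mk'
  induction R using Turing.ListBlank.induction_on with
  | _ r =>
    have : wordAt (Turing.Tape.mk' L (Turing.ListBlank.mk r)) =
        r.takeWhile fun a => a != Sym.blank := by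
      unfold wordAt
      rw [Turing.Tape.mk'_right₀]
      rfl
    rw [this]
    intro h
    simpa using List.mem_takeWhile_imp h

theorem blank_notMem_candidate (A : Machine e) {d : ℕ} (Z Z' : Dataset d) (v : ℕ × ℕ × ℕ) :
    Sym.blank ∉ candidate A Z Z' v := by
  simp only [candidate, Machine.run, A.runFrom_eq_after]
  split_ifs
  · exact blank_notMem_wordAt _
  · simp

/-- A candidate as a word of letters. -/
noncomputable def candL (A : Machine e) {d : ℕ} (Z Z' : Dataset d) (v : ℕ × ℕ × ℕ) :
    List Letter :=
  (exists_map_sym _ (blank_notMem_candidate A Z Z' v)).choose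

theorem candL_spec (A : Machine e) {d : ℕ} (Z Z' : Dataset d) (v : ℕ × ℕ × ℕ) :
    (candL A Z Z' v).map Letter.sym = candidate A Z Z' v :=
  (exists_map_sym _ (blank_notMem_candidate A Z Z' v)).choose_spec

/-- Keep the better candidate. -/
noncomputable def better (A : Machine e) {d : ℕ} (Z Z' : Dataset d) (b : ℕ × List Letter)
    (v : ℕ × ℕ × ℕ) : ℕ × List Letter :=
  if errors A Z Z' v < b.1 then (errors A Z Z' v, candL A Z Z' v) else b

/-- The state before the loops, except for the best candidate. The list on the stack `cl` serves
as a clock for the erasure of the tapes. -/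
structure Ready (A : Machine e) {d : ℕ} (Z Z' : Dataset d)
    (s : St (Reg A.State) Var (Fin (e + 2))) : Prop where
  reg : s.reg = Reg.zero A.start
  tape : s.tape = inTape []
  zr : s.var .zr = (dataL Z).reverse
  zp : s.var .zp = dataL Z'
  mc : s.var .mc = List.replicate Z'.length .pos
  rr : s.var .rr = List.replicate (loopBound Z'.length) .pos
  test : s.var .test = dataL (Z'.rtake (loopBound Z'.length))
  cl : (dataL Z).length + (dataL Z').length + 4 * Z'.length + 4 ≤ (s.var .cl).length
  empty : ∀ z, z ∈ [Var.cand, .err, .cw, .tw, .wr, .w2, .t1, .t2, .t3, .clock] → s.var z = []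

/-- The bounds on `better` are the invariant of the loops. They are obtained together with the run
because the length of a candidate is bounded through its computation. -/
theorem Run.body (A : Machine e) {d : ℕ} (Z Z' : Dataset d)
    (s : St (Reg A.State) Var (Fin (e + 2))) (hs : Ready A Z Z' s) (b : ℕ × List Letter)
    (σ κ t N : ℕ) (hσ : σ ≤ Z'.length) (hκ : κ ≤ Z'.length) (ht : t ≤ Z'.length)
    (hN : (s.var .cl).length + d ≤ N) (hb : b.1 ≤ N) (hb' : b.2.length ≤ N)
    (hsv : s.var .sv = List.replicate σ .pos)
    (hkv : s.var .kv = List.replicate κ .pos) (htv : s.var .tv = List.replicate t .pos) :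
    (better A Z Z' b (σ, κ, t)).1 ≤ N ∧ (better A Z Z' b (σ, κ, t)).2.length ≤ N ∧
    Run (body A) (s.keep b) (24 * N ^ 3 + 160 * N ^ 2 + 400 * N + 400)
      (s.keep (better A Z Z' b (σ, κ, t))) := by
  have hem := hs.empty
  simp only [List.mem_cons, forall_eq_or_imp, List.not_mem_nil, false_imp_iff, implies_true,
    and_true] at hem
  obtain ⟨hcand, herr, hcw, htw, hwr, hw2, h1, h2, h3, hclock⟩ := hem
  obtain ⟨w, hw, hwl, hrun⟩ := Run.candProg A (s.keep b) Z Z' σ κ t (s.var .cl).length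
    (by simpa [St.keep] using hs.reg) ht (by simpa [St.keep] using hs.tape)
    (by simpa [St.keep, St.set_var] using hs.zr) (by simpa [St.keep, St.set_var] using hs.zp)
    (by simpa [St.keep, St.set_var] using hsv) (by simpa [St.keep, St.set_var] using hkv)
    (by simpa [St.keep, St.set_var] using htv) (by simpa [St.keep, St.set_var] using hs.mc)
    (by simpa [St.keep, St.set_var] using h1) (by simpa [St.keep, St.set_var] using h2)
    (by simpa [St.keep, St.set_var] using h3) (by simpa [St.keep, St.set_var] using hcw)
    (by simpa [St.keep, St.set_var] using hclock) (by simpa [St.keep, St.set_var] using hcand)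
    hσ hκ (by simpa [St.keep, St.set_var] using hs.cl) (by simp [St.keep, St.set_var])
  have hwc : candL A Z Z' (σ, κ, t) = w :=
    Letter.sym_injective.list_map ((candL_spec A Z Z' _).trans hw.symm)
  have hcl := hs.cl
  have hrt : (dataL (Z'.rtake (loopBound Z'.length))).length ≤ (dataL Z').length :=
    length_dataL_drop_le Z' _
  have herrs : errors A Z Z' (σ, κ, t) ≤ Z'.length := by
    refine List.countP_le_length.trans ?_
    simp [List.rtake]
  have hcount := Run.countErr A.start ((s.keep b).set .cand w)
    (Z'.rtake (loopBound Z'.length)) w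
    (by simpa [St.keep] using hs.reg) (by simpa [St.keep, St.set_var] using hs.test)
    (by simpa [St.keep, St.set_var] using htw) (by simpa [St.keep, St.set_var] using hwr)
    (by simpa [St.keep, St.set_var] using hw2) (by simpa [St.keep, St.set_var] using hcw)
    (by simpa [St.keep, St.set_var] using h1) (by simpa [St.keep, St.set_var] using herr)
    (by simp) (2 * N) (by omega) (by omega)
  have hupd := Run.update s b (errors A Z Z' (σ, κ, t)) w h1 h2 h3 hcand herr N (by omega) hb
    (by omega) hb'
  rw [hw] at hcount
  refine ⟨?_, ?_, (hrun.seq (hcount.seq hupd)).cast ?_ ?_⟩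
  · unfold better
    split_ifs
    · simp only; omega
    · exact hb
  · unfold better
    split_ifs
    · simp only [hwc]; omega
    · exact hb'
  -- The leading terms are those of `Run.countErr` at `2 * N`: `3(2N)³ = 24N³` and `40(2N)² =
  -- 160N²`.
  · generalize (s.var .cl).length = a at *
    ring_nf
    nlinarith [Nat.zero_le (N ^ 2), Nat.zero_le (N ^ 3)]
  · rw [better, hwc]

/-- The loops over the triples. -/
def loops {Q τ : Type} (p : Prog (Reg Q) Var τ) : Prog (Reg Q) Var τ :=
  .seq (.copy .rr .sr .t1) <| .seq (.forEach .sr <|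
    .seq (.pop .sr) <| .seq (.push .sv .pos) <|
    .seq (.copy .rr .kr .t1) <| .seq (.forEach .kr <|
      .seq (.pop .kr) <| .seq (.push .kv .pos) <|
      .seq (.copy .rr .tr .t1) <| .seq (.forEach .tr <|
        .seq (.pop .tr) <| .seq (.push .tv .pos) p) (.clear .tv)) (.clear .kv)) (.clear .sv)

/-- A loop with a counter. -/
theorem Run.counter {Q τ β : Type} (w x c : Var) (p : Prog (Reg Q) Var τ) (r T : ℕ)
    (S : β → St (Reg Q) Var τ) (φ : β → ℕ → β) (I : β → Prop) (hxc : x ≠ c)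
    (hr : w ≠ x ∧ w ≠ c ∧ .t1 ≠ x ∧ .t1 ≠ c ∧ x ≠ .t1 ∧ w ≠ .t1)
    (hS : ∀ b, (S b).var w = List.replicate r .pos ∧ (S b).var .t1 = [] ∧ (S b).var x = [] ∧
      (S b).var c = [])
    (hI : ∀ b j, j < r → I b → I (φ b (j + 1)))
    (hstep : ∀ b j n, j + n + 1 = r → I b →
      Run p (((S b).set x (List.replicate n .pos)).set c (List.replicate (j + 1) .pos)) T
        (((S (φ b (j + 1))).set x (List.replicate n .pos)).set c (List.replicate (j + 1) .pos)))
    (b : β) (hb : I b) :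
    Run (.seq (.copy w x .t1) (.seq (.forEach x (.seq (.pop x) (.seq (.push c .pos) p)))
      (.clear c))) (S b) (r * (T + 20) + 10) (S ((List.range' 1 r).foldl φ b)) := by
  have hloop := Run.range' (c := fun v => (v.top x).isSome)
    (p := .seq (.pop x) (.seq (.push c .pos) p))
    (fun b j n => ((S b).set x (List.replicate n .pos)).set c (List.replicate j .pos)) φ I (T + 4) r
    hI (by intro b j n; simp [St.set_var, hxc, List.replicate_succ]) (by
      intro b j n hj hI
      refine ((Run.pop _ _).seq ((Run.push _ _ _).seq ((hstep b j n hj hI).congr ?_))).cast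
        (by omega) rfl
      refine St.ext' (by simp) (by simp) fun z => ?_
      simp only [St.set_var]
      split_ifs <;> simp_all [List.replicate_succ]) (by simp [St.set_var, hxc]) b hb
  obtain ⟨h1, h2, h3, h4⟩ := hS b
  obtain ⟨h1', h2', h3', h4'⟩ := hS ((List.range' 1 r).foldl φ b)
  refine ((Run.copyOf w x Var.t1 _ _ h1 h3 h2 hr.1 hr.2.2.2.2.2 hr.2.2.2.2.1).seq
    ((hloop.congr ?_).seq (Run.clearOf c (List.replicate r .pos) _ (by simp)))).cast ?_ ?_
  · refine St.ext' (by simp) (by simp) fun z => ?_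
    simp only [St.set_var]
    split_ifs <;> simp_all
  · simp only [List.length_replicate]
    ring_nf
    omega
  · refine St.ext' (by simp) (by simp) fun z => ?_
    simp only [St.set_var]
    split_ifs <;> simp_all

/-- The loops change only their counters and the best candidate, none of which is mentioned in
`Ready`. -/
theorem Ready.set {A : Machine e} {d : ℕ} {Z Z' : Dataset d}
    {s : St (Reg A.State) Var (Fin (e + 2))} (hs : Ready A Z Z' s) (z : Var) (w : List Letter)
    (hz : z ∈ [Var.inp, .out, .best, .sv, .sr, .kv, .kr, .tv, .tr]) :
    Ready A Z Z' (s.set z w) := by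
  have h : ∀ y, y ∉ [Var.inp, .out, .best, .sv, .sr, .kv, .kr, .tv, .tr] →
      (s.set z w).var y = s.var y := by
    intro y hy
    rw [St.set_var, if_neg]
    rintro rfl
    exact hy hz
  refine ⟨hs.reg, hs.tape, ?_, ?_, ?_, ?_, ?_, ?_, fun y hy => ?_⟩
  · rw [h _ (by decide), hs.zr]
  · rw [h _ (by decide), hs.zp]
  · rw [h _ (by decide), hs.mc]
  · rw [h _ (by decide), hs.rr]
  · rw [h _ (by decide), hs.test]
  · rw [h _ (by decide)]
    exact hs.cl
  · rw [h _ ?_, hs.empty y hy]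
    revert hy
    cases y <;> decide

/-- Three nested instances of `Run.counter`; in each inner one, the counters of the outer loops are
part of the fixed state. -/
theorem Run.loops (A : Machine e) {d : ℕ} (Z Z' : Dataset d)
    (s : St (Reg A.State) Var (Fin (e + 2))) (hs : Ready A Z Z' s) (b : ℕ × List Letter)
    (N : ℕ) (hN : (s.var .cl).length + d ≤ N) (hb : b.1 ≤ N) (hb' : b.2.length ≤ N)
    (hem : ∀ z, z ∈ [Var.sv, .sr, .kv, .kr, .tv, .tr] → s.var z = []) :
    Run (loops (AlgLearn.body A)) (s.keep b)
      (N * (N * (N * (24 * N ^ 3 + 160 * N ^ 2 + 400 * N + 420) + 30) + 30) + 10)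
      (s.keep ((triples (loopBound Z'.length)).foldl (better A Z Z') b)) := by
  simp only [List.mem_cons, forall_eq_or_imp, List.not_mem_nil, false_imp_iff, implies_true,
    and_true] at hem
  obtain ⟨hsv, hsr, hkv, hkr, htv, htr⟩ := hem
  have h1 : s.var .t1 = [] := hs.empty _ (by decide)
  have hrM := loopBound_le Z'.length
  have hcl := hs.cl
  have hrN : loopBound Z'.length ≤ N := by omega
  have hrr := hs.rr
  set r := loopBound Z'.length with hr
  -- The bounds do not mention a state, but they come from `Run.body`, which is applied to an
  -- auxiliary state with the required counters.
  have hb3 (b : ℕ × List Letter) (hb : b.1 ≤ N ∧ b.2.length ≤ N) (σ κ t : ℕ) (hσ : σ ≤ r)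
      (hκ : κ ≤ r) (ht : t ≤ r) : (better A Z Z' b (σ, κ, t)).1 ≤ N ∧
      (better A Z Z' b (σ, κ, t)).2.length ≤ N := by
    have := Run.body A Z Z' (((s.set .sv (List.replicate σ .pos)).set .kv
      (List.replicate κ .pos)).set .tv (List.replicate t .pos))
      (((hs.set _ _ (by decide)).set _ _ (by decide)).set _ _ (by decide)) b σ κ t N
      (by omega) (by omega) (by omega) (by simpa [St.set_var] using hN) hb.1 hb.2
      (by simp [St.set_var]) (by simp [St.set_var]) (by simp)
    exact ⟨this.1, this.2.1⟩
  have hfold {β : Type} (L : List ℕ) (φ : β → ℕ → β) (I : β → Prop)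
      (h : ∀ b, I b → ∀ j ∈ L, I (φ b j)) : ∀ b, I b → I (L.foldl φ b) := by
    induction L with
    | nil => exact fun b hb => hb
    | cons a L ih =>
      exact fun b hb => ih (fun b hb j hj => h b hb j (List.mem_cons_of_mem _ hj)) _
        (h b hb a List.mem_cons_self)
  have hb2 (b : ℕ × List Letter) (hb : b.1 ≤ N ∧ b.2.length ≤ N) (σ κ : ℕ) (hσ : σ ≤ r)
      (hκ : κ ≤ r) := hfold (List.range' 1 r) (fun b t => better A Z Z' b (σ, κ, t))
      (fun b => b.1 ≤ N ∧ b.2.length ≤ N)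
      (fun b hb t ht => hb3 b hb σ κ t hσ hκ (by simp at ht; omega)) b hb
  have hb1 (b : ℕ × List Letter) (hb : b.1 ≤ N ∧ b.2.length ≤ N) (σ : ℕ) (hσ : σ ≤ r) :=
    hfold (List.range' 1 r) (fun b κ => (List.range' 1 r).foldl
      (fun b t => better A Z Z' b (σ, κ, t)) b) (fun b => b.1 ≤ N ∧ b.2.length ≤ N)
      (fun b hb κ hκ => hb2 b hb σ κ hσ (by simp at hκ; omega)) b hb
  rw [foldl_triples]
  refine (Run.counter .rr .sr .sv _ r (r * (r * (24 * N ^ 3 + 160 * N ^ 2 + 400 * N + 420) + 30) + 10)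
    (fun b => s.keep b) (fun b σ => (List.range' 1 r).foldl (fun b κ => (List.range' 1 r).foldl
      (fun b t => better A Z Z' b (σ, κ, t)) b) b) (fun b => b.1 ≤ N ∧ b.2.length ≤ N)
    (by decide) (by decide) (by intro b; simp [St.keep, St.set_var, hrr, h1, hsr, hsv])
    (fun b j hj hb => hb1 b hb (j + 1) (by omega)) ?_ b ⟨hb, hb'⟩).cast ?_ rfl
  · intro b σ n₁ hσ hb
    have := Run.counter .rr .kr .kv (.seq (.copy .rr .tr .t1) <| .seq (.forEach .tr <|
        .seq (.pop .tr) <| .seq (.push .tv .pos) (AlgLearn.body A)) (.clear .tv)) r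
      (r * (24 * N ^ 3 + 160 * N ^ 2 + 400 * N + 420) + 10)
      (fun b => ((s.keep b).set .sr (List.replicate n₁ .pos)).set .sv
        (List.replicate (σ + 1) .pos)) (fun b κ => (List.range' 1 r).foldl
      (fun b t => better A Z Z' b (σ + 1, κ, t)) b) (fun b => b.1 ≤ N ∧ b.2.length ≤ N)
      (by decide) (by decide) (by intro b; simp [St.keep, St.set_var, hrr, h1, hkr, hkv])
      (fun b j hj hb => hb2 b hb (σ + 1) (j + 1) (by omega) (by omega)) ?_ b hb
    · refine this.cast ?_ rfl
      ring_nf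
      omega
    · intro b κ n₂ hκ hb
      refine (Run.counter .rr .tr .tv (AlgLearn.body A) r
        (24 * N ^ 3 + 160 * N ^ 2 + 400 * N + 400)
        (fun b => ((((s.keep b).set .sr (List.replicate n₁ .pos)).set .sv
          (List.replicate (σ + 1) .pos)).set .kr (List.replicate n₂ .pos)).set .kv
          (List.replicate (κ + 1) .pos)) (fun b t => better A Z Z' b (σ + 1, κ + 1, t))
        (fun b => b.1 ≤ N ∧ b.2.length ≤ N)
        (by decide) (by decide) (by intro b; simp [St.keep, St.set_var, hrr, h1, htr, htv])
        (fun b j hj hb => hb3 b hb (σ + 1) (κ + 1) (j + 1) (by omega) (by omega) (by omega)) ?_ b hb).cast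
        le_rfl rfl
      intro b t n₃ ht hb
      have := (Run.body A Z Z' ((((((s.set .sr (List.replicate n₁ .pos)).set .sv
        (List.replicate (σ + 1) .pos)).set .kr (List.replicate n₂ .pos)).set .kv
        (List.replicate (κ + 1) .pos)).set .tr (List.replicate n₃ .pos)).set .tv
        (List.replicate (t + 1) .pos))
        ((((((hs.set _ _ (by decide)).set _ _ (by decide)).set _ _ (by decide)).set _ _
          (by decide)).set _ _ (by decide)).set _ _ (by decide)) b (σ + 1) (κ + 1) (t + 1) N
        (by omega) (by omega) (by omega) (by simpa [St.set_var] using hN) hb.1 hb.2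
        (by simp [St.set_var]) (by simp [St.set_var]) (by simp)).2.2
      refine (this.congr ?_).cast le_rfl ?_
      · refine St.ext' (by simp [St.keep]) (by simp [St.keep]) fun z => ?_
        cases z <;> simp [St.set_var, St.keep]
      · refine St.ext' (by simp [St.keep]) (by simp [St.keep]) fun z => ?_
        cases z <;> simp [St.set_var, St.keep]
  · have hT : r * (r * (r * (24 * N ^ 3 + 160 * N ^ 2 + 400 * N + 420) + 30) + 30) ≤
        N * (N * (N * (24 * N ^ 3 + 160 * N ^ 2 + 400 * N + 420) + 30) + 30) := by gcongr
    exact Nat.add_le_add_right hT 10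

/-! ### The program: preparation -/

section
variable {Q τ : Type}

/-- Split the input into the two datasets and count the examples of the second one. -/
def splitInput : Prog (Reg Q) Var τ :=
  .seq (.loop (fun v => decide (v.top .inp ≠ some .bar))
    (.xfer .inp fun z => decide (z = .zr))) <|
  .seq (.pop .inp) <| .seq (.moveAll .inp .t1) <|
  .forEach .t1 (.seq (.ite (fun v => decide (v.top .t1 = some .sep)) (.push .mc .pos) .skip)
    (.xfer .t1 fun z => decide (z = .zp)))

/-- The first part arrives on `zr` reversed, as `Run.build` needs it. The second part passes through
`t1` and so keeps its order; its separators are counted, one for each example. -/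
theorem Run.splitInput (s : St (Reg Q) Var τ) (u v : List Letter) (hu : Letter.bar ∉ u)
    (hin : s.var .inp = u ++ .bar :: v) (hzr : s.var .zr = []) (hzp : s.var .zp = [])
    (hmc : s.var .mc = []) (ht : s.var .t1 = []) :
    Run splitInput s (3 * u.length + 10 * v.length + 10)
      ((((s.set .inp []).set .zr u.reverse).set .mc (List.replicate (v.count .sep) .pos)).set .zp
        v) := by
  have h1 := Run.foldl (c := fun v => decide (v.top Var.inp ≠ some Letter.bar))
    (p := .xfer Var.inp fun z => decide (z = Var.zr))
    (fun b l => (s.set Var.zr b).set Var.inp (l ++ .bar :: v)) (fun b a => a :: b)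
    (fun _ l => Letter.bar ∉ l) 2 (by simp) (by simp; tauto) (fun b a l _ => by
      refine (Run.xfer_one Var.inp Var.zr (by decide) _ a (l ++ .bar :: v) (by simp)).cast le_rfl ?_
      refine St.ext' rfl rfl fun z => ?_
      simp only [St.set_var]
      split_ifs <;> simp_all) (by simp) [] u hu
  have hf : ∀ l b : List Letter, l.foldl (fun b a => a :: b) b = l.reverse ++ b := by
    intro l
    induction l with
    | nil => simp
    | cons a l ih => simp [ih]
  rw [hf] at h1
  have h2 := Run.forEach (p := .seq (.ite (fun v => decide (v.top Var.t1 = some .sep))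
      (.push Var.mc .pos) .skip) (.xfer Var.t1 fun z => decide (z = Var.zp))) Var.t1
    (fun b : ℕ × List Letter => (((s.set .inp []).set .zr u.reverse).set .mc
      (List.replicate b.1 .pos)).set .zp b.2)
    (fun b a => (if a = .sep then b.1 + 1 else b.1, a :: b.2)) (fun _ _ => True) 6 (by simp)
    (fun b a l _ => by
      refine (Run.seq (Run.ite (T := 2) (s' := ((((s.set .inp []).set .zr u.reverse).set .mc
        (List.replicate (if a = .sep then b.1 + 1 else b.1) .pos)).set .zp b.2).set .t1 (a :: l))
        ?_ ?_) (Run.xfer_one Var.t1 Var.zp (by decide) _ a l (by simp))).cast (by omega) ?_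
      · intro h
        refine (Run.push _ _ _).cast le_rfl ?_
        have h : a = .sep := by simpa using h
        refine St.ext' rfl rfl fun z => ?_
        cases z <;> simp [St.set_var, h, List.replicate_succ]
      · intro h
        have h : ¬ a = .sep := by simpa using h
        simp only [h, if_false]
        exact Run.skip _
      · refine St.ext' rfl rfl fun z => ?_
        cases z <;> simp [St.set_var]) (0, []) v.reverse trivial
  have hf' : ∀ (l : List Letter) (b : ℕ × List Letter),
      l.foldl (fun b a => (if a = .sep then b.1 + 1 else b.1, a :: b.2)) b =
        (l.count .sep + b.1, l.reverse ++ b.2) := by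
    intro l
    induction l with
    | nil => simp
    | cons a l ih =>
      intro b
      simp only [List.foldl_cons, ih, List.count_cons]
      by_cases h : a = .sep <;> (simp [h]; try omega)
  rw [hf'] at h2
  apply Run.cast
  · apply Run.seq (h1.congr ?_)
    · apply Run.seq (Run.pop _ _)
      apply Run.seq (Run.moveOf Var.inp Var.t1 v _ (by simp) (by simp [St.set_var, ht]) (by decide))
      refine h2.congr ?_
      refine St.ext' rfl rfl fun z => ?_
      cases z <;> simp [St.set_var, hmc, hzp]
    · refine St.ext' rfl rfl fun z => ?_
      cases z <;> simp [St.set_var, hzr, hin]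
  · simp only [List.length_reverse]
    omega
  · refine St.ext' rfl rfl fun z => ?_
    cases z <;> simp [St.set_var, ht]

theorem count_sep_dataL {d : ℕ} (Z : Dataset d) : (dataL Z).count .sep = Z.length := by
  induction Z with
  | nil => rfl
  | cons z Z ih =>
    have h : ∀ l : List Bool, (l.map signL).count .sep = 0 := by
      intro l
      rw [List.count_eq_zero]
      intro hl
      obtain ⟨b, -, hb⟩ := List.mem_map.1 hl
      cases b <;> cases hb
    have h' : ¬ signL z.2 = .sep := by cases z.2 <;> simp [signL]
    rw [dataL, List.flatMap_cons, List.count_append, ← dataL, ih, exampleL]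
    simp only [List.count_append, h]
    simp [h', add_comm]

/-- Build the clock. -/
def makeClock : Prog (Reg Q) Var τ :=
  .seq (.copy .zr .cl .t1) <| .seq (.copy .zr .cl .t1) <| .seq (.copy .zp .cl .t1) <|
    .seq (.copy .zp .cl .t1) <| .seq (.copy .zp .cl .t1) (.push .cl .pos)

/-- Only the length of the clock matters. Copies of the data are long enough because every example
has at least three letters in dimension at least one. -/
theorem Run.makeClock (s : St (Reg Q) Var τ) (ht : s.var .t1 = []) (hc : s.var .cl = []) :
    ∃ w : List Letter, w.length = 2 * (s.var .zr).length + 3 * (s.var .zp).length + 1 ∧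
      Run makeClock s (12 * (s.var .zr).length + 18 * (s.var .zp).length + 12) (s.set .cl w) := by
  refine ⟨.pos :: (s.var .zp ++ (s.var .zp ++ (s.var .zp ++ (s.var .zr ++ s.var .zr)))), ?_, ?_⟩
  · simp only [List.length_cons, List.length_append]
    omega
  apply Run.cast
  · apply Run.seq (Run.copy _ _ _ (by decide) (by decide) (by decide) _ ht)
    apply Run.seq (Run.copy _ _ _ (by decide) (by decide) (by decide) _ (by simp [St.set_var, ht]))
    apply Run.seq (Run.copy _ _ _ (by decide) (by decide) (by decide) _ (by simp [St.set_var, ht]))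
    apply Run.seq (Run.copy _ _ _ (by decide) (by decide) (by decide) _ (by simp [St.set_var, ht]))
    apply Run.seq (Run.copy _ _ _ (by decide) (by decide) (by decide) _ (by simp [St.set_var, ht]))
    exact Run.push _ _ _
  · simp [St.set_var]
    omega
  · refine St.ext' rfl rfl fun z => ?_
    cases z <;> simp [St.set_var, hc]

/-- Multiply `kv` by `sv`. -/
def mulBy : Prog (Reg Q) Var τ :=
  .seq (.forEach .kv (.seq (.pop .kv) (.copy .sv .tv .t1))) (.moveAll .tv .kv)

theorem Run.mulBy (s : St (Reg Q) Var τ) (a i : ℕ) (hsv : s.var .sv = List.replicate i .pos)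
    (htv : s.var .tv = []) (ht : s.var .t1 = []) :
    Run mulBy (s.set .kv (List.replicate a .pos)) (a * (9 * i + 6) + 4)
      (s.set .kv (List.replicate (a * i) .pos)) := by
  have h : ∀ a b, Run (.forEach .kv (.seq (.pop .kv) (.copy .sv .tv .t1)))
      ((s.set .kv (List.replicate a .pos)).set .tv (List.replicate b .pos)) (a * (6 * i + 6) + 1)
      ((s.set .kv []).set .tv (List.replicate (a * i + b) .pos)) := by
    intro a
    induction a with
    | zero =>
      intro b
      refine (Run.loop_false (by simp [St.set_var])).cast (by omega) (by simp)
    | succ a ih =>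
      intro b
      refine (Run.loop_true (T := 6 * i + 5) (by simp [St.set_var, List.replicate_succ])
        (((Run.pop _ _).seq (Run.copy _ _ _ (by decide) (by decide) (by decide) _
          (by simp [St.set_var, ht]))).cast ?_ rfl) ((ih (i + b)).congr ?_)).cast ?_ ?_
      · simp [St.set_var, hsv]
        omega
      · refine St.ext' rfl rfl fun z => ?_
        cases z <;> simp [St.set_var, hsv]
      · ring_nf
        omega
      · congr 2
        ring
  apply Run.cast
  · apply Run.seq ((h a 0).congr (by
      refine St.ext' rfl rfl fun z => ?_
      cases z <;> simp [St.set_var, htv]))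
    exact Run.moveOf Var.tv Var.kv (List.replicate (a * i) .pos) _ (by simp) (by simp [St.set_var])
      (by decide)
  · simp only [List.length_replicate]
    ring_nf
    omega
  · refine St.ext' rfl rfl fun z => ?_
    cases z <;> simp [St.set_var, htv]

/-- Increase `rr` if the tenth power of `sv` is at most `mc`. -/
def rootStep : Prog (Reg Q) Var τ :=
  .seq (.push .kv .pos) <| .seq (.rep mulBy 10) <| .seq (.copy .mc .tr .t1) <|
  .seq (.push .tr .pos) <| .seq (.forEach .kv (.seq (.pop .kv) (.pop .tr))) <|
  .seq (.ite (fun v => (v.top .tr).isSome) (.push .rr .pos) .skip) (.clear .tr)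

/-- The tenth power is computed in unary by ten multiplications, which is polynomial in `M` because
the exponent is fixed. The test `i ^ 10 ≤ M` asks whether `M + 1 - i ^ 10` is nonzero. -/
theorem Run.rootStep (s : St (Reg Q) Var τ) (b i M : ℕ) (hi : i ≤ M)
    (hsv : s.var .sv = List.replicate i .pos) (hmc : s.var .mc = List.replicate M .pos)
    (hkv : s.var .kv = []) (htv : s.var .tv = []) (htr : s.var .tr = []) (ht : s.var .t1 = []) :
    Run rootStep (s.set .rr (List.replicate b .pos))
      ((M + 1) ^ 10 * (90 * M + 65) + 9 * M + 70)
      (s.set .rr (List.replicate (if i ^ 10 ≤ M then b + 1 else b) .pos)) := by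
  -- All intermediate powers are at most `(M + 1) ^ 10`; the base `M + 1` is positive, so this also
  -- covers `M = 0`.
  have hpow := Run.rep (p := AlgLearn.mulBy) (fun j => (s.set .rr (List.replicate b .pos)).set .kv
    (List.replicate (i ^ j) .pos)) 10 ((M + 1) ^ 10 * (9 * M + 6) + 4) (fun j hj => by
      refine (Run.mulBy (s.set .rr (List.replicate b .pos)) (i ^ j) i (by simp [St.set_var, hsv])
        (by simp [St.set_var, htv]) (by simp [St.set_var, ht])).cast ?_ (by rw [pow_succ])
      have h1 : i ^ j ≤ (M + 1) ^ 10 :=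
        (Nat.pow_le_pow_left (by omega) j).trans (Nat.pow_le_pow_right (by omega) (by omega))
      gcongr)
  have hi10 : i ^ 10 ≤ (M + 1) ^ 10 := Nat.pow_le_pow_left (by omega) 10
  apply Run.cast
  · apply Run.seq (Run.push _ _ _)
    apply Run.seq (hpow.congr (by
      refine St.ext' rfl rfl fun z => ?_
      cases z <;> simp [St.set_var, hkv]))
    apply Run.seq (Run.copyOf Var.mc Var.tr Var.t1 (List.replicate M .pos) _
      (by simp [St.set_var, hmc]) (by simp [St.set_var, htr]) (by simp [St.set_var, ht])
      (by decide) (by decide) (by decide))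
    apply Run.seq (Run.push _ _ _)
    apply Run.seq (Run.sub .kv .tr (by decide) _ (i ^ 10) (M + 1) (by simp [St.set_var])
      (by simp [List.replicate_succ]))
    apply Run.seq (Run.ite (T := 2)
      (s' := (s.set .rr (List.replicate (if i ^ 10 ≤ M then b + 1 else b) .pos)).set .tr
        (List.replicate (M + 1 - i ^ 10) .pos)) ?_ ?_)
    · exact Run.clearOf Var.tr (List.replicate (M + 1 - i ^ 10) .pos) _ (by simp)
    · intro hc
      have hc' : i ^ 10 ≤ M := by
        by_contra h
        have : M + 1 - i ^ 10 = 0 := by omega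
        simp [this] at hc
      rw [if_pos hc']
      refine (Run.push _ _ _).cast le_rfl ?_
      refine St.ext' rfl rfl fun z => ?_
      cases z <;> simp [St.set_var, hkv, List.replicate_succ]
    · intro hc
      have hc' : ¬ i ^ 10 ≤ M := by
        intro h
        obtain ⟨j, hj⟩ := Nat.exists_eq_succ_of_ne_zero (show M + 1 - i ^ 10 ≠ 0 by omega)
        simp [hj, List.replicate_succ] at hc
      rw [if_neg hc']
      refine (Run.skip _).cast le_rfl ?_
      refine St.ext' rfl rfl fun z => ?_
      cases z <;> simp [St.set_var, hkv]
  · simp only [List.length_replicate]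
    generalize (M + 1) ^ 10 = B at *
    generalize i ^ 10 = a at *
    have : M + 1 - a ≤ M + 1 := Nat.sub_le _ _
    nlinarith
  · refine St.ext' rfl rfl fun z => ?_
    cases z <;> simp [St.set_var, htr]

end
section
variable {Q τ : Type}

/-- Compute the range of the loops. -/
def makeRoot : Prog (Reg Q) Var τ :=
  .seq (.copy .mc .sr .t1) (.seq (.forEach .sr (.seq (.pop .sr) (.seq (.push .sv .pos) rootStep)))
    (.clear .sv))

theorem Run.makeRoot (s : St (Reg Q) Var τ) (M : ℕ) (hmc : s.var .mc = List.replicate M .pos)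
    (hrr : s.var .rr = [])
    (hem : ∀ z, z ∈ [Var.sv, .sr, .kv, .tv, .tr, .t1] → s.var z = []) :
    Run makeRoot s (M * ((M + 1) ^ 10 * (90 * M + 65) + 9 * M + 90) + 10)
      (s.set .rr (List.replicate (loopBound M) .pos)) := by
  simp only [List.mem_cons, forall_eq_or_imp, List.not_mem_nil, false_imp_iff, implies_true,
    and_true] at hem
  obtain ⟨hsv, hsr, hkv, htv, htr, ht⟩ := hem
  have h := Run.counter (β := ℕ) Var.mc Var.sr Var.sv AlgLearn.rootStep M
    ((M + 1) ^ 10 * (90 * M + 65) + 9 * M + 70) (fun b => s.set .rr (List.replicate b .pos))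
    (fun b i => if i ^ 10 ≤ M then b + 1 else b) (fun _ => True) (by decide) (by decide)
    (by intro b; simp [St.set_var, hmc, hsv, hsr, ht]) (by simp) (fun b j n hj _ => by
      refine ((Run.rootStep ((s.set .sr (List.replicate n .pos)).set .sv
        (List.replicate (j + 1) .pos)) b (j + 1) M (by omega) (by simp)
        (by simp [St.set_var, hmc]) (by simp [St.set_var, hkv]) (by simp [St.set_var, htv])
        (by simp [St.set_var, htr]) (by simp [St.set_var, ht])).congr ?_).cast le_rfl ?_
      all_goals
        refine St.ext' rfl rfl fun z => ?_
        cases z <;> simp [St.set_var]) 0 trivial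
  rw [foldl_loopBound] at h
  refine (h.congr ?_).cast le_rfl rfl
  refine St.ext' rfl rfl fun z => ?_
  cases z <;> simp [St.set_var, hrr]

/-- Extract the test data. -/
def makeTest : Prog (Reg Q) Var τ :=
  .seq (.copy .mc .sv .t1) <| .seq (.copy .rr .kv .t1) <|
  .seq (.forEach .kv (.seq (.pop .kv) (.pop .sv))) <| .seq (.copy .zp .test .t1) <|
  .seq (takeExamples .sv .test .t2) (.clear .t2)

/-- The last `r` examples are what remains when the first `M - r` are taken away, with `M - r`
computed on `sv`. -/
theorem Run.makeTest (s : St (Reg Q) Var τ) {d : ℕ} (Z' : Dataset d) (r : ℕ)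
    (hr : r ≤ Z'.length) (hmc : s.var .mc = List.replicate Z'.length .pos)
    (hrr : s.var .rr = List.replicate r .pos) (hzp : s.var .zp = dataL Z')
    (hem : ∀ z, z ∈ [Var.sv, .kv, .test, .t1, .t2] → s.var z = []) (N : ℕ)
    (hN : (dataL Z').length ≤ N) (hN' : Z'.length ≤ N) (hd : d ≤ N) :
    Run makeTest s (3 * N * N + 50 * N + 20) (s.set .test (dataL (Z'.rtake r))) := by
  simp only [List.mem_cons, forall_eq_or_imp, List.not_mem_nil, false_imp_iff, implies_true,
    and_true] at hem
  obtain ⟨hsv, hkv, htest, h1, h2⟩ := hem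
  have ht := length_dataL_take_le Z' (Z'.length - r)
  apply Run.cast
  · apply Run.seq (Run.copyOf Var.mc Var.sv Var.t1 _ _ hmc hsv h1 (by decide) (by decide)
      (by decide))
    apply Run.seq (Run.copyOf Var.rr Var.kv Var.t1 (List.replicate r .pos) _
      (by simp [St.set_var, hrr]) (by simp [St.set_var, hkv]) (by simp [St.set_var, h1])
      (by decide) (by decide) (by decide))
    apply Run.seq (Run.sub Var.kv Var.sv (by decide) _ r Z'.length (by simp)
      (by simp [St.set_var]))
    apply Run.seq (Run.copyOf Var.zp Var.test Var.t1 (dataL Z') _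
      (by simp [St.set_var, hzp]) (by simp [St.set_var, htest]) (by simp [St.set_var, h1])
      (by decide) (by decide) (by decide))
    apply Run.seq (Run.takeExamples Var.sv Var.test Var.t2 (by decide) (by decide) (by decide) _
      Z' (Z'.length - r) (by omega) (by simp [St.set_var]) (by simp))
    exact Run.clearOf Var.t2 (dataL (Z'.take (Z'.length - r))).reverse _
      (by simp [St.set_var, h2])
  · simp only [List.length_replicate, List.length_reverse]
    generalize (dataL (Z'.take (Z'.length - r))).length = a at *
    generalize (dataL Z').length = b at *
    have : Z'.length - r ≤ N := by omega
    have := Nat.mul_le_mul this (show 3 * d + 9 ≤ 3 * N + 9 by omega)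
    generalize (Z'.length - r) * (3 * d + 9) = c at *
    generalize Z'.length = m at *
    nlinarith
  · refine St.ext' rfl rfl fun z => ?_
    cases z <;> simp [St.set_var, hsv, hkv, h2, List.rtake]

end

variable {e : ℕ}

/-- The whole program. -/
def mainProg (A : Machine e) : Prog (Reg A.State) Var (Fin (e + 2)) :=
  .seq splitInput <| .seq makeClock <| .seq makeRoot <| .seq makeTest <|
  .seq (.seq (.copy .rr .best .t1) (.push .best .pos)) (loops (body A))

/-- A bound for the running time of the program. -/
def timeBound (N : ℕ) : ℕ :=
  N * (N * (N * (24 * N ^ 3 + 160 * N ^ 2 + 400 * N + 420) + 30) + 30) +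
    N * ((N + 1) ^ 10 * (90 * N + 65) + 9 * N + 90) + 3 * N * N + 200 * N + 100

theorem Run.mainProg (A : Machine e) {d : ℕ} (hd : 1 ≤ d) (Z Z' : Dataset d)
    (hZ : 1 ≤ Z.length) (N : ℕ)
    (hN : 2 * (dataL Z).length + 3 * (dataL Z').length + 1 + d ≤ N) (hN' : Z'.length + 1 ≤ N) :
    ∃ s', s'.var .out = ((triples (loopBound Z'.length)).foldl (better A Z Z')
        (loopBound Z'.length + 1, [])).2 ∧
      Run (mainProg A) ⟨Reg.zero A.start, Function.update (fun _ => []) .inp (inputL Z Z'),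
        fun _ => Turing.Tape.mk₁ []⟩ (timeBound N) s' := by
  have hrM := loopBound_le Z'.length
  set s : St (Reg A.State) Var (Fin (e + 2)) :=
    ⟨Reg.zero A.start, Function.update (fun _ => []) .inp (inputL Z Z'),
      fun _ => Turing.Tape.mk₁ []⟩ with hs
  have hinp : s.var .inp = inputL Z Z' := by simp [hs]
  have hvar : ∀ z, z ≠ Var.inp → s.var z = [] := fun z hz => by simp [hs, hz]
  have h1 := Run.splitInput s (dataL Z) (dataL Z') (bar_notMem_dataL Z) hinp
    (hvar _ (by decide)) (hvar _ (by decide)) (hvar _ (by decide)) (hvar _ (by decide))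
  rw [count_sep_dataL] at h1
  set s₁ := (((s.set .inp []).set .zr (dataL Z).reverse).set .mc
    (List.replicate Z'.length .pos)).set .zp (dataL Z') with hs₁
  have hem₁ : ∀ z, z ∉ [Var.zr, .mc, .zp] → s₁.var z = [] := by
    intro z hz
    by_cases h : z = .inp
    · simp [hs₁, St.set_var, h]
    · simp only [List.mem_cons, List.not_mem_nil, or_false, not_or] at hz
      simp [hs₁, St.set_var, hz, hvar z h]
  have hzr₁ : s₁.var .zr = (dataL Z).reverse := by simp [hs₁, St.set_var]
  have hzp₁ : s₁.var .zp = dataL Z' := by simp [hs₁]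
  have hmc₁ : s₁.var .mc = List.replicate Z'.length .pos := by simp [hs₁, St.set_var]
  have hreg₁ : s₁.reg = Reg.zero A.start := rfl
  have htape₁ : s₁.tape = inTape [] := by
    funext i
    simp [hs₁, hs, inTape]
  clear_value s₁
  obtain ⟨w, hw, h2⟩ := Run.makeClock s₁ (hem₁ _ (by decide)) (hem₁ _ (by decide))
  rw [hzr₁, hzp₁, List.length_reverse] at hw h2
  have h3 := Run.makeRoot (s₁.set .cl w) Z'.length (by simp [St.set_var, hmc₁])
    (by simp [St.set_var, hem₁]) (by
      intro z hz
      rw [St.set_var, if_neg (by rintro rfl; revert hz; decide), hem₁]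
      revert hz
      cases z <;> decide)
  set r := loopBound Z'.length with hr
  have h4 := Run.makeTest ((s₁.set .cl w).set .rr (List.replicate r .pos)) Z' r hrM
    (by simp [St.set_var, hmc₁]) (by simp) (by simp [St.set_var, hzp₁]) (by
      intro z hz
      rw [St.set_var, if_neg (by rintro rfl; revert hz; decide),
        St.set_var, if_neg (by rintro rfl; revert hz; decide), hem₁]
      revert hz
      cases z <;> decide) N (by omega) (by omega) (by omega)
  -- The best count starts at `r + 1`, above any number of errors on `r` examples, and the output
  -- starts empty.
  have h5 : Run (.seq (.copy Var.rr Var.best Var.t1) (.push Var.best .pos))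
      (((s₁.set .cl w).set .rr (List.replicate r .pos)).set .test (dataL (Z'.rtake r)))
      (6 * r + 5)
      ((((s₁.set .cl w).set .rr (List.replicate r .pos)).set .test
        (dataL (Z'.rtake r))).keep (r + 1, [])) := by
    refine ((Run.copyOf Var.rr Var.best Var.t1 (List.replicate r .pos) _ (by simp [St.set_var])
      (by simp [St.set_var, hem₁]) (by simp [St.set_var, hem₁]) (by decide) (by decide)
      (by decide)).seq (Run.push _ _ _)).cast ?_ ?_
    · simp only [List.length_replicate]
      omega
    · refine St.ext' rfl rfl fun z => ?_
      cases z <;> simp [St.set_var, St.keep, hem₁, List.replicate_succ]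
  have hready : Ready A Z Z'
      (((s₁.set .cl w).set .rr (List.replicate r .pos)).set .test (dataL (Z'.rtake r))) := by
    refine ⟨hreg₁, htape₁, by simp [St.set_var, hzr₁], by simp [St.set_var, hzp₁],
      by simp [St.set_var, hmc₁], by simp [St.set_var, hr], by simp [hr], ?_, ?_⟩
    -- Here `m ≥ 1` is used: with code lengths `a ≥ 3` and `b ≥ 2M`, the clock length `2a + 3b + 1`
    -- is at least `a + b + 4M + 4`.
    · have hl : 3 ≤ (dataL Z).length := by
        rw [length_dataL]
        nlinarith
      have hl' : 2 * Z'.length ≤ (dataL Z').length := by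
        rw [length_dataL]
        nlinarith
      simp only [St.set_var, reduceCtorEq, if_false, if_true, hw]
      generalize (dataL Z).length = a at *
      generalize (dataL Z').length = b at *
      omega
    · intro z hz
      rw [St.set_var, if_neg (by rintro rfl; revert hz; decide),
        St.set_var, if_neg (by rintro rfl; revert hz; decide),
        St.set_var, if_neg (by rintro rfl; revert hz; decide), hem₁]
      revert hz
      cases z <;> decide
  have h6 := Run.loops A Z Z' _ hready (r + 1, []) N (by
      simp only [St.set_var, reduceCtorEq, if_false, if_true, hw]
      omega) (by simp only; omega) (by simp) (by
      intro z hz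
      rw [St.set_var, if_neg (by rintro rfl; revert hz; decide),
        St.set_var, if_neg (by rintro rfl; revert hz; decide),
        St.set_var, if_neg (by rintro rfl; revert hz; decide), hem₁]
      revert hz
      cases z <;> decide)
  refine ⟨_, ?_, (h1.seq (h2.seq (h3.seq (h4.seq (h5.seq h6))))).cast ?_ rfl⟩
  · simp [St.keep, hr]
  · have hT : Z'.length * ((Z'.length + 1) ^ 10 * (90 * Z'.length + 65) + 9 * Z'.length + 90) ≤
        N * ((N + 1) ^ 10 * (90 * N + 65) + 9 * N + 90) := by
      have : Z'.length ≤ N := by omega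
      gcongr
    unfold timeBound
    generalize Z'.length * ((Z'.length + 1) ^ 10 * (90 * Z'.length + 65) + 9 * Z'.length + 90) = a
      at *
    generalize N * ((N + 1) ^ 10 * (90 * N + 65) + 9 * N + 90) = b at *
    generalize N * (N * (N * (24 * N ^ 3 + 160 * N ^ 2 + 400 * N + 420) + 30) + 30) = c at *
    generalize (dataL Z).length = x at *
    generalize (dataL Z').length = y at *
    omega

/-! ### Correctness and running time of the machine -/

theorem Machine.runFrom_mono (U : Machine e) {t t' : ℕ} (h : t ≤ t') (c : U.Cfg) (w : List Sym)
    (hw : U.runFrom t c = some w) : U.runFrom t' c = some w := by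
  induction t generalizing t' c with
  | zero =>
    cases t' <;> simp only [Machine.runFrom] at hw ⊢ <;> cases hc : U.step c <;> simp_all
  | succ t ih =>
    obtain ⟨t', rfl⟩ : ∃ n, t' = n + 1 := ⟨t' - 1, by omega⟩
    simp only [Machine.runFrom] at hw ⊢
    cases hc : U.step c <;> simp_all

/-- The running minimum of the program meets the `argmin` of the definition. As `r ≤ M`, the test
set has exactly `r` elements, so the empirical error is the count divided by `r`. -/
theorem foldl_better (A : Machine e) {d : ℕ} (Z Z' : Dataset d) :
    ((triples (loopBound Z'.length)).foldl (better A Z Z') (loopBound Z'.length + 1, [])).2.map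
      Letter.sym = reduction A Z Z' := by
  have hrM := loopBound_le Z'.length
  have h := foldl_argmin (triples (loopBound Z'.length)) (errors A Z Z')
    (fun v => empErr (classifierOf d (candidate A Z Z' v)) (Z'.rtake (loopBound Z'.length)))
    (candL A Z Z') (loopBound Z'.length) (by intro h; simp [h, triples])
    (fun v => List.countP_le_length.trans (by simp [List.rtake]; omega))
    (fun v => by
      have : (Z'.rtake (loopBound Z'.length)).length = loopBound Z'.length := by
        simp [List.rtake]
        omega
      simp [empErr, errors, this]) []
  unfold reduction better
  simp only at h ⊢
  rw [h]
  split <;> simp_all [candL_spec]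

/-- A machine that implements the reduction in polynomial time. -/
theorem exists_reduction_machine (A : Machine e) : ∃ (e' : ℕ) (U : Machine e'),
    ∃ q : Polynomial ℕ, ∀ d : ℕ, 1 ≤ d → ∀ Z Z' : Dataset d, 1 ≤ Z.length →
      U.run (q.eval (d * (Z.length + Z'.length))) (codeInput Z Z') = some (reduction A Z Z') := by
  obtain ⟨e', U, hU⟩ := exists_machine (mainProg A) (Reg.zero A.start) Var.inp Var.out (by decide)
  -- With `x = d(m + M)` and `d + 2 ≤ 3d`, the size `2m(d + 2) + 3M(d + 2) + 1 + d` required by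
  -- `Run.mainProg` is at most `7dm + 9dM + 1 ≤ 10x + 1`.
  let P : Polynomial ℕ := 10 * .X + 1
  refine ⟨e', U, P * (P * (P * (24 * P ^ 3 + 160 * P ^ 2 + 400 * P + 420) + 30) + 30) +
    P * ((P + 1) ^ 10 * (90 * P + 65) + 9 * P + 90) + 3 * P * P + 200 * P + 100,
    fun d hd Z Z' hZ => ?_⟩
  have hx : d * (Z.length + Z'.length) = d * Z.length + d * Z'.length := by ring
  have h1 : Z.length ≤ d * Z.length := Nat.le_mul_of_pos_left _ hd
  have h2 : Z'.length ≤ d * Z'.length := Nat.le_mul_of_pos_left _ hd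
  have h3 : d ≤ d * Z.length := Nat.le_mul_of_pos_right _ hZ
  obtain ⟨s', hs', t, ht, hrun⟩ := Run.mainProg A hd Z Z' hZ
    (10 * (d * (Z.length + Z'.length)) + 1) (by
      simp only [length_dataL, mul_add, mul_comm _ d]
      omega) (by omega)
  have hrun := hU _ _ _ hrun
  rw [hs', foldl_better, ← codeInput_eq] at hrun
  refine U.runFrom_mono (ht.trans (le_of_eq ?_)) _ _ hrun
  simp [timeBound, P]

/-! ### Concentration -/

open ProbabilityTheory in
/-- Hoeffding's inequality for the empirical error. -/
theorem measureReal_err_deviation_le {d r : ℕ} (D : Measure (Example d)) [IsProbabilityMeasure D]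
    (c : Cube d → Bool) (η : ℝ) (hη : 0 < η) (hr : 0 < r) :
    (Measure.pi fun _ : Fin r => D).real {w | η < |(empErr c (List.ofFn w) : ℝ) - err D c|} ≤
      2 * Real.exp (-(2 * r * η ^ 2)) := by
  let f : Example d → ℝ := {z : Example d | c z.1 ≠ z.2}.indicator 1
  have hf : ∫ z, f z ∂D = err D c := by
    simp only [f]
    rw [integral_indicator_one (MeasurableSet.of_discrete)]
    rfl
  have hmem : ∀ z, f z ∈ Set.Icc (0 : ℝ) 1 := by
    intro z
    simp only [f, Set.indicator_apply, Pi.one_apply]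
    split_ifs <;> simp
  have hmem' : ∀ z, -f z ∈ Set.Icc (-1 : ℝ) 0 := fun z => by
    have := hmem z
    simp only [Set.mem_Icc] at this ⊢
    constructor <;> linarith
  -- The one-sided bound is applied to the error indicator and to its negative.
  have key : ∀ (g : Example d → ℝ) (a b : ℝ), (∀ z, g z ∈ Set.Icc a b) → b - a = 1 →
      (Measure.pi fun _ : Fin r => D).real
        {w | r * η ≤ ∑ i, (g (w i) - ∫ z, g z ∂D)} ≤ Real.exp (-(2 * r * η ^ 2)) := by
    intro g a b hg hab
    have hmg : Measurable g := Measurable.of_discrete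
    have hind : iIndepFun (fun (i : Fin r) (w : Fin r → Example d) => g (w i) - ∫ z, g z ∂D)
        (Measure.pi fun _ : Fin r => D) :=
      iIndepFun_pi (X := fun (_ : Fin r) z => g z - ∫ z, g z ∂D)
        fun i => Measurable.of_discrete.aemeasurable
    have hsub : ∀ i ∈ (Finset.univ : Finset (Fin r)),
        HasSubgaussianMGF (fun w : Fin r → Example d => g (w i) - ∫ z, g z ∂D)
          ((‖b - a‖₊ / 2) ^ 2) (Measure.pi fun _ : Fin r => D) := by
      intro i _
      have h := hasSubgaussianMGF_of_mem_Icc (μ := Measure.pi fun _ : Fin r => D)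
        (X := fun w : Fin r → Example d => g (w i)) (a := a) (b := b)
        Measurable.of_discrete.aemeasurable (Filter.Eventually.of_forall fun w => hg (w i))
      have hint : ∫ w, g (w i) ∂(Measure.pi fun _ : Fin r => D) = ∫ z, g z ∂D :=
        integral_comp_eval (μ := fun _ : Fin r => D) (i := i) hmg.aestronglyMeasurable
      rwa [hint] at h
    -- Each centered summand is sub-Gaussian with parameter `1/4`, so the exponent is `-(rη)² / (2 ·
    -- r/4) = -2rη²`.
    refine (HasSubgaussianMGF.measure_sum_ge_le_of_iIndepFun hind hsub
      (by positivity : 0 ≤ r * η)).trans (le_of_eq ?_)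
    congr 1
    have : (r : ℝ) ≠ 0 := by positivity
    simp only [hab, Finset.sum_const, Finset.card_univ, Fintype.card_fin, nsmul_eq_mul]
    simp
    field_simp
  have hemp : ∀ w : Fin r → Example d,
      (empErr c (List.ofFn w) : ℝ) * r = ∑ i, f (w i) := by
    intro w
    have : (r : ℝ) ≠ 0 := by positivity
    have hc : ∀ (n : ℕ) (w : Fin n → Example d),
        ((List.ofFn w).countP (fun z => c z.1 != z.2) : ℝ) = ∑ i, f (w i) := by
      intro n
      induction n with
      | zero => simp
      | succ n ih =>
        intro w
        rw [List.ofFn_succ, List.countP_cons, Fin.sum_univ_succ, Nat.cast_add, ih, add_comm]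
        congr 1
        by_cases h : c (w 0).1 = (w 0).2 <;> simp [f, h]
    simp only [empErr, List.length_ofFn]
    push_cast
    rw [hc]
    field_simp
  have h1 := key f 0 1 hmem (by norm_num)
  have h2 := key (fun z => -f z) (-1) 0 hmem' (by norm_num)
  rw [integral_neg] at h2
  rw [two_mul]
  refine le_trans (measureReal_mono ?_) ((measureReal_union_le _ _).trans (add_le_add h1 h2))
  intro w hw
  have hr' : (0 : ℝ) < r := by exact_mod_cast hr
  simp only [Set.mem_ofPred_eq, lt_abs, Set.mem_union, hf, Finset.sum_sub_distrib, Finset.sum_const,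
    Finset.card_univ, Fintype.card_fin, nsmul_eq_mul, Finset.sum_neg_distrib, ← hemp] at hw ⊢
  rcases hw with hw | hw
  · left
    nlinarith
  · right
    nlinarith

/-- Both measures agree on boxes. This allows the test examples to be split off as an independent
sample. -/
theorem measurePreserving_append {E : Type*} [MeasurableSpace E] (D : Measure E)
    [IsProbabilityMeasure D] (a b : ℕ) :
    MeasurePreserving (fun p : (Fin a → E) × (Fin b → E) => Fin.append p.1 p.2)
      ((Measure.pi fun _ : Fin a => D).prod (Measure.pi fun _ : Fin b => D))
      (Measure.pi fun _ : Fin (a + b) => D) := by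
  have hm : Measurable (fun p : (Fin a → E) × (Fin b → E) => Fin.append p.1 p.2) := by
    refine measurable_pi_lambda _ fun i => ?_
    induction i using Fin.addCases with
    | left i => simpa using measurable_fst.eval
    | right i => simpa using measurable_snd.eval
  refine ⟨hm, (Measure.pi_eq fun s hs => ?_).symm⟩
  rw [Measure.map_apply hm (MeasurableSet.univ_pi hs)]
  have : (fun p : (Fin a → E) × (Fin b → E) => Fin.append p.1 p.2) ⁻¹' Set.univ.pi s =
      (Set.univ.pi fun i => s (Fin.castAdd b i)) ×ˢ (Set.univ.pi fun i => s (Fin.natAdd a i)) := by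
    ext p
    simp [Set.mem_pi, Fin.forall_fin_add]
  rw [this, Measure.prod_prod, Measure.pi_pi, Measure.pi_pi, Fin.prod_univ_add]

/-- Composed with `Fin.append`, the restriction is the first projection, which preserves measure
because the other factor is a probability measure. -/
theorem measurePreserving_castAdd {E : Type*} [MeasurableSpace E] (D : Measure E)
    [IsProbabilityMeasure D] (a b : ℕ) :
    MeasurePreserving (fun (w : Fin (a + b) → E) i => w (Fin.castAdd b i))
      (Measure.pi fun _ : Fin (a + b) => D) (Measure.pi fun _ : Fin a => D) := by
  have hm : Measurable (fun (w : Fin (a + b) → E) i => w (Fin.castAdd b i)) := by fun_prop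
  refine ⟨hm, ?_⟩
  rw [← (measurePreserving_append D a b).map_eq,
    Measure.map_map hm (measurePreserving_append D a b).measurable]
  have : (fun (w : Fin (a + b) → E) i => w (Fin.castAdd b i)) ∘
      (fun p : (Fin a → E) × (Fin b → E) => Fin.append p.1 p.2) = Prod.fst := by
    funext p i
    simp
  rw [this]
  exact measurePreserving_fst.map_eq

/-- A set of small slices is small. -/
theorem measureReal_prod_le {α β : Type*} [MeasurableSpace α] [MeasurableSpace β] (μ : Measure α)
    (ν : Measure β) [IsProbabilityMeasure μ] [IsProbabilityMeasure ν] (S : Set (α × β))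
    (hS : MeasurableSet S) (κ : ℝ) (h : ∀ a, ν.real (Prod.mk a ⁻¹' S) ≤ κ) :
    (μ.prod ν).real S ≤ κ := by
  obtain ⟨a⟩ := μ.nonempty_of_neZero
  have hκ : 0 ≤ κ := measureReal_nonneg.trans (h a)
  refine ENNReal.toReal_le_of_le_ofReal hκ ?_
  rw [Measure.prod_apply hS]
  calc ∫⁻ x, ν (Prod.mk x ⁻¹' S) ∂μ ≤ ∫⁻ _, ENNReal.ofReal κ ∂μ := by
        refine lintegral_mono fun a => ?_
        rw [ENNReal.le_ofReal_iff_toReal_le (measure_ne_top _ _) hκ]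
        exact h a
    _ = ENNReal.ofReal κ := by simp

/-! ### Optimality of the reduction -/

variable {e : ℕ}

theorem mem_triples (r s k t : ℕ) :
    (s, k, t) ∈ triples r ↔ (1 ≤ s ∧ s ≤ r) ∧ (1 ≤ k ∧ k ≤ r) ∧ 1 ≤ t ∧ t ≤ r := by
  simp only [triples, List.mem_flatMap, List.mem_map, List.mem_range'_1, Prod.mk.injEq]
  constructor
  · rintro ⟨s, hs, k, hk, t, ht, rfl, rfl, rfl⟩
    omega
  · rintro ⟨hs, hk, ht⟩
    exact ⟨s, by omega, k, by omega, t, by omega, rfl, rfl, rfl⟩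

theorem length_triples (r : ℕ) : (triples r).length = r ^ 3 := by
  simp [triples, List.length_flatMap]
  ring

/-- If all empirical errors are accurate, then the error of the reduction is almost minimal. -/
theorem err_reduction_le (A : Machine e) {d : ℕ} (D : Measure (Example d)) (Z Z' : Dataset d)
    (η : ℝ) (h : ∀ v ∈ triples (loopBound Z'.length),
      |(empErr (classifierOf d (candidate A Z Z' v)) (Z'.rtake (loopBound Z'.length)) : ℝ) -
        err D (classifierOf d (candidate A Z Z' v))| ≤ η)
    (v : ℕ × ℕ × ℕ) (hv : v ∈ triples (loopBound Z'.length)) :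
    err D (classifierOf d (reduction A Z Z')) ≤
      err D (classifierOf d (candidate A Z Z' v)) + 2 * η := by
  simp only [reduction]
  split
  · rename_i h0
    rw [List.argmin_eq_none] at h0
    simp [h0] at hv
  · rename_i u hu
    have h1 := List.le_of_mem_argmin hv hu
    have h2 := abs_le.1 (h u (List.argmin_mem hu))
    have h3 := abs_le.1 (h v hv)
    have h4 := (Rat.cast_le (K := ℝ)).2 h1
    linarith [h2.1, h3.2]

theorem boundedMachines_mono {s k s' k' : ℕ} (hs : s ≤ s') (hk : k ≤ k') :
    boundedMachines s k ⊆ boundedMachines s' k' := by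
  rintro B ⟨h1, h2⟩
  refine ⟨h1.trans hs, fun d hd Z hZ => ?_⟩
  obtain ⟨w, hw⟩ := Option.isSome_iff_exists.1 (h2 d hd Z hZ)
  rw [Option.isSome_iff_exists]
  exact ⟨w, B.runFrom_mono (Nat.pow_le_pow_right (by positivity) hk) _ _ hw⟩

/-- The failure probability of the tests is small for large test sets. -/
theorem test_failure_le (i j r : ℕ) (hr : 480 * 8 ^ 5 * 2 ^ (10 * i) * 2 ^ j ≤ r) :
    (r : ℝ) ^ 3 * (2 * Real.exp (-(2 * r * ((1 / 2 : ℝ) ^ (i + 2)) ^ 2))) ≤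
      (1 / 2 : ℝ) ^ (j + 1) := by
  have hr' : (480 * 8 ^ 5 * 2 ^ (10 * i) * 2 ^ j : ℝ) ≤ r := by exact_mod_cast hr
  set a : ℝ := 2 ^ i with ha
  set b : ℝ := 2 ^ j with hb
  have ha1 : 1 ≤ a := one_le_pow₀ (by norm_num)
  have hb1 : 1 ≤ b := one_le_pow₀ (by norm_num)
  have ha10 : (2 : ℝ) ^ (10 * i) = a ^ 10 := by rw [ha, ← pow_mul, mul_comm]
  rw [ha10] at hr'
  have hr1 : (1 : ℝ) ≤ r := by
    have : (1 : ℝ) ≤ a ^ 10 := one_le_pow₀ ha1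
    nlinarith
  have hx : 2 * (r : ℝ) * ((1 / 2 : ℝ) ^ (i + 2)) ^ 2 = r / (8 * a ^ 2) := by
    rw [pow_add, one_div, inv_pow, ← ha]
    field_simp
    norm_num
  have hd : (1 / 2 : ℝ) ^ (j + 1) = 1 / (2 * b) := by
    rw [pow_succ, one_div, inv_pow, ← hb]
    field_simp
  rw [hx, hd, Real.exp_neg]
  -- The exponential is bounded below by its fifth-order term: `r^5` beats the `r^3` of the union
  -- bound and leaves `r^2` for the constants. The exponent is `r / (8a²)`, hence `8 ^ 5` and `a ^
  -- 10`; and `480 = 4 · 120`.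
  have hexp := Real.pow_div_factorial_le_exp ((r : ℝ) / (8 * a ^ 2)) (by positivity) 5
  have h5 : ((r : ℝ) / (8 * a ^ 2)) ^ 5 / (Nat.factorial 5 : ℕ) =
      r ^ 5 / (120 * 8 ^ 5 * a ^ 10) := by
    have : ((Nat.factorial 5 : ℕ) : ℝ) = 120 := by norm_num [Nat.factorial]
    rw [this]
    field_simp
  rw [h5] at hexp
  have hbound : 4 * b * (r : ℝ) ^ 3 ≤ r ^ 5 / (120 * 8 ^ 5 * a ^ 10) := by
    rw [le_div_iff₀ (by positivity)]
    -- The hypothesis bounds `r` itself, and `r ≤ r²` as `r ≥ 1`.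
    have h2 : 480 * 8 ^ 5 * a ^ 10 * b ≤ (r : ℝ) ^ 2 := by nlinarith
    calc 4 * b * (r : ℝ) ^ 3 * (120 * 8 ^ 5 * a ^ 10) =
        (r : ℝ) ^ 3 * (480 * 8 ^ 5 * a ^ 10 * b) := by ring
      _ ≤ (r : ℝ) ^ 3 * (r : ℝ) ^ 2 := by gcongr
      _ = (r : ℝ) ^ 5 := by ring
  have hE : 0 < Real.exp ((r : ℝ) / (8 * a ^ 2)) := Real.exp_pos _
  rw [← div_eq_mul_inv, mul_div_assoc', div_le_div_iff₀ hE (by positivity)]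
  nlinarith

/-- A candidate, as a function of the first part of the second dataset. -/
theorem candidate_append (A : Machine e) {d : ℕ} (Z Y W : Dataset d) (v : ℕ × ℕ × ℕ)
    (hv : v.2.2 ≤ Y.length) : candidate A Z (Y ++ W) v =
      (A.run (Y.length + W.length)
        (codeParams v.1 v.2.1 ++ codeInput Z (Y.take v.2.2))).getD [] := by
  rw [candidate, List.take_append_of_le_length hv, List.length_append]

/-- With high probability, all tests are accurate. -/
theorem measureReal_tests_le (A : Machine e) {d : ℕ} (D : Measure (Example d))
    [IsProbabilityMeasure D] (m n r : ℕ) (hr : r = loopBound (n + r)) (hn : r ≤ n) (h0 : 0 < r)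
    (η : ℝ) (hη : 0 < η) :
    ((Measure.pi fun _ : Fin m => D).prod (Measure.pi fun _ : Fin (n + r) => D)).real
      {S | ∃ v ∈ triples r,
        η < |(empErr (classifierOf d (candidate A (List.ofFn S.1) (List.ofFn S.2) v))
          ((List.ofFn S.2).rtake r) : ℝ) -
          err D (classifierOf d (candidate A (List.ofFn S.1) (List.ofFn S.2) v))|} ≤
      r ^ 3 * (2 * Real.exp (-(2 * r * η ^ 2))) := by
  -- The sample is regrouped as (first dataset, first `n` examples) and the last `r` examples. With
  -- the first group fixed, it suffices to bound each slice.
  have hmp := ((MeasurePreserving.id (Measure.pi fun _ : Fin m => D)).prod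
    (measurePreserving_append D n r)).comp (measurePreserving_prodAssoc
      (Measure.pi fun _ : Fin m => D) (Measure.pi fun _ : Fin n => D)
      (Measure.pi fun _ : Fin r => D))
  rw [← hmp.measureReal_preimage MeasurableSet.of_discrete.nullMeasurableSet]
  refine measureReal_prod_le _ _ _ MeasurableSet.of_discrete _ fun a => ?_
  -- The candidates do not depend on the test examples, so Hoeffding's inequality applies to each of
  -- them.
  let c : ℕ × ℕ × ℕ → Cube d → Bool := fun v => classifierOf d ((A.run (n + r)
    (codeParams v.1 v.2.1 ++
      codeInput (List.ofFn a.1) ((List.ofFn a.2).take v.2.2))).getD [])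
  have hsub : ∀ w : Fin r → Example d, ∀ v ∈ triples r,
      classifierOf d (candidate A (List.ofFn a.1) (List.ofFn a.2 ++ List.ofFn w) v) = c v := by
    rintro w ⟨s, k, t⟩ hv
    rw [mem_triples] at hv
    -- Here `t ≤ r ≤ n` enters: no candidate is trained on a test example.
    rw [candidate_append _ _ _ _ _ (by simp; omega)]
    simp [c]
  have hrt : ∀ w : Fin r → Example d,
      (List.ofFn a.2 ++ List.ofFn w).rtake r = List.ofFn w := by
    intro w
    simp [List.rtake]
  have hunion : ∀ L : List (ℕ × ℕ × ℕ), (Measure.pi fun _ : Fin r => D).real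
      {w | ∃ v ∈ L, η < |(empErr (c v) (List.ofFn w) : ℝ) - err D (c v)|} ≤
      L.length * (2 * Real.exp (-(2 * r * η ^ 2))) := by
    intro L
    induction L with
    | nil => simp
    | cons v L ih =>
      have : {w : Fin r → Example d | ∃ u ∈ v :: L,
          η < |(empErr (c u) (List.ofFn w) : ℝ) - err D (c u)|} =
          {w | η < |(empErr (c v) (List.ofFn w) : ℝ) - err D (c v)|} ∪
          {w | ∃ u ∈ L, η < |(empErr (c u) (List.ofFn w) : ℝ) - err D (c u)|} := by
        ext w
        simp
      rw [this]
      refine (measureReal_union_le _ _).trans ?_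
      have := measureReal_err_deviation_le D (c v) η hη h0
      simp only [List.length_cons]
      push_cast
      linarith
  refine (measureReal_mono ?_).trans ((hunion (triples r)).trans
    (by simp [length_triples]))
  rintro w ⟨v, hv, hw⟩
  refine ⟨v, hv, ?_⟩
  simp only [Function.comp, MeasurableEquiv.prodAssoc, Prod.map, List.ofFn_fin_append] at hw
  simpa [List.ofFn_fin_append, hsub w v hv, hrt w] using hw

theorem take_ofFn {α : Type*} {a b : ℕ} (f : Fin (a + b) → α) :
    (List.ofFn f).take a = List.ofFn fun i => f (Fin.castAdd b i) := by
  rw [← Fin.append_castAdd_natAdd (f := f), List.ofFn_fin_append]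
  simp

/-- The reduction is accurate with high probability if the algorithm is, with the parameters `s`
and `k` and on the first `t` examples. -/
theorem le_measureReal_reduction (A : Machine e) {d : ℕ} (D : Measure (Example d))
    [IsProbabilityMeasure D] (F : Set (Machine 0)) (m t l r s k i j : ℕ)
    (hr : r = loopBound (t + l + r)) (hn : r ≤ t + l) (hv : (s, k, t) ∈ triples r)
    (hC : 480 * 8 ^ 5 * 2 ^ (10 * i) * 2 ^ j ≤ r)
    (hrun : ∀ Z Y : Dataset d, Z.length = m → Y.length = t →
      (A.run (t + l + r) (codeParams s k ++ codeInput Z Y)).isSome)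
    (hgood : 1 - (1 / 2 : ℝ) ^ (j + 1) ≤
      ((Measure.pi fun _ : Fin m => D).prod (Measure.pi fun _ : Fin t => D)).real
        {S | ∀ B ∈ F, err D (classifierOf d (A.output
            (codeParams s k ++ codeInput (List.ofFn S.1) (List.ofFn S.2)))) ≤
          err D (classifierOf d (B.output (codeData (List.ofFn S.1)))) + (1 / 2 : ℝ) ^ (i + 1)}) :
    1 - (1 / 2 : ℝ) ^ j ≤
      ((Measure.pi fun _ : Fin m => D).prod (Measure.pi fun _ : Fin (t + l + r) => D)).real
        {S | ∀ B ∈ F, err D (classifierOf d (reduction A (List.ofFn S.1) (List.ofFn S.2))) ≤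
          err D (classifierOf d (B.output (codeData (List.ofFn S.1)))) + (1 / 2 : ℝ) ^ i} := by
  have h0 : 0 < r := by
    rw [mem_triples] at hv
    omega
  -- The guarantee for samples of size `t` is pulled back to the prefix of length `t` of the whole
  -- sample.
  have hmp := (MeasurePreserving.id (Measure.pi fun _ : Fin m => D)).prod
    ((measurePreserving_castAdd D t l).comp (measurePreserving_castAdd D (t + l) r))
  rw [← hmp.measureReal_preimage MeasurableSet.of_discrete.nullMeasurableSet] at hgood
  have htest := (measureReal_tests_le A D m (t + l) r hr hn h0 ((1 / 2) ^ (i + 2))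
    (by positivity)).trans (test_failure_le i j r hC)
  have hj : (1 / 2 : ℝ) ^ j = (1 / 2) ^ (j + 1) + (1 / 2) ^ (j + 1) := by ring
  rw [hj, ← sub_sub, sub_le_iff_le_add]
  refine hgood.trans ((measureReal_mono ?_).trans ((measureReal_union_le _ _).trans
    (add_le_add_right htest _)))
  rintro ⟨z, w⟩ hS
  -- The good event for `A` lies in the union of the good event for the reduction and the failure of
  -- some test, each failure having probability at most `δ/2`.
  rw [Set.mem_union, or_iff_not_imp_right]
  intro hT B hB
  have hS := hS B hB
  simp only [Prod.map, id, Function.comp] at hS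
  rw [Set.mem_ofPred_eq] at hT
  push Not at hT
  have hlen : (List.ofFn w).length = t + l + r := List.length_ofFn
  have h1 := err_reduction_le A D (List.ofFn z) (List.ofFn w) ((1 / 2) ^ (i + 2))
    (by rwa [hlen, ← hr]) (s, k, t) (by rwa [hlen, ← hr])
  have htake : (List.ofFn w).take t =
      List.ofFn fun i => w (Fin.castAdd r (Fin.castAdd l i)) := by
    rw [← take_ofFn fun i => w (Fin.castAdd r i), ← take_ofFn, List.take_take,
      min_eq_left (Nat.le_add_right t l)]
  have hcand : candidate A (List.ofFn z) (List.ofFn w) (s, k, t) = A.output (codeParams s k ++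
      codeInput (List.ofFn z) (List.ofFn fun i => w (Fin.castAdd r (Fin.castAdd l i)))) := by
    obtain ⟨c, hc⟩ := Option.isSome_iff_exists.1 (hrun (List.ofFn z)
      (List.ofFn fun i => w (Fin.castAdd r (Fin.castAdd l i))) (by simp) (by simp))
    simp only [candidate]
    rw [hlen, htake, hc, A.output_eq _ _ _ hc]
    rfl
  rw [hcand] at h1
  -- The loss is `ε/2` from `A` and `2 · ε/4` from the tests.
  have hi : (1 / 2 : ℝ) ^ i = (1 / 2) ^ (i + 1) + 2 * (1 / 2) ^ (i + 2) := by ring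
  rw [hi]
  linarith

/-- A sample size that suffices for the reduction. -/
noncomputable def sampleSize (s k : ℕ) (p : MvPolynomial (Fin 4) ℕ) (q : Polynomial ℕ) :
    MvPolynomial (Fin 4) ℕ :=
  -- The substitution doubles `1/ε` and `1/δ`, so that `A` is used with `ε/2` and `δ/2`. The summand
  -- `1` ensures `t ≥ 1`, where the loop over `t` begins.
  let T := MvPolynomial.bind₁ ![.X 0, .X 1, 2 * .X 2, 2 * .X 3] p + 1
  -- The sum is what `r` has to reach: `T`, `s` and `k` put the triple into the range of the loops,
  -- the value of `q` keeps the run of `A` within the time limit, and the last term makes the tests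
  -- reliable. The tenth power turns this into a condition on `M`.
  (T + .C s + .C k + Polynomial.aeval (.X 0 * (.X 1 + T)) q +
    .C (480 * 8 ^ 5) * .X 2 ^ 10 * .X 3) ^ 10

theorem eval_sampleSize (s k : ℕ) (p : MvPolynomial (Fin 4) ℕ) (q : Polynomial ℕ)
    (d m i j : ℕ) : MvPolynomial.eval ![d, m, 2 ^ i, 2 ^ j] (sampleSize s k p q) =
      ((MvPolynomial.eval ![d, m, 2 ^ (i + 1), 2 ^ (j + 1)] p + 1) + s + k +
        q.eval (d * (m + (MvPolynomial.eval ![d, m, 2 ^ (i + 1), 2 ^ (j + 1)] p + 1))) +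
        480 * 8 ^ 5 * 2 ^ (10 * i) * 2 ^ j) ^ 10 := by
  have h1 : MvPolynomial.eval ![d, m, 2 ^ i, 2 ^ j]
      (MvPolynomial.bind₁ ![.X 0, .X 1, 2 * .X 2, 2 * .X 3] p) =
      MvPolynomial.eval ![d, m, 2 ^ (i + 1), 2 ^ (j + 1)] p := by
    have h := MvPolynomial.eval₂Hom_bind₁ (RingHom.id ℕ) ![d, m, 2 ^ i, 2 ^ j]
      ![.X 0, .X 1, 2 * .X 2, 2 * .X 3] p
    refine h.trans ?_
    change MvPolynomial.eval _ p = _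
    congr 2
    funext a
    fin_cases a <;> simp [pow_succ, mul_comm]
  have h2 : ∀ y : MvPolynomial (Fin 4) ℕ, MvPolynomial.eval ![d, m, 2 ^ i, 2 ^ j]
      (Polynomial.aeval y q) = q.eval (MvPolynomial.eval ![d, m, 2 ^ i, 2 ^ j] y) := by
    intro y
    induction q using Polynomial.induction_on' with
    | add f g hf hg => simp [hf, hg]
    | monomial n a => simp [Polynomial.aeval_monomial]
  simp only [sampleSize, map_pow, map_add, map_mul, h1, h2, MvPolynomial.eval_X,
    MvPolynomial.eval_C, map_one]
  simp [← pow_mul, mul_comm i]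

end AlgLearn

/-! ### The theorem -/

theorem claim2 {e : ℕ} (A : Machine e)
    (hA : ∀ s k : ℕ, 1 ≤ s → 1 ≤ k → IsTuringOptimalFor s k A (codeParams s k)) :
    ∃ (e' : ℕ) (U : Machine e'), ImplementsReduction U A ∧ IsTuringOptimal U := by
  obtain ⟨e', U, qU, hU⟩ := exists_reduction_machine A
  refine ⟨e', U, fun d hd Z Z' hZ => ⟨_, hU d hd Z Z' hZ⟩, fun s k => ⟨⟨qU, ?_⟩, ?_⟩⟩
  · intro d hd Z Z' hZ
    rw [List.nil_append, hU d hd Z Z' hZ]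
    rfl
  -- The hypothesis and the loops need positive parameters, whereas `s` or `k` may be zero. Passing
  -- to `s + 1` and `k + 1` only enlarges the family of competitors.
  obtain ⟨⟨q, hq⟩, p, hp⟩ := hA (s + 1) (k + 1) (by omega) (by omega)
  refine ⟨sampleSize (s + 1) (k + 1) p q, fun i j d m M hd hm hM D _ => ?_⟩
  rw [eval_sampleSize] at hM
  set t := MvPolynomial.eval ![d, m, 2 ^ (i + 1), 2 ^ (j + 1)] p + 1 with ht
  have hr := (le_loopBound_iff _ _).2 hM
  have hrM := (le_loopBound_iff _ M).1 le_rfl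
  obtain ⟨r, hr_def⟩ : ∃ r, r = loopBound M := ⟨_, rfl⟩
  rw [← hr_def] at hr hrM
  -- The summands `s + 1` and `k + 1` of the sample size give `r ≥ 2`, whence `2r ≤ r^10 ≤ M`: the
  -- test examples and the first `r` examples do not overlap.
  have h2r : 2 * r ≤ M := by
    refine le_trans ?_ hrM
    calc 2 * r ≤ r * r := Nat.mul_le_mul_right _ (by omega)
      _ = r ^ 2 := (sq r).symm
      _ ≤ r ^ 10 := Nat.pow_le_pow_right (by omega) (by norm_num)
  -- The sample consists of `t` training examples for the decisive candidate, `l` examples that it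
  -- ignores, and `r` test examples.
  obtain ⟨l, rfl⟩ : ∃ l, M = t + l + r := ⟨M - r - t, by omega⟩
  have hgood := hp (i + 1) (j + 1) d m t hd hm (by omega) D
  have hmain := le_measureReal_reduction A D (boundedMachines (s + 1) (k + 1)) m t l r (s + 1)
    (k + 1) i j hr_def (by omega) ((mem_triples _ _ _ _).2 (by omega)) (by omega)
    -- The running time `q(d(m + t))` is one of the summands bounded by `r`, hence at most `M`.
    (fun Z Y hZ hY => by
      obtain ⟨w, hw⟩ := Option.isSome_iff_exists.1 (hq d hd Z Y (by omega))
      rw [hZ, hY] at hw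
      rw [Option.isSome_iff_exists]
      exact ⟨w, A.runFrom_mono (by omega) _ _ hw⟩) hgood
  refine hmain.trans (measureReal_mono ?_)
  intro S hS B hB
  rw [List.nil_append, U.output_eq _ _ _
    (hU d hd (List.ofFn S.1) (List.ofFn S.2) (by simpa using hm))]
  exact hS B (boundedMachines_mono (Nat.le_succ s) (Nat.le_succ k) hB)
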